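/- Let $n\ge 0$ and let $B^n$ be the set of crossingless matchings of $2n$ points on a line. For $a,b\in B^n$ let $W(b)a$ be the collection of circles obtained by gluing the reflection $W(b)$ of $b$ on top of $a$, let $|W(b)a|$ be the number of these circles, and let $V(S)$ be the free abelian group on the circles of a collection $S$. The group of the odd arc algebra is $$OH^n=\bigoplus_{a,b\in B^n} b(OH^n)a,\qquad b(OH^n)a=\textstyle\bigwedge^* V(W(b)a),$$ where $\bigwedge^k V(W(b)a)$ is in quantum degree $2k-|W(b)a|+n$. For each triple $a,b,c\in B^n$ choose a chronological cobordism $C_{cba}:W(c)bW(b)a\to W(c)a$: an order in which the arcs of $b$ are contracted with their mirror images in $W(b)$ by saddles, no arc being contracted before an arc surrounding it, and an orientation of each saddle that splits a circle. Put $C=(C_{cba})_{a,b,c}$. The odd functor $OF$ sends a merge of circles to the induced projection of exterior algebras, and a split of a circle into $b_1\to b_2$ to the map that replaces this circle by $b_1$ and multiplies by $b_1-b_2$ on the left. Let $OH^n_C$ be the (nonassociative) algebra $OH^n$ in which $xy=OF(C_{cba})(x\wedge y)$ for $x\in c(OH^n)b$, $y\in b(OH^n)a$, and the product of $d(OH^n)c$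 with $b(OH^n)a$ is zero for $c\neq b$. Let $\mathcal G^n\times\mathcal Z$ be the groupoid with set of objects $B^n$ whose morphisms $a\to b$ are the pairs $(W(b)a,m)$ with $m\in\mathbb Z$, with composition $(W(c)b,l)\circ(W(b)a,m)=(W(c)a,l+m)$. A homogeneous $x\in b(OH^n)a$ of quantum degree $m$ has degree $|x|=(W(b)a,m)$; this grades $OH^n_C$ and $OH^n_C\otimes_{\mathbb Z}\mathbb Z[i]$. Let $N_2(\mathcal G^n\times\mathcal Z)$ be the set of pairs of composable morphisms, and identify $\mathbb Z/4$ with $\mathbb Z[i]^*$ by $k\mapsto i^k$. For $\tau:N_2(\mathcal G^n\times\mathcal Z)\to\mathbb Z/4$, the twisted algebra $(OH^n_C\otimes_{\mathbb Z}\mathbb Z[i])_\tau$ is the $\mathbb Z[i]$-module $OH^n_C\otimes_{\mathbb Z}\mathbb Z[i]$ with the bilinear multiplication determined by $x*_\tau y=i^{\tau(|x|,|y|)}\,xy$ for homogeneous $x,y$ with composable degrees, and $x*_\tau y=0$ for homogeneous $x,y$ whose degrees are not composable. **Theorem.** For every $n\ge 0$ and every choice $C$ there is a map $\tau_C:N_2(\mathcal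 G^n\times\mathcal Z)\to\mathbb Z/4$ such that the twisted algebra $(OH^n_C\otimes_{\mathbb Z}\mathbb Z[i])_{\tau_C}$ is associative. -/

import Mathlib

open CategoryTheory
open scoped TensorProduct

/-! ## Crossingless matchings, circles, and the exterior algebra on circles -/

/-- A crossingless matching of `2n` points on a line, given by the map sending each point to the
other endpoint of its arc. -/
@[ext]
structure CrossinglessMatching (n : ℕ) where
  partner : Fin (2 * n) → Fin (2 * n)
  partner_partner : ∀ i, partner (partner i) = i
  partner_ne : ∀ i, partner i ≠ i
  noncrossing : ∀ i j, ¬ (i < j ∧ j < partner i ∧ partner i < partner j)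

noncomputable instance CrossinglessMatching.instFintype (n : ℕ) :
    Fintype (CrossinglessMatching n) :=
  Fintype.ofInjective CrossinglessMatching.partner fun _ _ h => CrossinglessMatching.ext h

/-- The adjacency relation of the closed diagram `W(b)a` on its `2n` points. -/
inductive GluedAdj {n : ℕ} (b a : CrossinglessMatching n) : Fin (2 * n) → Fin (2 * n) → Prop
  | lower (i : Fin (2 * n)) : GluedAdj b a i (a.partner i)
  | upper (i : Fin (2 * n)) : GluedAdj b a i (b.partner i)

/-- The diagrams between `W(c)bW(b)a` and `W(c)a`, on the `2n` points of the lower line (second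
coordinate `false`) and the `2n` points of the upper line (second coordinate `true`). The set `S`
consists of the endpoints of those arcs of `b` that have been contracted with their mirror image:
they are replaced by vertical strands. The matching `a` lies below the lower line, `W(c)` above the
upper line, and what is left of `bW(b)` lies in between. -/
inductive StackedAdj {n : ℕ} (c b a : CrossinglessMatching n) (S : Set (Fin (2 * n))) :
    Fin (2 * n) × Bool → Fin (2 * n) × Bool → Prop
  | lower (i : Fin (2 * n)) : StackedAdj c b a S (i, false) (a.partner i, false)
  | upper (i : Fin (2 * n)) : StackedAdj c b a S (i, true) (c.partner i, true)
  | cup (i : Fin (2 * n)) (side : Bool) (h : i ∉ S) :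
      StackedAdj c b a S (i, side) (b.partner i, side)
  | strand (i : Fin (2 * n)) (h : i ∈ S) : StackedAdj c b a S (i, false) (i, true)

/-- The circles of a diagram given by an adjacency relation `r` on its points, that is, the classes
of points under the equivalence relation generated by `r`. -/
abbrev Circles {P : Type} (r : P → P → Prop) : Type := Quot r

/-- The free abelian group `V(S)` on the circles of a diagram. -/
abbrev CircleGroup {P : Type} (r : P → P → Prop) : Type := Circles r →₀ ℤ

/-- The abelian group `OF(S) = ⋀ V(S)`. -/
abbrev OddF {P : Type} (r : P → P → Prop) : Type := ExteriorAlgebra ℤ (CircleGroup r)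

/-- The generator of `OF(S)` given by the circle through the point `p`. -/
noncomputable def circleGen {P : Type} (r : P → P → Prop) (p : P) : OddF r :=
  ExteriorAlgebra.ι ℤ (Finsupp.single (Quot.mk r p) 1)

/-- The map of exterior algebras induced by a map between sets of circles. -/
noncomputable def mapCircles {P Q : Type} {r : P → P → Prop} {s : Q → Q → Prop}
    (f : Circles r → Circles s) : OddF r →ₐ[ℤ] OddF s :=
  ExteriorAlgebra.map (Finsupp.lmapDomain ℤ ℤ f)

/-! ## Chronological contraction cobordisms and the odd functor -/

/-- A chronological cobordism `W(c)bW(b)a → W(c)a` which contracts the arcs of `b` one after the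
other, no arc being contracted before an arc that surrounds it. An arc is recorded by its left
endpoint, `arc t` is the arc contracted at time `t`, and `leftToRight t` orients the saddle at time
`t`: if this saddle is a split, the arrow goes from the circle through the left vertical strand to
the circle through the right one for `true`, and backwards for `false`. (Orientations of merges
play no role.) -/
structure ChronContraction {n : ℕ} (b : CrossinglessMatching n) where
  arc : Fin n ≃ {i : Fin (2 * n) // i < b.partner i}
  outer_first : ∀ s t : Fin n, (arc s : Fin (2 * n)) < arc t →
    b.partner (arc t) < b.partner (arc s) → s < t
  leftToRight : Fin n → Bool

/-- A choice of a chronological contraction cobordism `C_{cba}` for each triple `(c, b, a)`. -/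
def ContractionChoice (n : ℕ) : Type :=
  ∀ (_c b _a : CrossinglessMatching n), ChronContraction b

namespace ChronContraction

variable {n : ℕ} {b : CrossinglessMatching n} (C : ChronContraction b)

/-- The endpoints of the arcs contracted before time `t`. -/
def contracted (t : Fin (n + 1)) : Set (Fin (2 * n)) :=
  {i | ∃ s : Fin n, s.castSucc < t ∧ (i = C.arc s ∨ i = b.partner (C.arc s))}

theorem not_mem_contracted_zero (i : Fin (2 * n)) : i ∉ C.contracted 0 := by
  rintro ⟨s, hs, -⟩
  exact absurd hs (Fin.not_lt_zero _)

theorem mem_contracted_last (i : Fin (2 * n)) : i ∈ C.contracted (Fin.last n) := by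
  rcases lt_or_gt_of_ne (b.partner_ne i) with h | h
  · have h2 : b.partner i < b.partner (b.partner i) := by rwa [b.partner_partner]
    exact ⟨C.arc.symm ⟨_, h2⟩, Fin.castSucc_lt_last _, Or.inr (by simp [b.partner_partner])⟩
  · exact ⟨C.arc.symm ⟨_, h⟩, Fin.castSucc_lt_last _, Or.inl (by simp)⟩

/-- The diagram at time `t`, from `W(c)bW(b)a` at time `0` to `W(c)a` at time `n`. -/
abbrev diagram (c a : CrossinglessMatching n) (t : Fin (n + 1)) :
    Fin (2 * n) × Bool → Fin (2 * n) × Bool → Prop :=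
  StackedAdj c b a (C.contracted t)

/-- A circle before the saddle at time `t` is sent to a circle after this saddle which passes
through one of its points. For a merge this is the canonical projection of circles. For a split
of a circle into `b₁` and `b₂`, the circle which is split goes to one of `b₁`, `b₂`, and all other
circles go to themselves. -/
noncomputable def transport (c a : CrossinglessMatching n) (t : Fin n)
    (K : Circles (C.diagram c a t.castSucc)) : Circles (C.diagram c a t.succ) :=
  Quot.mk _ K.out

open scoped Classical in
/-- The value of the odd functor on the saddle at time `t`. The saddle is a split when both arcs to
be contracted belong to the same circle. A merge acts by the projection of circles, a split of a
circle into `b₁ → b₂` by replacing this circle by `b₁` (or `b₂`, with the same result) and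
multiplying by `b₁ - b₂` on the left. -/
noncomputable def saddle (c a : CrossinglessMatching n) (t : Fin n) :
    OddF (C.diagram c a t.castSucc) →ₗ[ℤ] OddF (C.diagram c a t.succ) :=
  let i : Fin (2 * n) := C.arc t
  let left := circleGen (C.diagram c a t.succ) (i, false)
  let right := circleGen (C.diagram c a t.succ) (b.partner i, false)
  let f := (mapCircles (C.transport c a t)).toLinearMap
  if Quot.mk (C.diagram c a t.castSucc) (i, false) = Quot.mk _ (i, true) then
    LinearMap.mulLeft ℤ (if C.leftToRight t then left - right else right - left) ∘ₗ f
  else f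

/-- The value of the odd functor on the part of the cobordism from time `0` to time `t`. -/
noncomputable def saddlesUpTo (c a : CrossinglessMatching n) (t : Fin (n + 1)) :
    OddF (C.diagram c a 0) →ₗ[ℤ] OddF (C.diagram c a t) :=
  Fin.induction (motive := fun t => OddF (C.diagram c a 0) →ₗ[ℤ] OddF (C.diagram c a t))
    LinearMap.id (fun t F => C.saddle c a t ∘ₗ F) t

/-- The identification of the circles of the diagram at time `n` with those of `W(c)a`. -/
def toGlued (c a : CrossinglessMatching n) :
    Circles (C.diagram c a (Fin.last n)) → Circles (GluedAdj c a) :=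
  Quot.lift (fun p => Quot.mk _ p.1) fun _ _ h => by
    cases h with
    | lower i => exact Quot.sound (.lower i)
    | upper i => exact Quot.sound (.upper i)
    | cup i _ h => exact absurd (C.mem_contracted_last i) h
    | strand => rfl

/-- The map `OF(C_{cba}) : OF(W(c)bW(b)a) → OF(W(c)a)`. -/
noncomputable def oddFunctor (c a : CrossinglessMatching n) :
    OddF (C.diagram c a 0) →ₗ[ℤ] OddF (GluedAdj c a) :=
  (mapCircles (C.toGlued c a)).toLinearMap ∘ₗ C.saddlesUpTo c a (Fin.last n)

/-- The inclusion of the circles of `W(b)a` in those of `W(c)bW(b)a`. -/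
def inclLower (c a : CrossinglessMatching n) :
    Circles (GluedAdj b a) → Circles (C.diagram c a 0) :=
  Quot.map (fun i => (i, false)) fun _ _ h => by
    cases h with
    | lower => exact .lower _
    | upper => exact .cup _ false (C.not_mem_contracted_zero _)

/-- The inclusion of the circles of `W(c)b` in those of `W(c)bW(b)a`. -/
def inclUpper (c a : CrossinglessMatching n) :
    Circles (GluedAdj c b) → Circles (C.diagram c a 0) :=
  Quot.map (fun i => (i, true)) fun _ _ h => by
    cases h with
    | lower => exact .cup _ true (C.not_mem_contracted_zero _)
    | upper => exact .upper _

/-- The product `(x, y) ↦ OF(C_{cba})(x ∧ y)`. -/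
noncomputable def product (c a : CrossinglessMatching n) :
    OddF (GluedAdj c b) →ₗ[ℤ] OddF (GluedAdj b a) →ₗ[ℤ] OddF (GluedAdj c a) :=
  ((LinearMap.mul ℤ (OddF (C.diagram c a 0))).compl₁₂
    (mapCircles (C.inclUpper c a)).toLinearMap
    (mapCircles (C.inclLower c a)).toLinearMap).compr₂ (C.oddFunctor c a)

end ChronContraction

/-! ## The odd arc algebra and its grading -/

/-- The group `OH^n`, the direct sum of the groups `b(OH^n)a = OF(W(b)a)` over the finitely many
pairs `(b, a)`. The component of `x` in `b(OH^n)a` is `x b a`. -/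
abbrev OH (n : ℕ) : Type :=
  ∀ b a : CrossinglessMatching n, OddF (GluedAdj b a)

/-- The multiplication of `OH^n_C`: the product of `d(OH^n)c` and `b(OH^n)a` is zero for `c ≠ b`,
and the product of `c(OH^n)b` and `b(OH^n)a` is given by `OF(C_{cba})`. -/
noncomputable def OH.mul {n : ℕ} (C : ContractionChoice n) : OH n →ₗ[ℤ] OH n →ₗ[ℤ] OH n :=
  LinearMap.mk₂ ℤ (fun x y c a => ∑ b, (C c b a).product c a (x c b) (y b a))
    (fun x x' y => by ext c a; simp [Finset.sum_add_distrib])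
    (fun k x y => by
      ext c a; simp only [Pi.smul_apply, map_smul, LinearMap.smul_apply, Finset.smul_sum])
    (fun x y y' => by ext c a; simp [Finset.sum_add_distrib])
    (fun k x y => by
      ext c a; simp only [Pi.smul_apply, map_smul, Finset.smul_sum])

/-- The groupoid `𝒢^n × 𝒵`: objects are the crossingless matchings, and a morphism from `a` to `b`
is the diagram `W(b)a` (the unique morphism of `𝒢^n` from `a` to `b`) together with an integer;
integers are added under composition. -/
abbrev ArcGroupoid (n : ℕ) : Type :=
  Codiscrete (CrossinglessMatching n) × SingleObj (Multiplicative ℤ)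

/-- The integer component of a morphism of `𝒢^n × 𝒵`. -/
def quantumDegree {n : ℕ} (g : Arrow (ArcGroupoid n)) : ℤ :=
  Multiplicative.toAdd (show Multiplicative ℤ from g.hom.2)

/-- The part of degree `m` of `b(OH^n)a = (⋀ V(W(b)a)){n - |W(b)a|}`, where the circles have
degree `2` in the exterior algebra. -/
noncomputable def quantumPiece {n : ℕ} (b a : CrossinglessMatching n) (m : ℤ) :
    Submodule ℤ (OddF (GluedAdj b a)) :=
  ⨆ (k : ℕ) (_ : 2 * (k : ℤ) - Nat.card (Circles (GluedAdj b a)) + n = m),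
    ⋀[ℤ]^k (CircleGroup (GluedAdj b a))

open scoped Classical in
/-- The inclusion of `b(OH^n)a` in `OH^n`. -/
noncomputable def OH.incl {n : ℕ} (b a : CrossinglessMatching n) :
    OddF (GluedAdj b a) →ₗ[ℤ] OH n :=
  LinearMap.single ℤ (fun b => ∀ a, OddF (GluedAdj b a)) b ∘ₗ
    LinearMap.single ℤ (fun a => OddF (GluedAdj b a)) a

/-- The homogeneous elements of `OH^n` whose degree is the given morphism of `𝒢^n × 𝒵`. -/
noncomputable def OH.piece {n : ℕ} (g : Arrow (ArcGroupoid n)) : Submodule ℤ (OH n) :=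
  (quantumPiece g.right.1.as g.left.1.as (quantumDegree g)).map
    (OH.incl g.right.1.as g.left.1.as)

open scoped Classical in
theorem isInternal_of_projections {ι R M : Type*} [Ring R] [AddCommGroup M] [Module R M]
    (P : ι → Submodule R M) (p : ι → M →ₗ[R] M) (h1 : ∀ i, ∀ x ∈ P i, p i x = x)
    (h2 : ∀ i j, i ≠ j → ∀ x ∈ P j, p i x = 0) (h3 : ⨆ i, P i = ⊤) :
    DirectSum.IsInternal P := by
  rw [DirectSum.isInternal_submodule_iff_iSupIndep_and_iSup_eq_top]
  refine ⟨fun i => ?_, h3⟩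
  rw [Submodule.disjoint_def]
  intro x hx hx2
  rw [← h1 i x hx]
  have : (⨆ (j) (_ : j ≠ i), P j) ≤ LinearMap.ker (p i) :=
    iSup₂_le fun j hj y hy => h2 i j hj.symm y hy
  exact this hx2

open scoped Classical in
/-- `OH^n` is the direct sum of its homogeneous parts. -/
theorem OH.isInternal_piece (n : ℕ) :
    DirectSum.IsInternal (OH.piece : Arrow (ArcGroupoid n) → Submodule ℤ (OH n)) := by
  let d (b a : CrossinglessMatching n) (k : ℕ) : ℤ :=
    2 * (k : ℤ) - Nat.card (Circles (GluedAdj b a)) + n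
  have hd : ∀ b a k l, d b a k = d b a l → k = l := by
    intro b a k l h
    simp only [d] at h
    omega
  -- the projection of `b(OH^n)a` to its part of degree `m`
  let q (b a : CrossinglessMatching n) (m : ℤ) : OddF (GluedAdj b a) →ₗ[ℤ] OddF (GluedAdj b a) :=
    if h : ∃ k, d b a k = m then
      GradedAlgebra.proj (fun i : ℕ => ⋀[ℤ]^i (CircleGroup (GluedAdj b a))) h.choose
    else 0
  have hq : ∀ b a m m' x, x ∈ quantumPiece b a m' → q b a m x = if m = m' then x else 0 := by
    intro b a m m' x hx
    have hle : quantumPiece b a m' ≤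
        LinearMap.eqLocus (q b a m) (if m = m' then LinearMap.id else 0) := by
      refine iSup₂_le fun k hk y hy => ?_
      rw [LinearMap.mem_eqLocus]
      change d b a k = m' at hk
      by_cases hm : m = m'
      · subst hm
        have hex : ∃ k, d b a k = m := ⟨k, hk⟩
        have hck : hex.choose = k := hd b a _ _ (hex.choose_spec.trans hk.symm)
        simp only [q, dif_pos hex, hck, if_true, LinearMap.id_apply, GradedAlgebra.proj_apply]
        exact DirectSum.decompose_of_mem_same _ hy
      · simp only [q, if_neg hm, LinearMap.zero_apply]
        split_ifs with hex
        · rw [GradedAlgebra.proj_apply]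
          refine DirectSum.decompose_of_mem_ne _ hy fun hkk => hm ?_
          rw [← hk, hkk, hex.choose_spec]
        · rfl
    have := hle hx
    rw [LinearMap.mem_eqLocus] at this
    rw [this]
    split_ifs <;> rfl
  let ev (b a : CrossinglessMatching n) : OH n →ₗ[ℤ] OddF (GluedAdj b a) :=
    LinearMap.proj a ∘ₗ LinearMap.proj b
  have hev : ∀ b a x, ev b a (OH.incl b a x) = x := by
    intro b a x
    simp [ev, OH.incl]
  have hev0 : ∀ b a b' a' x, ¬ (b = b' ∧ a = a') → ev b a (OH.incl b' a' x) = 0 := by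
    intro b a b' a' x h
    by_cases hb : b = b'
    · subst hb
      have ha : a ≠ a' := fun ha => h ⟨rfl, ha⟩
      simp [ev, OH.incl, ha]
    · simp [ev, OH.incl, hb]
  refine isInternal_of_projections _
    (fun g => OH.incl g.right.1.as g.left.1.as ∘ₗ
      q g.right.1.as g.left.1.as (quantumDegree g) ∘ₗ ev g.right.1.as g.left.1.as) ?_ ?_ ?_
  · rintro g _ ⟨x, hx, rfl⟩
    simp only [LinearMap.comp_apply, hev]
    rw [hq _ _ _ _ _ hx, if_pos rfl]
  · rintro g h hgh _ ⟨x, hx, rfl⟩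
    simp only [LinearMap.comp_apply]
    by_cases hba : g.right.1.as = h.right.1.as ∧ g.left.1.as = h.left.1.as
    · obtain ⟨⟨⟨gl⟩, gu⟩, ⟨⟨gr⟩, gv⟩, ⟨gh, gm⟩⟩ := g
      obtain ⟨⟨⟨hl⟩, hu⟩, ⟨⟨hr⟩, hv⟩, ⟨hh, hm⟩⟩ := h
      obtain ⟨h1, h2⟩ := hba
      dsimp only at h1 h2
      subst h1 h2
      dsimp only
      rw [hev, hq _ _ _ _ _ hx, if_neg, map_zero]
      intro hmm
      apply hgh
      have : gm = hm := hmm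
      subst this
      rfl
    · rw [hev0 _ _ _ _ _ hba, map_zero, map_zero]
  · rw [eq_top_iff]
    intro x _
    have hx : x = ∑ b, ∑ a, OH.incl b a (x b a) := by
      funext b a
      rw [Finset.sum_apply, Finset.sum_apply, Finset.sum_eq_single b, Finset.sum_apply,
        Finset.sum_apply, Finset.sum_eq_single a]
      · exact (hev b a _).symm
      · intro a' _ ha
        exact hev0 b a b a' _ fun h => ha h.2.symm
      · simp
      · intro b' _ hb
        rw [Finset.sum_apply, Finset.sum_apply]
        exact Finset.sum_eq_zero fun a' _ => hev0 b a b' a' _ fun h => hb h.1.symm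
      · simp
    rw [hx]
    refine Submodule.sum_mem _ fun b _ => Submodule.sum_mem _ fun a _ => ?_
    have htop : (⨆ k : ℕ, ⋀[ℤ]^k (CircleGroup (GluedAdj b a))) = ⊤ :=
      (DirectSum.Decomposition.isInternal
        (fun k : ℕ => ⋀[ℤ]^k (CircleGroup (GluedAdj b a)))).submodule_iSup_eq_top
    have hmem : x b a ∈ ⨆ k : ℕ, ⋀[ℤ]^k (CircleGroup (GluedAdj b a)) := htop ▸ trivial
    have hle : (⨆ k : ℕ, ⋀[ℤ]^k (CircleGroup (GluedAdj b a))) ≤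
        (⨆ g : Arrow (ArcGroupoid n), OH.piece g).comap (OH.incl b a) := by
      refine iSup_le fun k y hy => ?_
      let g : Arrow (ArcGroupoid n) :=
        Arrow.mk (X := ((⟨a⟩, SingleObj.star _) : ArcGroupoid n))
          (Y := ((⟨b⟩, SingleObj.star _) : ArcGroupoid n))
          ((), (Multiplicative.ofAdd (d b a k) : Multiplicative ℤ))
      refine Submodule.mem_iSup_of_mem g ⟨y, ?_, rfl⟩
      exact Submodule.mem_iSup_of_mem k (Submodule.mem_iSup_of_mem rfl hy)
    exact hle hmem

/-- The homogeneous elements of `OH^n ⊗ ℤ[i]` of a given degree. -/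
noncomputable def OH.gaussPiece {n : ℕ} (g : Arrow (ArcGroupoid n)) :
    Submodule GaussianInt (GaussianInt ⊗[ℤ] OH n) :=
  (OH.piece g).baseChange GaussianInt

open scoped Classical in
theorem OH.isInternal_gaussPiece (n : ℕ) :
    DirectSum.IsInternal
      (OH.gaussPiece : Arrow (ArcGroupoid n) → Submodule GaussianInt (GaussianInt ⊗[ℤ] OH n)) :=
  DirectSum.IsInternal.baseChange _ (OH.isInternal_piece n)

/-- The multiplication of `OH^n_C ⊗ ℤ[i]`. -/
noncomputable def OH.gaussMul {n : ℕ} (C : ContractionChoice n) :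
    (GaussianInt ⊗[ℤ] OH n) →ₗ[GaussianInt] (GaussianInt ⊗[ℤ] OH n) →ₗ[GaussianInt]
      (GaussianInt ⊗[ℤ] OH n) :=
  LinearMap.BilinMap.baseChange GaussianInt (OH.mul C)

/-! ## Twisting an algebra graded by a groupoid -/

section Twist

variable {Γ : Type*} [Category Γ] {R A : Type*} [CommRing R] [AddCommGroup A] [Module R A]

open scoped Classical in
/-- The coefficient `τ(g, h)` for composable morphisms `· ←g- · ←h- ·`. (For morphisms which
are not composable, the product of homogeneous elements of these degrees is zero.) -/
noncomputable def twistCoeff (τ : ComposableArrows Γ 2 → Rˣ) (g h : Arrow Γ) : R :=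
  if e : h.right = g.left then (τ (ComposableArrows.mk₂ h.hom (eqToHom e ≫ g.hom)) : R) else 0

open scoped Classical in
/-- The multiplication `(x, y) ↦ τ(|x|, |y|) xy`, for homogeneous `x` and `y`, of the twist by `τ` of
an algebra with multiplication `μ` which is the direct sum of its homogeneous parts `P g`. -/
noncomputable def twistMul (P : Arrow Γ → Submodule R A) (hP : DirectSum.IsInternal P)
    (μ : A →ₗ[R] A →ₗ[R] A) (τ : ComposableArrows Γ 2 → Rˣ) : A →ₗ[R] A →ₗ[R] A :=
  let e := (LinearEquiv.ofBijective (DirectSum.coeLinearMap P) hP).symm.toLinearMap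
  (DirectSum.toModule R (Arrow Γ) _ fun g =>
    (DirectSum.toModule R (Arrow Γ) _ fun h =>
      (twistCoeff τ g h • μ.domRestrict₁₂ (P g) (P h)).flip).flip).compl₁₂ e e

theorem twistMul_apply (P : Arrow Γ → Submodule R A) (hP) (μ : A →ₗ[R] A →ₗ[R] A)
    (τ : ComposableArrows Γ 2 → Rˣ) {g h : Arrow Γ} {x y : A} (hx : x ∈ P g) (hy : y ∈ P h) :
    twistMul P hP μ τ x y = twistCoeff τ g h • μ x y := by
  classical
  have key : ∀ (g : Arrow Γ) (x : A) (hx : x ∈ P g),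
      (LinearEquiv.ofBijective (DirectSum.coeLinearMap P) hP).symm x =
        DirectSum.lof R _ (fun i => P i) g ⟨x, hx⟩ := by
    intro g x hx
    rw [LinearEquiv.symm_apply_eq]
    exact (DirectSum.coeLinearMap_lof P g ⟨x, hx⟩).symm
  unfold twistMul
  rw [LinearMap.compl₁₂_apply]
  erw [key g x hx, key h y hy]
  simp only [DirectSum.toModule_lof, LinearMap.flip_apply, LinearMap.smul_apply]
  rfl

end Twist

/-- The unit `i` of `ℤ[i]`. -/
def gaussI : GaussianIntˣ := ⟨⟨0, 1⟩, ⟨0, -1⟩, by decide, by decide⟩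

/-- The isomorphism `ℤ/4 ≅ ℤ[i]^*`, `k ↦ i^k`. -/
def gaussUnit (k : ZMod 4) : GaussianIntˣ := gaussI ^ k.val

/-- The multiplication of `(OH^n_C ⊗ ℤ[i])_τ`. -/
noncomputable def OH.twistedMul {n : ℕ} (C : ContractionChoice n)
    (τ : ComposableArrows (ArcGroupoid n) 2 → ZMod 4) :
    (GaussianInt ⊗[ℤ] OH n) →ₗ[GaussianInt] (GaussianInt ⊗[ℤ] OH n) →ₗ[GaussianInt]
      (GaussianInt ⊗[ℤ] OH n) :=
  twistMul OH.gaussPiece (OH.isInternal_gaussPiece n) (OH.gaussMul C) fun F => gaussUnit (τ F)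

/-! Lift everything to the exterior algebra on the `2n` points of the line. Merges only identify
circles, and a split multiplies on the left by the difference of the two endpoints of the contracted
arc. So the product of `c(OH^n)b` and `b(OH^n)a` is `(X, Y) ↦ w ∧ X ∧ Y` followed by the projection
to the circles of `W(c)a`, where `w = w(c,b,a)` is the wedge of the endpoint differences of those
arcs of `b` whose saddles split a circle (`ChronContraction.product_eq`). The two bracketings of a
triple product over `d, c, b, a` therefore differ by a Koszul sign and by the prefactors `w(d,b,a) ∧
w(d,c,b)` and `w(d,c,a) ∧ w(c,b,a)`. Modulo the relations of `W(d)a` the two lists of vectors have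
equal length and span the same lattice, so the prefactors agree up to a sign `η`
(`exists_sign_wedge_splitVecs`). It remains to write `η` as a product of four signs, one for each
triple, times powers of `-1` that a twist depending on degrees can absorb.

Plane model. Colour the intervals between points like a chessboard and let `W = ℝ^n` be the
functions on the intervals of one colour. A linear isomorphism from `ℝ^{2n}` to `W × W` sends the
span of the endpoint differences of the arcs of `b` to `Yb^⊥ × Yb`, where `Yb` consists of the
functions constant on the regions cut out by `b` (`map_arcSpan`). Hence the relations of `W(c)a`
become `(Yc ∩ Ya)^⊥ × (Yc + Ya)`, and every matching is replaced by a subspace of one Euclidean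
space.

Sign of a triple. The wedge of the splitting vectors of `(c,b,a)`, completed by the relations of
`W(c)a`, is a scalar multiple of a standard wedge built from bases attached to the pairs `(c,b)`,
`(b,a)` and from a basis of `Yb` (`exists_triple_eq_smul`). The sign of this scalar is the sign of
the triple.

Positivity. Applying this twice to each bracketing leaves two wedges over `Yb` and `Yc` which differ
only in the subspaces along which two linear maps are glued. Both are nonnegative multiples of one
and the same wedge (`exists_nonneg_wedge_splitMap_mul`), because an operator with nonnegative
quadratic form has nonnegative determinant (`LinearMap.det_nonneg_of_inner_nonneg`). So `η` is the
product of the four triple signs and of explicit Koszul signs (`pos_of_wedge_eq_smul`,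
`wedge_splitVecs_eq`).

Twist. Modulo 2 the Koszul exponent is a sum of one term for each triple and a product of a pair
exponent with a number of splits (`exponent_parity`). The pair exponents are additive under
composition up to the number of splits (`pairExp_parity`), so the remaining signs are absorbed by a
twist depending on the degree of the left factor (`sign_parity`). The resulting twist takes only the
values `±1`. -/

/-! ## Wedge products of lists of vectors -/

namespace ExteriorAlgebra

section Wedge

variable (R : Type*) {M N : Type*} [CommRing R] [AddCommGroup M] [Module R M] [AddCommGroup N]
  [Module R N]

/-- The wedge product of a list of vectors. -/
noncomputable def wedge (l : List M) : ExteriorAlgebra R M := (l.map (ι R)).prod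

@[simp] theorem wedge_nil : wedge R ([] : List M) = 1 := rfl

@[simp] theorem wedge_cons (x : M) (l : List M) : wedge R (x :: l) = ι R x * wedge R l := by
  simp [wedge]

@[simp] theorem wedge_append (l m : List M) : wedge R (l ++ m) = wedge R l * wedge R m := by
  simp [wedge]

theorem map_wedge (f : M →ₗ[R] N) (l : List M) : map f (wedge R l) = wedge R (l.map f) := by
  induction l with
  | nil => simp
  | cons x l ih => simp [ih]

theorem ιMulti_eq_wedge {k : ℕ} (v : Fin k → M) : ιMulti R k v = wedge R (List.ofFn v) := by
  rw [ιMulti_apply, wedge, List.map_ofFn]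
  rfl

theorem wedge_eq_ιMulti (l : List M) : wedge R l = ιMulti R l.length l.get := by
  rw [ιMulti_eq_wedge, List.ofFn_get]

theorem ι_mul_ι_comm (x y : M) : ι R x * ι R y = -(ι R y * ι R x) :=
  eq_neg_of_add_eq_zero_left (ι_add_mul_swap x y)

theorem ι_mul_wedge (x : M) (l : List M) :
    ι R x * wedge R l = (-1 : R) ^ l.length • (wedge R l * ι R x) := by
  induction l with
  | nil => simp
  | cons y l ih =>
    rw [wedge_cons, ← mul_assoc, ι_mul_ι_comm, neg_mul, mul_assoc, ih, List.length_cons, pow_succ]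
    simp [mul_assoc]

theorem wedge_mul_wedge_comm (l m : List M) :
    wedge R l * wedge R m = (-1 : R) ^ (l.length * m.length) • (wedge R m * wedge R l) := by
  induction l with
  | nil => simp
  | cons x l ih =>
    rw [wedge_cons, mul_assoc, ih, mul_smul_comm, ← mul_assoc, ι_mul_wedge, smul_mul_assoc,
      smul_smul, ← pow_add, mul_assoc, List.length_cons]
    congr 2
    ring

variable {R}

/-- The submodule of vectors annihilating `Z` from the left. -/
def annih (Z : ExteriorAlgebra R N) : Submodule R N where
  carrier := {x | ι R x * Z = 0}
  add_mem' {x y} hx hy := by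
    have hx : ι R x * Z = 0 := hx
    have hy : ι R y * Z = 0 := hy
    simp [add_mul, hx, hy]
  zero_mem' := by simp
  smul_mem' c x hx := by
    have hx : ι R x * Z = 0 := hx
    simp [hx]

theorem mem_annih {Z : ExteriorAlgebra R N} {x : N} : x ∈ annih Z ↔ ι R x * Z = 0 := Iff.rfl

theorem annih_le_mul_right (Z Z' : ExteriorAlgebra R N) : annih Z ≤ annih (Z * Z') := by
  intro x hx
  rw [mem_annih] at hx ⊢
  rw [← mul_assoc, hx, zero_mul]

theorem annih_le_wedge_mul (l : List N) (Z : ExteriorAlgebra R N) :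
    annih Z ≤ annih (wedge R l * Z) := by
  intro x hx
  rw [mem_annih] at hx ⊢
  rw [← mul_assoc, ι_mul_wedge, smul_mul_assoc, mul_assoc, hx, mul_zero, smul_zero]

theorem mem_annih_wedge {l : List N} {x : N} (hx : x ∈ l) : x ∈ annih (wedge R l) := by
  induction l with
  | nil => simp at hx
  | cons y l ih =>
    rw [wedge_cons]
    rcases List.mem_cons.mp hx with rfl | h
    · rw [mem_annih, ← mul_assoc, ι_sq_zero, zero_mul]
    · have := annih_le_wedge_mul (R := R) [y] (wedge R l) (ih h)
      simpa using this

/-- The vectors of a list of wedge factors may be changed modulo the annihilator of the rest. -/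
theorem wedge_map_mul_congr {P : Type*} (f g : P → N) (l : List P) (Z : ExteriorAlgebra R N)
    (h : ∀ x ∈ l, f x - g x ∈ annih Z) :
    wedge R (l.map f) * Z = wedge R (l.map g) * Z := by
  induction l with
  | nil => simp
  | cons x l ih =>
    have h1 := annih_le_wedge_mul (l.map g) Z (h x (by simp))
    rw [mem_annih, map_sub, sub_mul, sub_eq_zero] at h1
    rw [List.map_cons, List.map_cons, wedge_cons, wedge_cons, mul_assoc, mul_assoc,
      ih fun y hy => h y (by simp [hy]), h1]

theorem ιMulti_mul_congr {k : ℕ} (v w : Fin k → N) (Z : ExteriorAlgebra R N)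
    (h : ∀ i, v i - w i ∈ annih Z) : ιMulti R k v * Z = ιMulti R k w * Z := by
  have := wedge_map_mul_congr v w (List.finRange k) Z fun x _ => h x
  rwa [← List.ofFn_eq_map, ← List.ofFn_eq_map, ← ιMulti_eq_wedge, ← ιMulti_eq_wedge] at this

/-- Alternating maps in as many variables as the rank are determined by their value on one basis. -/
theorem alternatingMap_eq_det_smul {k : ℕ} (e : Module.Basis (Fin k) R M) (g : M [⋀^Fin k]→ₗ[R] N)
    (v : Fin k → M) : g v = e.det v • g e := by
  have h : g = (LinearMap.toSpanSingleton R N (g e)).compAlternatingMap e.det := by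
    refine Module.Basis.ext_alternating e fun i h => ?_
    let σ : Equiv.Perm (Fin k) := Equiv.ofBijective i (Finite.injective_iff_bijective.1 h)
    change g (e ∘ σ) = e.det (e ∘ σ) • g e
    simp [AlternatingMap.map_perm, Module.Basis.det_self]
  exact congrArg (fun φ => φ v) h

theorem ιMulti_sum_smul {k : ℕ} (B : Matrix (Fin k) (Fin k) R) (w : Fin k → N) :
    ιMulti R k (fun i => ∑ j, B i j • w j) = B.det • ιMulti R k w := by
  have h := alternatingMap_eq_det_smul (Pi.basisFun R (Fin k))
    ((ιMulti R k).compLinearMap (Fintype.linearCombination R w)) (fun i => B i)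
  rw [Pi.basisFun_det_apply, AlternatingMap.compLinearMap_apply,
    AlternatingMap.compLinearMap_apply] at h
  convert h using 3
  all_goals first | rfl | (funext i; simp [Fintype.linearCombination_apply, Pi.single_apply])

/-- If every vector of the list `l'` is a combination of vectors of `l` of the same length and of
vectors of `S`, then the wedge product of `l'` is, modulo `S`, a fixed multiple of that of `l`. -/
theorem exists_wedge_mul_eq_smul (l l' : List M) (S : Submodule R M)
    (hlen : l'.length = l.length) (h : ∀ x ∈ l', x ∈ Submodule.span R {y | y ∈ l} ⊔ S) :
    ∃ b : R, ∀ {N : Type} [AddCommGroup N] [Module R N] (φ : M →ₗ[R] N) (Z : ExteriorAlgebra R N),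
      S ≤ (annih Z).comap φ →
        wedge R (l'.map φ) * Z = b • (wedge R (l.map φ) * Z) := by
  have h1 : ∀ i : Fin l.length, ∃ B : Fin l.length → R,
      l'.get (i.cast hlen.symm) - ∑ j, B j • l.get j ∈ S := by
    intro i
    obtain ⟨y, hy, s, hs, hys⟩ := Submodule.mem_sup.mp (h _ (l'.get_mem (i.cast hlen.symm)))
    have hset : {y | y ∈ l} = Set.range l.get := by
      ext y
      exact List.mem_iff_get
    rw [hset, Submodule.mem_span_range_iff_exists_fun] at hy
    obtain ⟨B, rfl⟩ := hy
    exact ⟨B, by rw [← hys]; simpa using hs⟩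
  choose B hB using h1
  -- The scalar is the determinant of the coefficient matrix. It is fixed before `φ` and `Z`, so one
  -- coefficient serves all targets later on.
  refine ⟨Matrix.det (Matrix.of B), fun {N} _ _ φ Z hZ => ?_⟩
  have e1 : l'.map φ = List.ofFn fun i : Fin l.length => φ (l'.get (i.cast hlen.symm)) := by
    apply List.ext_get
    · simp [hlen]
    · intro k h1 h2
      simp
  have e2 : l.map φ = List.ofFn fun i : Fin l.length => φ (l.get i) := by
    apply List.ext_get
    · simp
    · intro k h1 h2
      simp
  rw [e1, e2, ← ιMulti_eq_wedge, ← ιMulti_eq_wedge, ← smul_mul_assoc, ← ιMulti_sum_smul]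
  refine ιMulti_mul_congr _ _ Z fun i => ?_
  have := hZ (hB i)
  simpa using this

end Wedge

end ExteriorAlgebra

/-! ## A determinant inequality -/

/-- Deform the identity to `T` along `(1 - s) + s T`. If `det T < 0`, the determinant vanishes for
some `s < 1`, and a kernel vector `v ≠ 0` gives `(1 - s)‖v‖² + s⟨T v, v⟩ = 0`, which contradicts the
hypothesis. -/
theorem LinearMap.det_nonneg_of_inner_nonneg {N : Type*} [NormedAddCommGroup N]
    [InnerProductSpace ℝ N] [FiniteDimensional ℝ N] (T : N →ₗ[ℝ] N)
    (hT : ∀ v, 0 ≤ inner ℝ (T v) v) : 0 ≤ LinearMap.det T := by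
  by_contra! hneg
  let e := Module.finBasis ℝ N
  let f : ℝ → ℝ := fun s =>
    Matrix.det ((1 - s) • (1 : Matrix _ _ ℝ) + s • LinearMap.toMatrix e e T)
  have hfs : ∀ s, f s = LinearMap.det ((1 - s) • LinearMap.id + s • T) := by
    intro s
    rw [← LinearMap.det_toMatrix e]
    simp [f]
  have hf : Continuous f := by
    apply Continuous.matrix_det
    fun_prop
  have h0 : f 0 = 1 := by simp [f]
  have h1 : f 1 < 0 := by rw [hfs]; simpa using hneg
  obtain ⟨s, hs, hs0⟩ := intermediate_value_Icc' zero_le_one hf.continuousOn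
    (show (0 : ℝ) ∈ Set.Icc (f 1) (f 0) from ⟨h1.le, by rw [h0]; exact zero_le_one⟩)
  have hs1 : s < 1 := lt_of_le_of_ne hs.2 (by rintro rfl; exact h1.ne hs0)
  rw [hfs] at hs0
  obtain ⟨v, hv, hv0⟩ := Submodule.exists_mem_ne_zero_of_ne_bot
    (LinearMap.bot_lt_ker_of_det_eq_zero hs0).ne'
  have h2 : inner ℝ ((1 - s) • v + s • T v) v = 0 := by
    have : (1 - s) • v + s • T v = 0 := by simpa using hv
    rw [this, inner_zero_left]
  rw [inner_add_left, inner_smul_left, inner_smul_left, real_inner_self_eq_norm_sq] at h2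
  simp only [conj_trivial] at h2
  have h3 : 0 < (1 - s) * ‖v‖ ^ 2 := mul_pos (by linarith) (pow_pos (norm_pos_iff.mpr hv0) 2)
  have h4 : 0 ≤ s * inner ℝ (T v) v := mul_nonneg hs.1 (hT v)
  linarith

/-! ### Wedges of two linear maps glued along an orthogonal decomposition -/

namespace ExteriorAlgebra

section Projections

variable {N X : Type} [NormedAddCommGroup N] [InnerProductSpace ℝ N] [FiniteDimensional ℝ N]
  [AddCommGroup X] [Module ℝ X]

/-- The map equal to `h` on `B` and to `κ` on the orthogonal complement of `B`. -/
noncomputable def splitMap (B : Submodule ℝ N) (κ h : N →ₗ[ℝ] X) : N →ₗ[ℝ] X :=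
  κ ∘ₗ (LinearMap.id - B.starProjection.toLinearMap) + h ∘ₗ B.starProjection.toLinearMap

theorem splitMap_apply (B : Submodule ℝ N) (κ h : N →ₗ[ℝ] X) (x : N) :
    splitMap B κ h x = κ (x - B.starProjection x) + h (B.starProjection x) := rfl

theorem splitMap_of_mem {B : Submodule ℝ N} (κ h : N →ₗ[ℝ] X) {x : N} (hx : x ∈ B) :
    splitMap B κ h x = h x := by
  rw [splitMap_apply, Submodule.starProjection_eq_self_iff.mpr hx]
  simp

theorem splitMap_of_mem_orthogonal {B : Submodule ℝ N} (κ h : N →ₗ[ℝ] X) {x : N} (hx : x ∈ Bᗮ) :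
    splitMap B κ h x = κ x := by
  rw [splitMap_apply, (Submodule.starProjection_apply_eq_zero_iff B).mpr hx]
  simp

/-- Write `B`, `R` also for the orthogonal projections. Modulo the annihilator of `Z`, `h` vanishes
on `R` and `κ` on its complement, so the map glued along `B` agrees with `(κ + h) ∘ T` for `T = R(1
- B) + (1 - R)B`. The factor is `det T`, and `⟨T v, v⟩ = ‖R(1 - B)v‖² + ‖(1 - R)Bv‖²` is
nonnegative. No relation between `B` and `R` is needed, so different `B` can be compared with the
same right-hand side. -/
theorem exists_nonneg_wedge_splitMap {m : ℕ} (e : Module.Basis (Fin m) ℝ N) (B R : Submodule ℝ N)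
    (κ h : N →ₗ[ℝ] X) (Z : ExteriorAlgebra ℝ X) (hR : ∀ x ∈ R, h x ∈ annih Z)
    (hR' : ∀ x ∈ Rᗮ, κ x ∈ annih Z) :
    ∃ t : ℝ, 0 ≤ t ∧ wedge ℝ ((List.ofFn e).map (splitMap B κ h)) * Z =
      t • (wedge ℝ ((List.ofFn e).map (κ + h)) * Z) := by
  let T : N →ₗ[ℝ] N := splitMap B R.starProjection.toLinearMap
    (LinearMap.id - R.starProjection.toLinearMap)
  have hT : ∀ x, T x = R.starProjection (x - B.starProjection x) +
    (B.starProjection x - R.starProjection (B.starProjection x)) := fun x => rfl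
  refine ⟨LinearMap.det T, LinearMap.det_nonneg_of_inner_nonneg T fun v => ?_, ?_⟩
  · set a := B.starProjection v
    have ha : inner ℝ (v - a) a = 0 :=
      Submodule.inner_left_of_mem_orthogonal (Submodule.starProjection_apply_mem B v)
        (Submodule.sub_starProjection_mem_orthogonal v)
    have hsa := Submodule.inner_starProjection_left_eq_right R (v - a) a
    have h1 : 0 ≤ inner ℝ (R.starProjection (v - a)) (v - a) :=
      R.re_inner_starProjection_nonneg (𝕜 := ℝ) (v - a)
    have h2 : 0 ≤ inner ℝ (a - R.starProjection a) a := by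
      have := R.starProjection_inner_eq_zero (𝕜 := ℝ) a _ (R.starProjection_apply_mem a)
      nth_rewrite 3 [← sub_add_cancel a (R.starProjection a)]
      rw [inner_add_right, this, add_zero]
      exact real_inner_self_nonneg
    -- The cross terms `⟨R(v - a), a⟩` and `-⟨R a, v - a⟩` cancel since `R` is self-adjoint, and
    -- `⟨a, v - a⟩ = 0`.
    have h3 : inner ℝ (T v) v = inner ℝ (R.starProjection (v - a)) (v - a) +
        inner ℝ (a - R.starProjection a) a := by
      have h4 : T v = R.starProjection (v - a) + (a - R.starProjection a) := hT v
      have h5 : inner ℝ (T v) v = inner ℝ (T v) (v - a) + inner ℝ (T v) a := by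
        rw [← inner_add_right, sub_add_cancel]
      rw [h5, h4]
      simp only [inner_add_left, inner_sub_left a]
      rw [hsa, real_inner_comm (v - a) a, ha, real_inner_comm (v - a) (R.starProjection a)]
      ring
    rw [h3]
    exact add_nonneg h1 h2
  · have h1 : wedge ℝ ((List.ofFn e).map (splitMap B κ h)) * Z =
        wedge ℝ ((List.ofFn e).map ((κ + h) ∘ₗ T)) * Z := by
      refine wedge_map_mul_congr _ _ _ _ fun x _ => ?_
      set a := B.starProjection x with ha
      have h2 : splitMap B κ h x - ((κ + h) ∘ₗ T) x =
          κ (x - a - R.starProjection (x - a)) + h (R.starProjection a) -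
            h (R.starProjection (x - a)) - κ (a - R.starProjection a) := by
        simp only [splitMap_apply, LinearMap.comp_apply, hT, LinearMap.add_apply, ← ha, map_add,
          map_sub]
        abel
      rw [h2]
      exact sub_mem (sub_mem (add_mem (hR' _ (Submodule.sub_starProjection_mem_orthogonal _))
        (hR _ (Submodule.starProjection_apply_mem R _))) (hR _
          (Submodule.starProjection_apply_mem R _)))
        (hR' _ (Submodule.sub_starProjection_mem_orthogonal _))
    rw [h1, List.map_ofFn, List.map_ofFn, ← ιMulti_eq_wedge, ← ιMulti_eq_wedge, ← smul_mul_assoc]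
    congr 1
    have := alternatingMap_eq_det_smul e ((ιMulti ℝ m).compLinearMap (κ + h)) (T ∘ e)
    rw [Module.Basis.det_comp, Module.Basis.det_self, mul_one] at this
    exact this

end Projections

end ExteriorAlgebra

namespace ExteriorAlgebra

/-! ## Products of wedges attached to triples of subspaces -/

section Triple

variable {W : Type} [NormedAddCommGroup W] [InnerProductSpace ℝ W] [FiniteDimensional ℝ W]

/-- A basis of a subspace, as a list of vectors. -/
noncomputable def basisList (S : Submodule ℝ W) : List W :=
  (List.ofFn (Module.finBasis ℝ S)).map S.subtype

@[simp] theorem length_basisList (S : Submodule ℝ W) :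
    (basisList S).length = Module.finrank ℝ S := by simp [basisList]

theorem span_basisList (S : Submodule ℝ W) : Submodule.span ℝ {x | x ∈ basisList S} = S := by
  have h : {x | x ∈ basisList S} = S.subtype '' Set.range (Module.finBasis ℝ S) := by
    ext x
    simp [basisList, List.mem_ofFn]
  rw [h, Submodule.span_image, (Module.finBasis ℝ S).span_eq, Submodule.map_top,
    Submodule.range_subtype]

theorem mem_of_basisList_map {X : Type*} [AddCommGroup X] [Module ℝ X] {S : Submodule ℝ W}
    (f : W →ₗ[ℝ] X) (T : Submodule ℝ X) (h : ∀ x ∈ (basisList S).map f, x ∈ T) {x : W}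
    (hx : x ∈ S) : f x ∈ T := by
  rw [← span_basisList S] at hx
  have : Submodule.span ℝ {x | x ∈ basisList S} ≤ T.comap f :=
    Submodule.span_le.mpr fun y hy => h _ (List.mem_map_of_mem hy)
  exact this hx

theorem mem_annih_basisList {X : Type*} [AddCommGroup X] [Module ℝ X] {S : Submodule ℝ W}
    (f : W →ₗ[ℝ] X) {x : W} (hx : x ∈ S) : f x ∈ annih (wedge ℝ ((basisList S).map f)) :=
  mem_of_basisList_map f _ (fun _ hy => mem_annih_wedge hy) hx

/-- The sum of the intersections of the middle subspace with the two others. -/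
abbrev meetSup (Yc Yb Ya : Submodule ℝ W) : Submodule ℝ W := (Yc ⊓ Yb) ⊔ (Yb ⊓ Ya)

theorem meetSup_le_middle (Yc Yb Ya : Submodule ℝ W) : meetSup Yc Yb Ya ≤ Yb :=
  sup_le inf_le_right inf_le_left

theorem meetSup_le_sup (Yc Yb Ya : Submodule ℝ W) : meetSup Yc Yb Ya ≤ Yc ⊔ Ya :=
  sup_le (inf_le_left.trans le_sup_left) (inf_le_right.trans le_sup_right)

theorem sub_starProjection_mem {P Y : Submodule ℝ W} (h : P ≤ Y) {y : W} (hy : y ∈ Y) :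
    y - P.starProjection y ∈ Y ⊓ Pᗮ :=
  ⟨sub_mem hy (h (P.starProjection_apply_mem y)), P.sub_starProjection_mem_orthogonal y⟩

/-- The comparison of the wedge of vectors of `Ybᗮ × Yb` for the triple `(Yc, Yb, Ya)` with a wedge
of vectors which depend only on the three pairs and on `Yb`. -/
theorem exists_triple_eq_smul (Yc Yb Ya : Submodule ℝ W) (v : List (W × W))
    (hv : ∀ x ∈ v, x.1 ∈ Ybᗮ ∧ x.2 ∈ Yb)
    (hlen : v.length + Module.finrank ℝ ((Yc ⊓ Ya)ᗮ : Submodule ℝ W) + Module.finrank ℝ W =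
      Module.finrank ℝ Yb + Module.finrank ℝ ((Yc ⊓ Yb)ᗮ : Submodule ℝ W) +
        Module.finrank ℝ ((Yb ⊓ Ya)ᗮ : Submodule ℝ W)) :
    ∃ b : ℝ, ∀ {X : Type} [AddCommGroup X] [Module ℝ X] (u l p : W →ₗ[ℝ] X)
      (Z : ExteriorAlgebra ℝ X), (∀ y ∈ Yc ⊔ Ya, p y ∈ annih Z) →
        wedge ℝ (v.map (l.coprod p)) * (wedge ℝ ((basisList (Yc ⊓ Ya)ᗮ).map l) *
          (wedge ℝ ((basisList (⊤ : Submodule ℝ W)).map (l - u)) * Z)) =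
        b • (wedge ℝ ((basisList Yb).map (splitMap (meetSup Yc Yb Ya) p (l - u))) *
          (wedge ℝ ((basisList (Yc ⊓ Yb)ᗮ).map u) *
            (wedge ℝ ((basisList (Yb ⊓ Ya)ᗮ).map l) * Z))) := by
  -- The three inclusions into `W × W × W` are the universal case of `(u, l, p)`. It suffices to
  -- show that the vectors of the left side lie in the span of those of the right side modulo `ip
  -- (Yc ⊔ Ya)`.
  let iu : W →ₗ[ℝ] W × W × W := LinearMap.inl ℝ W (W × W)
  let il : W →ₗ[ℝ] W × W × W := LinearMap.inr ℝ W (W × W) ∘ₗ LinearMap.inl ℝ W W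
  let ip : W →ₗ[ℝ] W × W × W := LinearMap.inr ℝ W (W × W) ∘ₗ LinearMap.inr ℝ W W
  set P := meetSup Yc Yb Ya
  let L := (basisList Yb).map (splitMap P ip (il - iu)) ++
    ((basisList (Yc ⊓ Yb)ᗮ).map iu ++ (basisList (Yb ⊓ Ya)ᗮ).map il)
  let L' := v.map (il.coprod ip) ++ ((basisList (Yc ⊓ Ya)ᗮ).map il ++
    (basisList (⊤ : Submodule ℝ W)).map (il - iu))
  let S : Submodule ℝ (W × W × W) := (Yc ⊔ Ya).map ip
  let T := Submodule.span ℝ {y | y ∈ L} ⊔ S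
  have hL : ∀ x ∈ L, x ∈ T := fun x hx => Submodule.mem_sup_left (Submodule.subset_span hx)
  have hp : ∀ y ∈ Yc ⊔ Ya, ip y ∈ T := fun y hy =>
    Submodule.mem_sup_right (Submodule.mem_map_of_mem hy)
  have hF : ∀ y ∈ Yb, splitMap P ip (il - iu) y ∈ T := fun y hy =>
    mem_of_basisList_map _ T (fun x hx => hL x (List.mem_append_left _ hx)) hy
  have hu : ∀ y ∈ (Yc ⊓ Yb)ᗮ, iu y ∈ T := fun y hy => mem_of_basisList_map _ T
    (fun x hx => hL x (List.mem_append_right _ (List.mem_append_left _ hx))) hy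
  have hl : ∀ y ∈ (Yb ⊓ Ya)ᗮ, il y ∈ T := fun y hy => mem_of_basisList_map _ T
    (fun x hx => hL x (List.mem_append_right _ (List.mem_append_right _ hx))) hy
  have hPb : P ≤ Yb := meetSup_le_middle Yc Yb Ya
  -- The glued map equals `ip` on the part of `y` orthogonal to `P`, and `P` is contained in `Yc ⊔
  -- Ya`.
  have hpb : ∀ y ∈ Yb, ip y ∈ T := by
    intro y hy
    obtain ⟨h1, h2⟩ := sub_starProjection_mem hPb hy
    have h3 := hF _ h1
    rw [splitMap_of_mem_orthogonal _ _ h2] at h3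
    have h4 := add_mem h3 (hp _ (meetSup_le_sup Yc Yb Ya (P.starProjection_apply_mem y)))
    rwa [← map_add, sub_add_cancel] at h4
  -- Decompose `w` along `Ybᗮ`, the complement of `P` in `Yb`, and `P`. The first two parts are
  -- orthogonal to both intersections, so `il` and `iu` of them are available separately; on `P` the
  -- glued map is `il - iu`.
  have hdiff : ∀ w, (il - iu) w ∈ T := by
    intro w
    have h1 : (il - iu) (w - Yb.starProjection w) ∈ T := by
      have := Yb.sub_starProjection_mem_orthogonal w
      exact sub_mem (hl _ (Submodule.orthogonal_le inf_le_left this))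
        (hu _ (Submodule.orthogonal_le inf_le_right this))
    have h2 : (il - iu) (Yb.starProjection w) ∈ T := by
      set y := Yb.starProjection w
      have hy : y ∈ Yb := Yb.starProjection_apply_mem w
      have h3 : (il - iu) (P.starProjection y) ∈ T := by
        have hm := P.starProjection_apply_mem y
        have := hF _ (hPb hm)
        rwa [splitMap_of_mem _ _ hm] at this
      have h4 : (il - iu) (y - P.starProjection y) ∈ T := by
        have := P.sub_starProjection_mem_orthogonal y
        exact sub_mem (hl _ (Submodule.orthogonal_le le_sup_right this))
          (hu _ (Submodule.orthogonal_le le_sup_left this))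
      have := add_mem h4 h3
      rwa [← map_add, sub_add_cancel] at this
    have := add_mem h1 h2
    rwa [← map_add, sub_add_cancel] at this
  -- A vector of `Ycᗮ` is reached through the upper copy and `hdiff`, a vector of `Yaᗮ` directly
  -- through the lower copy.
  have hlca : ∀ y ∈ (Yc ⊓ Ya)ᗮ, il y ∈ T := by
    have hle : (Yc ⊓ Ya)ᗮ ≤ Ycᗮ ⊔ Yaᗮ := by
      rw [← Submodule.orthogonal_orthogonal (Ycᗮ ⊔ Yaᗮ), ← Submodule.inf_orthogonal,
        Submodule.orthogonal_orthogonal, Submodule.orthogonal_orthogonal]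
    intro y hy
    obtain ⟨y1, h1, y2, h2, rfl⟩ := Submodule.mem_sup.mp (hle hy)
    rw [map_add]
    refine add_mem ?_ (hl _ (Submodule.orthogonal_le inf_le_right h2))
    have := add_mem (hdiff y1) (hu _ (Submodule.orthogonal_le inf_le_left h1))
    simpa using this
  obtain ⟨b, hb⟩ := exists_wedge_mul_eq_smul L L' S
    (by simp only [L, L', List.length_append, List.length_map, length_basisList, finrank_top]; omega)
    (by
      intro x hx
      simp only [L', List.mem_append, List.mem_map] at hx
      rcases hx with ⟨y, hy, rfl⟩ | ⟨y, hy, rfl⟩ | ⟨y, -, rfl⟩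
      · obtain ⟨h1, h2⟩ := hv y hy
        rw [LinearMap.coprod_apply]
        exact add_mem (hl _ (Submodule.orthogonal_le inf_le_left h1)) (hpb _ h2)
      · exact hlca y (by rw [← span_basisList (Yc ⊓ Ya)ᗮ]; exact Submodule.subset_span hy)
      · exact hdiff y)
  refine ⟨b, fun {X} _ _ u l p Z hZ => ?_⟩
  have hS : S ≤ (annih Z).comap (u.coprod (l.coprod p)) := by
    rintro _ ⟨y, hy, rfl⟩
    simpa [ip] using hZ y hy
  have h1 := hb (u.coprod (l.coprod p)) Z hS
  have e1 : (u.coprod (l.coprod p)) ∘ (il.coprod ip) = l.coprod p := by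
    funext x; simp [il, ip]
  have e2 : (u.coprod (l.coprod p)) ∘ il = l := by funext x; simp [il]
  have e3 : (u.coprod (l.coprod p)) ∘ iu = u := by funext x; simp [iu]
  have e4 : (u.coprod (l.coprod p)) ∘ (il - iu) = (l - u : W →ₗ[ℝ] X) := by
    funext x; simp [iu, il]; abel
  have e5 : (u.coprod (l.coprod p)) ∘ (splitMap P ip (il - iu)) = splitMap P p (l - u) := by
    funext x; simp [splitMap_apply, iu, il, ip]; abel
  simp only [L, L', List.map_append, List.map_map, e1, e2, e3, e4, e5, wedge_append,
    mul_assoc] at h1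
  exact h1

end Triple

end ExteriorAlgebra

namespace ExteriorAlgebra

/-! ## Comparison of two bracketings -/

section Quadruple

variable {W : Type} [NormedAddCommGroup W] [InnerProductSpace ℝ W] [FiniteDimensional ℝ W]
  {X : Type} [AddCommGroup X] [Module ℝ X]

/-- The two wedges form one glued wedge on `Yb × Yc`, with `κ(y, z) = p(y + z)` and `h(y, z) = (e₁ -
e₂)y + (e₂ - e₃)z`. By summation by parts `h(y, z) = e₁ y + e₂(z - y) - e₃ z`, so `h` is killed on
the orthogonal complement `R` of the span of `Yb ⊓ Ya`, the antidiagonal of `Yc ⊓ Yb`, and `Yd ⊓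
Yc`, while `κ` is killed on that span. Since `R` does not involve `P₁` and `P₂`, both bracketings
are compared with the same wedge. -/
theorem exists_nonneg_wedge_splitMap_mul (Yd Yc Yb Ya P₁ P₂ : Submodule ℝ W) (h₁ : P₁ ≤ Yb)
    (h₂ : P₂ ≤ Yc) (e₁ e₂ e₃ p : W →ₗ[ℝ] X) (Z : ExteriorAlgebra ℝ X)
    (hba : ∀ x ∈ (Yb ⊓ Ya)ᗮ, e₁ x ∈ annih Z) (hcb : ∀ x ∈ (Yc ⊓ Yb)ᗮ, e₂ x ∈ annih Z)
    (hdc : ∀ x ∈ (Yd ⊓ Yc)ᗮ, e₃ x ∈ annih Z) (hp : ∀ x ∈ Yd ⊔ Ya, p x ∈ annih Z) :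
    ∃ t : ℝ, 0 ≤ t ∧
      wedge ℝ ((basisList Yb).map (splitMap P₁ p (e₁ - e₂))) *
        (wedge ℝ ((basisList Yc).map (splitMap P₂ p (e₂ - e₃))) * Z) =
      t • (wedge ℝ ((basisList Yb).map (p + (e₁ - e₂))) *
        (wedge ℝ ((basisList Yc).map (p + (e₂ - e₃))) * Z)) := by
  let N := WithLp 2 (Yb × Yc)
  let pr : N →ₗ[ℝ] Yb × Yc := (WithLp.linearEquiv 2 ℝ (Yb × Yc)).toLinearMap
  let fb : N →ₗ[ℝ] W := Yb.subtype ∘ₗ LinearMap.fst ℝ Yb Yc ∘ₗ pr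
  let fc : N →ₗ[ℝ] W := Yc.subtype ∘ₗ LinearMap.snd ℝ Yb Yc ∘ₗ pr
  let ib : Yb →ₗ[ℝ] N := (WithLp.linearEquiv 2 ℝ (Yb × Yc)).symm.toLinearMap ∘ₗ
    LinearMap.inl ℝ Yb Yc
  let ic : Yc →ₗ[ℝ] N := (WithLp.linearEquiv 2 ℝ (Yb × Yc)).symm.toLinearMap ∘ₗ
    LinearMap.inr ℝ Yb Yc
  have hinner : ∀ m n : N, inner ℝ m n = inner ℝ (fb m) (fb n) + inner ℝ (fc m) (fc n) :=
    fun m n => WithLp.prod_inner_apply m n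
  have hfbib : ∀ y, fb (ib y) = y := fun y => rfl
  have hfcib : ∀ y, fc (ib y) = 0 := fun y => rfl
  have hfbic : ∀ y, fb (ic y) = 0 := fun y => rfl
  have hfcic : ∀ y, fc (ic y) = y := fun y => rfl
  let κ : N →ₗ[ℝ] X := p ∘ₗ (fb + fc)
  let h : N →ₗ[ℝ] X := (e₁ - e₂) ∘ₗ fb + (e₂ - e₃) ∘ₗ fc
  let B : Submodule ℝ N := P₁.comap fb ⊓ P₂.comap fc
  let s : Set N := {n | (fc n = 0 ∧ fb n ∈ Ya) ∨ fb n + fc n = 0 ∨ (fb n = 0 ∧ fc n ∈ Yd)}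
  let R : Submodule ℝ N := (Submodule.span ℝ s)ᗮ
  let e : Module.Basis (Fin (Module.finrank ℝ Yb + Module.finrank ℝ Yc)) ℝ N :=
    (((Module.finBasis ℝ Yb).prod (Module.finBasis ℝ Yc)).map
      (WithLp.linearEquiv 2 ℝ (Yb × Yc)).symm).reindex finSumFinEquiv
  have he : List.ofFn e = (List.ofFn (Module.finBasis ℝ Yb)).map ib ++
      (List.ofFn (Module.finBasis ℝ Yc)).map ic := by
    rw [List.map_ofFn, List.map_ofFn, ← List.ofFn_fin_append]
    congr 1
    funext i
    refine Fin.addCases (fun i => ?_) (fun i => ?_) i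
    · rw [Fin.append_left]
      simp [e, ib]
    · rw [Fin.append_right]
      simp [e, ic]
  have hR : ∀ n ∈ R, h n ∈ annih Z := by
    intro n hn
    have hin : ∀ m ∈ s, inner ℝ m n = 0 := fun m hm =>
      (Submodule.mem_orthogonal _ _).mp hn m (Submodule.subset_span hm)
    have h1 : fb n ∈ (Yb ⊓ Ya)ᗮ := by
      rw [Submodule.mem_orthogonal]
      rintro y ⟨hy, hya⟩
      have := hin (ib ⟨y, hy⟩) (Or.inl ⟨rfl, hya⟩)
      rwa [hinner, hfbib, hfcib, inner_zero_left, add_zero] at this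
    have h2 : fc n ∈ (Yd ⊓ Yc)ᗮ := by
      rw [Submodule.mem_orthogonal]
      rintro y ⟨hyd, hy⟩
      have := hin (ic ⟨y, hy⟩) (Or.inr (Or.inr ⟨rfl, hyd⟩))
      rwa [hinner, hfbic, hfcic, inner_zero_left, zero_add] at this
    have h3 : fc n - fb n ∈ (Yc ⊓ Yb)ᗮ := by
      rw [Submodule.mem_orthogonal]
      rintro y ⟨hyc, hyb⟩
      have := hin (ic ⟨y, hyc⟩ - ib ⟨y, hyb⟩) (Or.inr (Or.inl (by
        rw [map_sub, map_sub, hfbic, hfbib, hfcic, hfcib]; simp)))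
      rw [hinner, map_sub, map_sub, hfbic, hfbib, hfcic, hfcib, zero_sub, sub_zero,
        inner_neg_left] at this
      rw [inner_sub_right]
      linarith
    have h4 : h n = e₁ (fb n) + e₂ (fc n - fb n) - e₃ (fc n) := by
      simp only [h, LinearMap.add_apply, LinearMap.comp_apply, LinearMap.sub_apply, map_sub]
      abel
    rw [h4]
    exact sub_mem (add_mem (hba _ h1) (hcb _ h3)) (hdc _ h2)
  have hR' : ∀ n ∈ Rᗮ, κ n ∈ annih Z := by
    intro n hn
    rw [Submodule.orthogonal_orthogonal] at hn
    have hle : Submodule.span ℝ s ≤ (annih Z).comap κ := by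
      refine Submodule.span_le.mpr ?_
      rintro m (⟨h1, h2⟩ | h1 | ⟨h1, h2⟩)
      · change p (fb m + fc m) ∈ annih Z
        rw [h1, add_zero]
        exact hp _ (Submodule.mem_sup_right h2)
      · change p (fb m + fc m) ∈ annih Z
        rw [h1, map_zero]
        exact zero_mem _
      · change p (fb m + fc m) ∈ annih Z
        rw [h1, zero_add]
        exact hp _ (Submodule.mem_sup_left h2)
    exact hle hn
  obtain ⟨t, ht, heq⟩ := exists_nonneg_wedge_splitMap e B R κ h Z hR hR'
  refine ⟨t, ht, ?_⟩
  have hsb : splitMap B κ h ∘ ib = splitMap P₁ p (e₁ - e₂) ∘ Yb.subtype := by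
    funext y
    have h1 : P₁.starProjection (y : W) ∈ Yb := h₁ (P₁.starProjection_apply_mem _)
    let y₁ : Yb := ⟨P₁.starProjection (y : W), h1⟩
    have hm : ib y₁ ∈ B := ⟨P₁.starProjection_apply_mem _, P₂.zero_mem⟩
    have hm' : ib (y - y₁) ∈ Bᗮ := by
      rw [Submodule.mem_orthogonal]
      rintro m ⟨hm1, -⟩
      rw [hinner, hfbib, hfcib, inner_zero_right, add_zero]
      exact (Submodule.mem_orthogonal _ _).mp (P₁.sub_starProjection_mem_orthogonal (y : W)) _ hm1
    have : ib y = ib y₁ + ib (y - y₁) := by rw [← map_add, add_sub_cancel]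
    rw [Function.comp_apply, this, map_add, splitMap_of_mem _ _ hm,
      splitMap_of_mem_orthogonal _ _ hm']
    simp only [h, κ, LinearMap.add_apply, LinearMap.comp_apply, hfbib, hfcib, map_zero, add_zero,
      Function.comp_apply, splitMap_apply]
    rw [add_comm]
    rfl
  have hsc : splitMap B κ h ∘ ic = splitMap P₂ p (e₂ - e₃) ∘ Yc.subtype := by
    funext y
    have h1 : P₂.starProjection (y : W) ∈ Yc := h₂ (P₂.starProjection_apply_mem _)
    let y₁ : Yc := ⟨P₂.starProjection (y : W), h1⟩
    have hm : ic y₁ ∈ B := ⟨P₁.zero_mem, P₂.starProjection_apply_mem _⟩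
    have hm' : ic (y - y₁) ∈ Bᗮ := by
      rw [Submodule.mem_orthogonal]
      rintro m ⟨-, hm1⟩
      rw [hinner, hfbic, hfcic, inner_zero_right, zero_add]
      exact (Submodule.mem_orthogonal _ _).mp (P₂.sub_starProjection_mem_orthogonal (y : W)) _ hm1
    have : ic y = ic y₁ + ic (y - y₁) := by rw [← map_add, add_sub_cancel]
    rw [Function.comp_apply, this, map_add, splitMap_of_mem _ _ hm,
      splitMap_of_mem_orthogonal _ _ hm']
    simp only [h, κ, LinearMap.add_apply, LinearMap.comp_apply, hfbic, hfcic, map_zero, zero_add,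
      Function.comp_apply, splitMap_apply]
    rw [add_comm]
    rfl
  have hgb : (κ + h) ∘ ib = (p + (e₁ - e₂)) ∘ Yb.subtype := by
    funext y
    simp [κ, h, hfbib, hfcib]
  have hgc : (κ + h) ∘ ic = (p + (e₂ - e₃)) ∘ Yc.subtype := by
    funext y
    simp [κ, h, hfbic, hfcic]
  rw [he, List.map_append, List.map_append, List.map_map, List.map_map, List.map_map, List.map_map,
    hsb, hsc, hgb, hgc, wedge_append, wedge_append, mul_assoc, mul_assoc] at heq
  simp only [basisList, List.map_map]
  exact heq

/-- The scalar `b` compares the wedge of the list `v` for the triple `(Yc, Yb, Ya)` with a wedge of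
vectors which depend only on the three pairs and on `Yb`. -/
def IsTripleCoeff (Yc Yb Ya : Submodule ℝ W) (v : List (W × W)) (b : ℝ) : Prop :=
  ∀ {X : Type} [AddCommGroup X] [Module ℝ X] (u l p : W →ₗ[ℝ] X) (Z : ExteriorAlgebra ℝ X),
    (∀ y ∈ Yc ⊔ Ya, p y ∈ annih Z) →
      wedge ℝ (v.map (l.coprod p)) * (wedge ℝ ((basisList (Yc ⊓ Ya)ᗮ).map l) *
        (wedge ℝ ((basisList (⊤ : Submodule ℝ W)).map (l - u)) * Z)) =
      b • (wedge ℝ ((basisList Yb).map (splitMap (meetSup Yc Yb Ya) p (l - u))) *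
        (wedge ℝ ((basisList (Yc ⊓ Yb)ᗮ).map u) *
          (wedge ℝ ((basisList (Yb ⊓ Ya)ᗮ).map l) * Z)))

/-- The dimension of the orthogonal complement of an intersection. -/
noncomputable abbrev codim (Yc Ya : Submodule ℝ W) : ℕ :=
  Module.finrank ℝ ((Yc ⊓ Ya)ᗮ : Submodule ℝ W)

theorem wedge_left_comm (l m : List X) (Z : ExteriorAlgebra ℝ X) :
    wedge ℝ l * (wedge ℝ m * Z) =
      (-1 : ℝ) ^ (l.length * m.length) • (wedge ℝ m * (wedge ℝ l * Z)) := by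
  rw [← mul_assoc, wedge_mul_wedge_comm, smul_mul_assoc, mul_assoc]

/-- Orthogonally to the sum of intersections the glued map is `p`, so its wedge supplies `p` there;
the sum of intersections itself lies in `Yd ⊔ Ya`, which `Z` already kills. This makes the
comparison for a second triple applicable after that for a first one. -/
theorem mem_annih_saddle_mul (Yd Yb Ya : Submodule ℝ W) (p h : W →ₗ[ℝ] X)
    (Z : ExteriorAlgebra ℝ X) (hZ : ∀ y ∈ Yd ⊔ Ya, p y ∈ annih Z) {y : W} (hy : y ∈ Yb) :
    p y ∈ annih (wedge ℝ ((basisList Yb).map (splitMap (meetSup Yd Yb Ya) p h)) * Z) := by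
  obtain ⟨h1, h2⟩ := sub_starProjection_mem (meetSup_le_middle Yd Yb Ya) hy
  have h3 := mem_annih_basisList (splitMap (meetSup Yd Yb Ya) p h) h1
  rw [splitMap_of_mem_orthogonal _ _ h2] at h3
  have h4 := annih_le_wedge_mul ((basisList Yb).map (splitMap (meetSup Yd Yb Ya) p h)) Z
    (hZ _ (meetSup_le_sup Yd Yb Ya ((meetSup Yd Yb Ya).starProjection_apply_mem y)))
  have := add_mem (annih_le_mul_right _ Z h3) h4
  rwa [← map_add, sub_add_cancel] at this

/-- The wedge of the splittings of the bracketing which first composes over `Yc`, in terms of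
vectors which depend only on pairs. -/
theorem wedge_left_bracketing_eq_smul {Yd Yc Yb Ya : Submodule ℝ W} {v w : List (W × W)} {r r' : ℝ}
    (hv : IsTripleCoeff Yd Yb Ya v r) (hw : IsTripleCoeff Yd Yc Yb w r')
    (e₁ e₂ e₃ p : W →ₗ[ℝ] X) (Z : ExteriorAlgebra ℝ X) (hZ : ∀ y ∈ Yd ⊔ Ya, p y ∈ annih Z) :
    wedge ℝ (v.map (e₁.coprod p)) * (wedge ℝ (w.map (e₂.coprod p)) *
      (wedge ℝ ((basisList (Yd ⊓ Ya)ᗮ).map e₁) *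
        (wedge ℝ ((basisList (⊤ : Submodule ℝ W)).map (e₂ - e₃)) *
          (wedge ℝ ((basisList (⊤ : Submodule ℝ W)).map (e₁ - e₂)) * Z)))) =
    ((-1 : ℝ) ^ (Module.finrank ℝ W * codim Yd Yb + codim Yd Yb * Module.finrank ℝ Yb +
      Module.finrank ℝ W * (v.length + codim Yd Ya) + v.length * w.length +
      Module.finrank ℝ Yb * (codim Yc Yb + codim Yd Yc + Module.finrank ℝ Yc)) * (r * r')) •
    (wedge ℝ ((basisList Yb).map (splitMap (meetSup Yd Yb Ya) p (e₁ - e₂))) *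
      (wedge ℝ ((basisList Yc).map (splitMap (meetSup Yd Yc Yb) p (e₂ - e₃))) *
        (wedge ℝ ((basisList (Yd ⊓ Yc)ᗮ).map e₃) * (wedge ℝ ((basisList (Yc ⊓ Yb)ᗮ).map e₂) *
          (wedge ℝ ((basisList (Yb ⊓ Ya)ᗮ).map e₁) * Z))))) := by
  have h1 := hv e₂ e₁ p Z hZ
  set F := (basisList Yb).map (splitMap (meetSup Yd Yb Ya) p (e₁ - e₂))
  set G := (basisList (Yb ⊓ Ya)ᗮ).map e₁
  have hZ' : ∀ y ∈ Yd ⊔ Yb, p y ∈ annih (wedge ℝ F * (wedge ℝ G * Z)) := by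
    have hGZ : ∀ y ∈ Yd ⊔ Ya, p y ∈ annih (wedge ℝ G * Z) := fun y hy =>
      annih_le_wedge_mul G Z (hZ y hy)
    intro y hy
    obtain ⟨y1, hy1, y2, hy2, rfl⟩ := Submodule.mem_sup.mp hy
    rw [map_add]
    exact add_mem (annih_le_wedge_mul F _ (hGZ y1 (Submodule.mem_sup_left hy1)))
      (mem_annih_saddle_mul Yd Yb Ya p (e₁ - e₂) _ hGZ hy2)
  have h2 := hw e₃ e₂ p _ hZ'
  set V := v.map (e₁.coprod p)
  set V' := w.map (e₂.coprod p)
  set D := (basisList (⊤ : Submodule ℝ W)).map (e₁ - e₂)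
  set D' := (basisList (⊤ : Submodule ℝ W)).map (e₂ - e₃)
  set H := (basisList (Yd ⊓ Ya)ᗮ).map e₁
  set F' := (basisList Yc).map (splitMap (meetSup Yd Yc Yb) p (e₂ - e₃))
  set H₂ := (basisList (Yd ⊓ Yb)ᗮ).map e₂
  set G₂ := (basisList (Yc ⊓ Yb)ᗮ).map e₂
  set G₃ := (basisList (Yd ⊓ Yc)ᗮ).map e₃
  -- Bring the factors into the order of `h1`, then of `h2`, then of the normal form. Every
  -- transposition of blocks contributes the product of their lengths to the exponent.
  rw [wedge_left_comm H D', mul_smul_comm, mul_smul_comm, wedge_left_comm V V',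
    wedge_left_comm V D', h1]
  simp only [mul_smul_comm]
  rw [wedge_left_comm F H₂]
  simp only [mul_smul_comm]
  rw [wedge_left_comm D' H₂]
  simp only [mul_smul_comm]
  rw [h2, wedge_left_comm G₂ F]
  simp only [mul_smul_comm]
  rw [wedge_left_comm G₃ F]
  simp only [mul_smul_comm]
  rw [wedge_left_comm F' F]
  simp only [smul_smul]
  congr 1
  simp only [V, V', D', H, F, F', H₂, G₂, G₃, List.length_map, length_basisList, finrank_top]
  ring

/-- The wedge of the splittings of the bracketing which first composes over `Yb`, in terms of
vectors which depend only on pairs. -/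
theorem wedge_right_bracketing_eq_smul {Yd Yc Yb Ya : Submodule ℝ W} {v w : List (W × W)} {r r' : ℝ}
    (hv : IsTripleCoeff Yd Yc Ya v r) (hw : IsTripleCoeff Yc Yb Ya w r')
    (e₁ e₂ e₃ p : W →ₗ[ℝ] X) (Z : ExteriorAlgebra ℝ X) (hZ : ∀ y ∈ Yd ⊔ Ya, p y ∈ annih Z) :
    wedge ℝ (v.map (e₂.coprod p)) * (wedge ℝ (w.map (e₁.coprod p)) *
      (wedge ℝ ((basisList (Yd ⊓ Ya)ᗮ).map e₂) *
        (wedge ℝ ((basisList (⊤ : Submodule ℝ W)).map (e₂ - e₃)) *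
          (wedge ℝ ((basisList (⊤ : Submodule ℝ W)).map (e₁ - e₂)) * Z)))) =
    ((-1 : ℝ) ^ (w.length * (codim Yd Ya + Module.finrank ℝ W) + codim Yc Ya * w.length +
      (Module.finrank ℝ Yc + codim Yd Yc) * (codim Yc Ya + w.length + Module.finrank ℝ W +
        codim Yc Yb + codim Yb Ya)) * (r * r')) •
    (wedge ℝ ((basisList Yb).map (splitMap (meetSup Yc Yb Ya) p (e₁ - e₂))) *
      (wedge ℝ ((basisList Yc).map (splitMap (meetSup Yd Yc Ya) p (e₂ - e₃))) *
        (wedge ℝ ((basisList (Yd ⊓ Yc)ᗮ).map e₃) * (wedge ℝ ((basisList (Yc ⊓ Yb)ᗮ).map e₂) *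
          (wedge ℝ ((basisList (Yb ⊓ Ya)ᗮ).map e₁) * Z))))) := by
  set V := v.map (e₂.coprod p)
  set V' := w.map (e₁.coprod p)
  set D := (basisList (⊤ : Submodule ℝ W)).map (e₁ - e₂)
  set D' := (basisList (⊤ : Submodule ℝ W)).map (e₂ - e₃)
  have h1 := hv e₃ e₂ p (wedge ℝ V' * (wedge ℝ D * Z)) fun y hy =>
    annih_le_wedge_mul _ _ (annih_le_wedge_mul _ _ (hZ y hy))
  set H := (basisList (Yd ⊓ Ya)ᗮ).map e₂
  set F := (basisList Yc).map (splitMap (meetSup Yd Yc Ya) p (e₂ - e₃))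
  set G₃ := (basisList (Yd ⊓ Yc)ᗮ).map e₃
  have hZ' : ∀ y ∈ Yc ⊔ Ya, p y ∈ annih (wedge ℝ F * (wedge ℝ G₃ * Z)) := by
    have hGZ : ∀ y ∈ Yd ⊔ Ya, p y ∈ annih (wedge ℝ G₃ * Z) := fun y hy =>
      annih_le_wedge_mul G₃ Z (hZ y hy)
    intro y hy
    obtain ⟨y1, hy1, y2, hy2, rfl⟩ := Submodule.mem_sup.mp hy
    rw [map_add]
    exact add_mem (mem_annih_saddle_mul Yd Yc Ya p (e₂ - e₃) _ hGZ hy1)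
      (annih_le_wedge_mul F _ (hGZ y2 (Submodule.mem_sup_right hy2)))
  have h2 := hw e₂ e₁ p _ hZ'
  -- In the presence of `D`, which contains all `(e₁ - e₂) x`, the maps `e₁` and `e₂` are
  -- interchangeable. The first comparison produces `e₂` on this subspace, the second one needs
  -- `e₁`.
  have hc : ∀ Z' : ExteriorAlgebra ℝ X, wedge ℝ ((basisList (Yc ⊓ Ya)ᗮ).map e₂) *
      (wedge ℝ D * Z') = wedge ℝ ((basisList (Yc ⊓ Ya)ᗮ).map e₁) * (wedge ℝ D * Z') := by
    intro Z'
    refine (wedge_map_mul_congr e₁ e₂ _ _ fun x _ => ?_).symm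
    exact annih_le_mul_right _ Z' (mem_annih_basisList (e₁ - e₂) Submodule.mem_top)
  set G := (basisList (Yb ⊓ Ya)ᗮ).map e₁
  set F' := (basisList Yb).map (splitMap (meetSup Yc Yb Ya) p (e₁ - e₂))
  set H₂ := (basisList (Yc ⊓ Ya)ᗮ).map e₂
  set H₁ := (basisList (Yc ⊓ Ya)ᗮ).map e₁
  set G₂ := (basisList (Yc ⊓ Yb)ᗮ).map e₂
  rw [wedge_left_comm V' H, mul_smul_comm, wedge_left_comm V' D']
  simp only [mul_smul_comm]
  rw [h1, wedge_left_comm H₂ V', hc]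
  simp only [mul_smul_comm]
  rw [wedge_left_comm G₃ V']
  simp only [mul_smul_comm]
  rw [wedge_left_comm G₃ H₁]
  simp only [mul_smul_comm]
  rw [wedge_left_comm G₃ D]
  simp only [mul_smul_comm]
  rw [wedge_left_comm F V']
  rw [wedge_left_comm F H₁]
  simp only [mul_smul_comm]
  rw [wedge_left_comm F D]
  simp only [mul_smul_comm]
  rw [h2, wedge_left_comm G F]
  simp only [mul_smul_comm]
  rw [wedge_left_comm G G₃]
  simp only [mul_smul_comm]
  rw [wedge_left_comm G₂ F]
  simp only [mul_smul_comm]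
  rw [wedge_left_comm G₂ G₃]
  simp only [smul_smul, mul_smul_comm]
  congr 1
  simp only [V', D, D', H, F, G, H₁, H₂, G₂, G₃, List.length_map, length_basisList, finrank_top]
  ring

end Quadruple

end ExteriorAlgebra

namespace ExteriorAlgebra

/-! ## Wedges of linearly independent vectors -/

section Independent

variable {K M N : Type*} [Field K] [AddCommGroup M] [Module K M] [AddCommGroup N] [Module K N]

/-- A left inverse of the coordinate inclusion followed by the determinant is an alternating form
with value `1` on `v`; its lift to the exterior algebra detects the wedge. -/
theorem ιMulti_ne_zero_of_linearIndependent {k : ℕ} {v : Fin k → M} (hv : LinearIndependent K v) :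
    ιMulti K k v ≠ 0 := by
  obtain ⟨φ, hφ⟩ := (Fintype.linearCombination K v).exists_leftInverse_of_injective
    (LinearMap.ker_eq_bot.mpr hv.fintypeLinearCombination_injective)
  have h1 : φ ∘ v = Pi.basisFun K (Fin k) := by
    funext i
    have := LinearMap.congr_fun hφ (Pi.single i 1)
    simpa [Fintype.linearCombination_apply_single] using this
  intro h0
  have h2 := liftAlternating_apply_ιMulti (R := K) (N := K)
    (Function.update (fun _ => 0) k ((Pi.basisFun K (Fin k)).det.compLinearMap φ)) v
  rw [h0, map_zero, Function.update_self, AlternatingMap.compLinearMap_apply] at h2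
  have h3 : (fun i => φ (v i)) = Pi.basisFun K (Fin k) := h1
  rw [h3, Module.Basis.det_self] at h2
  exact zero_ne_one h2

theorem ιMulti_ne_zero_iff {k : ℕ} {v : Fin k → M} :
    ιMulti K k v ≠ 0 ↔ LinearIndependent K v :=
  ⟨fun h => by_contra fun hv => h (AlternatingMap.map_linearDependent _ _ hv),
    ιMulti_ne_zero_of_linearIndependent⟩

theorem wedge_ofFn_mul_wedge_ofFn_ne_zero {k k' : ℕ} {f : Fin k → M} {g : Fin k' → M}
    (h : LinearIndependent K (Sum.elim f g)) :
    wedge K (List.ofFn f) * wedge K (List.ofFn g) ≠ 0 := by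
  have h' := (linearIndependent_equiv finSumFinEquiv.symm).mpr h
  have e : Sum.elim f g ∘ finSumFinEquiv.symm = Fin.append f g := by
    funext i
    refine Fin.addCases (fun i => ?_) (fun i => ?_) i <;> simp
  have h2 := ιMulti_ne_zero_of_linearIndependent h'
  rwa [e, ιMulti_eq_wedge, List.ofFn_fin_append, wedge_append] at h2

theorem wedge_inl_mul_wedge_inr_ne_zero {l : List M} {m : List N} (hl : wedge K l ≠ 0)
    (hm : wedge K m ≠ 0) :
    wedge K (l.map (LinearMap.inl K M N)) * wedge K (m.map (LinearMap.inr K M N)) ≠ 0 := by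
  rw [wedge_eq_ιMulti, ιMulti_ne_zero_iff] at hl hm
  have h2 := wedge_ofFn_mul_wedge_ofFn_ne_zero (f := LinearMap.inl K M N ∘ l.get)
    (g := LinearMap.inr K M N ∘ m.get) (linearIndependent_inl_union_inr' hl hm)
  have e1 : List.ofFn (LinearMap.inl K M N ∘ l.get) = l.map (LinearMap.inl K M N) := by
    rw [← List.map_ofFn, List.ofFn_get]
  have e2 : List.ofFn (LinearMap.inr K M N ∘ m.get) = m.map (LinearMap.inr K M N) := by
    rw [← List.map_ofFn, List.ofFn_get]
  rwa [e1, e2] at h2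

end Independent

/-! ### The sign relating the two bracketings, for subspaces of a Euclidean space -/

section Sign

variable {W : Type} [NormedAddCommGroup W] [InnerProductSpace ℝ W] [FiniteDimensional ℝ W]

theorem wedge_basisList_ne_zero (S : Submodule ℝ W) : wedge ℝ (basisList S) ≠ 0 := by
  rw [basisList, List.map_ofFn, ← ιMulti_eq_wedge]
  exact ιMulti_ne_zero_of_linearIndependent
    ((Module.finBasis ℝ S).linearIndependent.map' _ S.ker_subtype)

/-- A basis of `(Yd ⊓ Ya)ᗮ × (Yd ⊔ Ya)`, as a list. -/
noncomputable def outerList (Yd Ya : Submodule ℝ W) : List (W × W) :=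
  (basisList (Yd ⊓ Ya)ᗮ).map (LinearMap.inl ℝ W W) ++
    (basisList (Yd ⊔ Ya)).map (LinearMap.inr ℝ W W)

/-- The sign relating the wedges of the splittings of the two bracketings. -/
theorem pos_of_wedge_eq_smul {Yd Yc Yb Ya : Submodule ℝ W} {v w v' w' : List (W × W)}
    {r₁ r₂ r₃ r₄ : ℝ} (hv : IsTripleCoeff Yd Yb Ya v r₁) (hw : IsTripleCoeff Yd Yc Yb w r₂)
    (hv' : IsTripleCoeff Yd Yc Ya v' r₃) (hw' : IsTripleCoeff Yc Yb Ya w' r₄) (η : ℝ)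
    (h : wedge ℝ v * (wedge ℝ w * wedge ℝ (outerList Yd Ya)) =
      η • (wedge ℝ v' * (wedge ℝ w' * wedge ℝ (outerList Yd Ya))))
    (hne : wedge ℝ v * (wedge ℝ w * wedge ℝ (outerList Yd Ya)) ≠ 0) :
    0 < η * ((-1 : ℝ) ^ (Module.finrank ℝ W * codim Yd Yb + codim Yd Yb * Module.finrank ℝ Yb +
      Module.finrank ℝ W * (v.length + codim Yd Ya) + v.length * w.length +
      Module.finrank ℝ Yb * (codim Yc Yb + codim Yd Yc + Module.finrank ℝ Yc) +
      (w'.length * (codim Yd Ya + Module.finrank ℝ W) + codim Yc Ya * w'.length +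
      (Module.finrank ℝ Yc + codim Yd Yc) * (codim Yc Ya + w'.length + Module.finrank ℝ W +
        codim Yc Yb + codim Yb Ya))) * (r₁ * r₂ * (r₃ * r₄))) := by
  -- The maps are chosen so that `e₁`, `p` and the differences `e₁ - e₂`, `e₂ - e₃` are the four
  -- coordinate inclusions. Nothing is lost: the wedge of all factors is nonzero whenever the given
  -- wedge in `W × W` is.
  let φ : W × W →ₗ[ℝ] (W × W) × (W × W) := LinearMap.inl ℝ (W × W) (W × W)
  let ψ : W × W →ₗ[ℝ] (W × W) × (W × W) := LinearMap.inr ℝ (W × W) (W × W)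
  let e₁ := φ ∘ₗ LinearMap.inl ℝ W W
  let p := φ ∘ₗ LinearMap.inr ℝ W W
  let e₂ := e₁ - ψ ∘ₗ LinearMap.inr ℝ W W
  let e₃ := e₂ - ψ ∘ₗ LinearMap.inl ℝ W W
  have hφ : e₁.coprod p = φ := by
    ext x <;> simp [e₁, p]
  have h12 : e₁ - e₂ = ψ ∘ₗ LinearMap.inr ℝ W W := by simp [e₂]
  have h23 : e₂ - e₃ = ψ ∘ₗ LinearMap.inl ℝ W W := by simp [e₃]
  set P := (basisList (Yd ⊔ Ya)).map p with hP
  set H := (basisList (Yd ⊓ Ya)ᗮ).map e₁ with hH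
  set D := (basisList (⊤ : Submodule ℝ W)).map (e₁ - e₂) with hD
  set D' := (basisList (⊤ : Submodule ℝ W)).map (e₂ - e₃) with hD'
  have hZ : ∀ y ∈ Yd ⊔ Ya, p y ∈ annih (wedge ℝ P) := fun y hy => mem_annih_basisList p hy
  have houter : (outerList Yd Ya).map φ = H ++ P := by
    simp only [outerList, List.map_append, List.map_map, hH, hP]
    rfl
  have hDD : D' ++ D = ((basisList (⊤ : Submodule ℝ W)).map (LinearMap.inl ℝ W W) ++
      (basisList (⊤ : Submodule ℝ W)).map (LinearMap.inr ℝ W W)).map ψ := by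
    simp only [hD, hD', h12, h23, List.map_append, List.map_map]
    rfl
  -- The sign of moving `P` in front of the differences occurs for both bracketings alike, so it
  -- drops out of the comparison.
  set ε : ℝ := (-1) ^ ((D' ++ D).length * P.length)
  have hε : ε ≠ 0 := pow_ne_zero _ (by norm_num)
  have hcomm : wedge ℝ D' * (wedge ℝ D * wedge ℝ P) =
      ε • (wedge ℝ P * (wedge ℝ D' * wedge ℝ D)) := by
    rw [← mul_assoc, ← wedge_append, wedge_mul_wedge_comm]
  have hmap : ∀ l l' : List (W × W), wedge ℝ (l.map φ) * (wedge ℝ (l'.map φ) * (wedge ℝ H *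
      (wedge ℝ D' * (wedge ℝ D * wedge ℝ P)))) =
      ε • (map φ (wedge ℝ l * (wedge ℝ l' * wedge ℝ (outerList Yd Ya))) *
        (wedge ℝ D' * wedge ℝ D)) := by
    intro l l'
    rw [hcomm, map_mul, map_mul, map_wedge, map_wedge, map_wedge, houter, wedge_append]
    simp only [mul_smul_comm, mul_assoc]
  have hcong : ∀ (l : List (W × W)) (Z : ExteriorAlgebra ℝ ((W × W) × (W × W))),
      (∀ x, (e₁ - e₂) x ∈ annih Z) →
      wedge ℝ (l.map (e₂.coprod p)) * Z = wedge ℝ (l.map φ) * Z := by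
    intro l Z hZ
    refine (wedge_map_mul_congr φ (e₂.coprod p) l Z fun x _ => ?_).symm
    rw [← hφ]
    have := hZ x.1
    simpa using this
  have hDZ : ∀ x, (e₁ - e₂) x ∈ annih (wedge ℝ D * wedge ℝ P) := fun x =>
    annih_le_mul_right _ _ (mem_annih_basisList (e₁ - e₂) Submodule.mem_top)
  have hDZ' : ∀ x, (e₁ - e₂) x ∈ annih (wedge ℝ D' * (wedge ℝ D * wedge ℝ P)) := fun x =>
    annih_le_wedge_mul _ _ (hDZ x)
  have hl := wedge_left_bracketing_eq_smul hv hw e₁ e₂ e₃ p (wedge ℝ P) hZ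
  have hr := wedge_right_bracketing_eq_smul hv' hw' e₁ e₂ e₃ p (wedge ℝ P) hZ
  have hH2 : wedge ℝ ((basisList (Yd ⊓ Ya)ᗮ).map e₂) *
      (wedge ℝ D' * (wedge ℝ D * wedge ℝ P)) =
      wedge ℝ H * (wedge ℝ D' * (wedge ℝ D * wedge ℝ P)) :=
    (wedge_map_mul_congr e₁ e₂ _ _ fun x _ => hDZ' x).symm
  rw [hcong w _ fun x => annih_le_wedge_mul _ _ (hDZ' x), hφ, hmap] at hl
  rw [hH2, hcong v' _ fun x => annih_le_wedge_mul _ _ (annih_le_wedge_mul _ _ (hDZ' x)),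
    hφ, hmap] at hr
  set Z := wedge ℝ ((basisList (Yd ⊓ Yc)ᗮ).map e₃) * (wedge ℝ ((basisList (Yc ⊓ Yb)ᗮ).map e₂) *
    (wedge ℝ ((basisList (Yb ⊓ Ya)ᗮ).map e₁) * wedge ℝ P))
  have hba : ∀ x ∈ (Yb ⊓ Ya)ᗮ, e₁ x ∈ annih Z := fun x hx =>
    annih_le_wedge_mul _ _ (annih_le_wedge_mul _ _
      (annih_le_mul_right _ _ (mem_annih_basisList e₁ hx)))
  have hcb : ∀ x ∈ (Yc ⊓ Yb)ᗮ, e₂ x ∈ annih Z := fun x hx =>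
    annih_le_wedge_mul _ _ (annih_le_mul_right _ _ (mem_annih_basisList e₂ hx))
  have hdc : ∀ x ∈ (Yd ⊓ Yc)ᗮ, e₃ x ∈ annih Z := fun x hx =>
    annih_le_mul_right _ _ (mem_annih_basisList e₃ hx)
  have hp : ∀ x ∈ Yd ⊔ Ya, p x ∈ annih Z := fun x hx =>
    annih_le_wedge_mul _ _ (annih_le_wedge_mul _ _ (annih_le_wedge_mul _ _ (hZ x hx)))
  obtain ⟨t, ht, h1⟩ := exists_nonneg_wedge_splitMap_mul Yd Yc Yb Ya (meetSup Yd Yb Ya)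
    (meetSup Yd Yc Yb) (meetSup_le_middle _ _ _) (meetSup_le_middle _ _ _) e₁ e₂ e₃ p Z hba hcb
    hdc hp
  obtain ⟨t', ht', h2⟩ := exists_nonneg_wedge_splitMap_mul Yd Yc Yb Ya (meetSup Yc Yb Ya)
    (meetSup Yd Yc Ya) (meetSup_le_middle _ _ _) (meetSup_le_middle _ _ _) e₁ e₂ e₃ p Z hba hcb
    hdc hp
  rw [h1] at hl
  rw [h2] at hr
  set Ξ := wedge ℝ ((basisList Yb).map (p + (e₁ - e₂))) *
    (wedge ℝ ((basisList Yc).map (p + (e₂ - e₃))) * Z)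
  have hA : ε • (map φ (wedge ℝ v * (wedge ℝ w * wedge ℝ (outerList Yd Ya))) *
      (wedge ℝ D' * wedge ℝ D)) ≠ 0 := by
    refine smul_ne_zero hε ?_
    rw [← wedge_append, ← wedge_append, ← wedge_append, map_wedge, hDD]
    refine wedge_inl_mul_wedge_inr_ne_zero (by simpa only [wedge_append] using hne) ?_
    rw [wedge_append]
    exact wedge_inl_mul_wedge_inr_ne_zero (wedge_basisList_ne_zero _) (wedge_basisList_ne_zero _)
  rw [h, map_smul, smul_mul_assoc, smul_comm, hr] at hl
  rw [h, map_smul, smul_mul_assoc, smul_comm, hr] at hA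
  rw [smul_smul, smul_smul, smul_smul] at hl
  rw [smul_smul, smul_smul] at hA
  have hΞ : Ξ ≠ 0 := fun h0 => hA (by rw [h0, smul_zero])
  -- Both bracketings are now multiples of the same nonzero `Ξ`, so their scalars can be equated.
  have hα := smul_left_injective ℝ hΞ hl
  have hα0 := left_ne_zero_of_smul hA
  rw [pow_add]
  set a : ℝ := (-1) ^ (Module.finrank ℝ W * codim Yd Yb + codim Yd Yb * Module.finrank ℝ Yb +
      Module.finrank ℝ W * (v.length + codim Yd Ya) + v.length * w.length +
      Module.finrank ℝ Yb * (codim Yc Yb + codim Yd Yc + Module.finrank ℝ Yc))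
  set a' : ℝ := (-1) ^ (w'.length * (codim Yd Ya + Module.finrank ℝ W) + codim Yc Ya * w'.length +
      (Module.finrank ℝ Yc + codim Yd Yc) * (codim Yc Ya + w'.length + Module.finrank ℝ W +
        codim Yc Yb + codim Yb Ya))
  have hα' : η * (a' * (r₃ * r₄) * t') = a * (r₁ * r₂) * t := by simpa [mul_assoc] using hα
  have hβ0 : η * (a' * (r₃ * r₄) * t') ≠ 0 := by simpa [mul_assoc] using hα0
  have htpos : 0 < t := ht.lt_of_ne fun h0 => hβ0 (by rw [hα', ← h0, mul_zero])
  have htpos' : 0 < t' := ht'.lt_of_ne fun h0 => hβ0 (by rw [← h0, mul_zero, mul_zero])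
  -- The two scalars are equal and nonzero, so their product is a positive square; dividing by `t *
  -- t' > 0` leaves the claim.
  have hprod : 0 < (η * (a' * (r₃ * r₄) * t')) * (a * (r₁ * r₂) * t) := by
    rw [← hα']
    exact mul_self_pos.mpr hβ0
  have : (η * (a' * (r₃ * r₄) * t')) * (a * (r₁ * r₂) * t) =
      (η * (a * a' * (r₁ * r₂ * (r₃ * r₄)))) * (t * t') := by ring
  rw [this] at hprod
  exact pos_of_mul_pos_left hprod (mul_pos htpos htpos').le

end Sign

end ExteriorAlgebra

/-! ## Multiplying a permutation by a transposition -/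

/-- Multiplication by a transposition cuts a cycle containing both points in two and joins two
different cycles. In the first case the new orbit of `y` runs through `σ x, …, σ^k x = y` with `k`
minimal and misses `x`; in the second the new orbit of `x` follows the old cycle of `y` until it
reaches `y`. -/
theorem Equiv.Perm.sameCycle_mul_swap_iff {α : Type*} [Finite α] [DecidableEq α]
    (σ : Equiv.Perm α) {x y : α} (hxy : x ≠ y) :
    (σ * Equiv.swap x y).SameCycle x y ↔ ¬ σ.SameCycle x y := by
  set τ := σ * Equiv.swap x y with hτ
  have hτx : τ x = σ y := by simp [hτ]
  have hτy : τ y = σ x := by simp [hτ]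
  have hτz : ∀ z, z ≠ x → z ≠ y → τ z = σ z := fun z h1 h2 => by
    simp [hτ, Equiv.swap_apply_of_ne_of_ne h1 h2]
  constructor
  · intro h hs
    have hex : ∃ k, 0 < k ∧ (σ ^ k) x = y := by
      obtain ⟨k, hk⟩ := hs.exists_nat_pow_eq
      refine ⟨k, Nat.pos_of_ne_zero ?_, hk⟩
      rintro rfl
      exact hxy hk
    classical
    set k := Nat.find hex with hk
    obtain ⟨hk0, hky⟩ := Nat.find_spec hex
    have hny : ∀ j, 0 < j → j < k → (σ ^ j) x ≠ y := fun j h0 hj hjy =>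
      Nat.find_min hex hj ⟨h0, hjy⟩
    -- A return to `x` after `j < k` steps would make `y` reachable in `k - j` steps, against the
    -- minimality of `k`.
    have hnx : ∀ j, 0 < j → j ≤ k → (σ ^ j) x ≠ x := by
      intro j h0 hj hjx
      rcases hj.lt_or_eq with hj | rfl
      · refine hny (k - j) (by omega) (by omega) ?_
        rw [← hky]
        conv_rhs => rw [← hk, show k = (k - j) + j by omega, pow_add, Equiv.Perm.mul_apply, hjx]
      · exact hxy (hjx.symm.trans hky)
    have hA : ∀ m, ∃ j, 0 < j ∧ j ≤ k ∧ (τ ^ m) y = (σ ^ j) x := by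
      intro m
      induction m with
      | zero => exact ⟨k, hk0, le_rfl, hky.symm⟩
      | succ m ih =>
        obtain ⟨j, h0, hj, e⟩ := ih
        rw [pow_succ', Equiv.Perm.mul_apply, e]
        rcases hj.lt_or_eq with hj | hj
        · exact ⟨j + 1, by omega, by omega, by
            rw [hτz _ (hnx j h0 hj.le) (hny j h0 hj), pow_succ', Equiv.Perm.mul_apply]⟩
        · refine ⟨1, one_pos, hk0, ?_⟩
          rw [hj, hky, hτy, pow_one]
    obtain ⟨m, hm⟩ := h.symm.exists_nat_pow_eq
    obtain ⟨j, h0, hj, e⟩ := hA m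
    exact hnx j h0 hj (e.symm.trans hm)
  · intro hs
    have hex : ∃ k, 0 < k ∧ (σ ^ k) y = y :=
      ⟨orderOf σ, orderOf_pos σ, by rw [pow_orderOf_eq_one]; rfl⟩
    classical
    set k := Nat.find hex with hk
    obtain ⟨hk0, hky⟩ := Nat.find_spec hex
    have hj : ∀ j, j < k → (τ ^ (j + 1)) x = (σ ^ (j + 1)) y := by
      intro j
      induction j with
      | zero => intro _; simpa using hτx
      | succ j ih =>
        intro hj
        rw [pow_succ', Equiv.Perm.mul_apply, ih (by omega), hτz, ← Equiv.Perm.mul_apply,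
          ← pow_succ']
        · intro h
          exact hs (Equiv.Perm.SameCycle.symm ⟨(j + 1 : ℕ), by rw [zpow_natCast]; exact h⟩)
        · intro h
          exact Nat.find_min hex hj ⟨by omega, h⟩
    refine ⟨k, ?_⟩
    have := hj (k - 1) (by omega)
    rw [show k - 1 + 1 = k by omega] at this
    rw [zpow_natCast, this]
    exact hky

/-! ## Surgery on the classes generated by two involutions -/

section Surgery

/-- The relation generated by the steps of two maps. -/
def StepRel {P : Type*} (α β : P → P) (p q : P) : Prop := q = α p ∨ q = β p

variable {P : Type*} {χ : P → Bool} {α β : P → P}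

/-- The composition of two colour-reversing involutions on the points of the colour `true`. -/
def stepPerm (hα : Function.Involutive α) (hβ : Function.Involutive β)
    (hχα : ∀ p, χ (α p) = !χ p) (hχβ : ∀ p, χ (β p) = !χ p) :
    Equiv.Perm {p // χ p = true} where
  toFun p := ⟨α (β p), by rw [hχα, hχβ, p.2]; rfl⟩
  invFun p := ⟨β (α p), by rw [hχβ, hχα, p.2]; rfl⟩
  left_inv p := Subtype.ext (by simp [hα _, hβ _])
  right_inv p := Subtype.ext (by simp [hα _, hβ _])

/-- The two involutions alternate along a circle and reverse the colour. So `α ∘ β` runs once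
through the points of colour `true` on the circle in one direction; without a colour it would have
to be followed in both directions. -/
theorem quot_stepRel_eq_iff (hα : Function.Involutive α) (hβ : Function.Involutive β)
    (hχα : ∀ p, χ (α p) = !χ p) (hχβ : ∀ p, χ (β p) = !χ p) {p q : {p // χ p = true}} :
    Quot.mk (StepRel α β) (p : P) = Quot.mk _ (q : P) ↔
      (stepPerm hα hβ hχα hχβ).SameCycle p q := by
  set π := stepPerm hα hβ hχα hχβ with hπ
  constructor
  · intro h
    -- A point of the wrong colour is assigned the cycle of its `β`-neighbour, which makes `f`
    -- constant along both kinds of steps.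
    let f : P → Quotient (Equiv.Perm.SameCycle.setoid π) := fun p =>
      if h : χ p = true then Quotient.mk _ ⟨p, h⟩ else
        Quotient.mk _ ⟨β p, by rw [hχβ]; simpa using h⟩
    have hf : ∀ p q, StepRel α β p q → f p = f q := by
      rintro p q (rfl | rfl)
      · by_cases hp : χ p = true
        · have hq : ¬ χ (α p) = true := by rw [hχα, hp]; decide
          simp only [f, dif_pos hp, dif_neg hq]
          refine Quotient.sound (⟨-1, ?_⟩ : π.SameCycle _ _)
          rw [zpow_neg, zpow_one, Equiv.Perm.inv_eq_iff_eq]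
          exact Subtype.ext (by simp [hπ, stepPerm, hα _, hβ _])
        · have hq : χ (α p) = true := by rw [hχα]; simpa using hp
          simp only [f, dif_neg hp, dif_pos hq]
          refine Quotient.sound (⟨1, ?_⟩ : π.SameCycle _ _)
          exact Subtype.ext (by simp [hπ, stepPerm, hβ _])
      · by_cases hp : χ p = true
        · have hq : ¬ χ (β p) = true := by rw [hχβ, hp]; decide
          simp only [f, dif_pos hp, dif_neg hq, hβ p]
        · have hq : χ (β p) = true := by rw [hχβ]; simpa using hp
          simp only [f, dif_neg hp, dif_pos hq]
    have h2 : f p = f q := congrArg (Quot.lift f hf) h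
    simp only [f, dif_pos p.2, dif_pos q.2] at h2
    exact Quotient.exact h2
  · have h1 : ∀ q : {p // χ p = true}, Quot.mk (StepRel α β) (π q : P) = Quot.mk _ (q : P) := by
      intro q
      have e1 : Quot.mk (StepRel α β) (q : P) = Quot.mk _ (β q) := Quot.sound (Or.inr rfl)
      have e2 : Quot.mk (StepRel α β) (β q) = Quot.mk _ (α (β q)) := Quot.sound (Or.inl rfl)
      exact (e1.trans e2).symm
    rintro ⟨k, rfl⟩
    induction k using Int.induction_on with
    | zero => rfl
    | succ k ih =>
      rw [add_comm, zpow_add, zpow_one, Equiv.Perm.mul_apply, h1]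
      exact ih
    | pred k ih =>
      rw [ih, ← h1 ((π ^ (-(k : ℤ) - 1)) p), ← Equiv.Perm.mul_apply, ← zpow_one_add]
      congr 5
      ring

/-- Exchanging the `β`-neighbours of two points of the same colour multiplies the permutation `α ∘
β` by a transposition. -/
theorem quot_stepRel_surgery [Finite P] {β' : P → P} (hα : Function.Involutive α)
    (hβ : Function.Involutive β) (hβ' : Function.Involutive β')
    (hχα : ∀ p, χ (α p) = !χ p) (hχβ : ∀ p, χ (β p) = !χ p) (hχβ' : ∀ p, χ (β' p) = !χ p)
    {p q : P} (hp : χ p = true) (hq : χ q = true) (hpq : p ≠ q) (h1 : β' p = β q)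
    (h2 : β' q = β p) (h3 : ∀ z, χ z = true → z ≠ p → z ≠ q → β' z = β z) :
    Quot.mk (StepRel α β') p = Quot.mk _ q ↔ ¬ Quot.mk (StepRel α β) p = Quot.mk _ q := by
  classical
  rw [quot_stepRel_eq_iff (p := ⟨p, hp⟩) (q := ⟨q, hq⟩) hα hβ hχα hχβ,
    quot_stepRel_eq_iff (p := ⟨p, hp⟩) (q := ⟨q, hq⟩) hα hβ' hχα hχβ',
    ← Equiv.Perm.sameCycle_mul_swap_iff _ fun h => hpq (congrArg Subtype.val h)]
  have : stepPerm hα hβ' hχα hχβ' =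
      stepPerm hα hβ hχα hχβ * Equiv.swap (⟨p, hp⟩ : {p // χ p = true}) ⟨q, hq⟩ := by
    ext z
    rw [Equiv.Perm.mul_apply]
    rcases eq_or_ne z ⟨p, hp⟩ with rfl | hzp
    · rw [Equiv.swap_apply_left]
      simp [stepPerm, h1]
    rcases eq_or_ne z ⟨q, hq⟩ with rfl | hzq
    · rw [Equiv.swap_apply_right]
      simp [stepPerm, h2]
    rw [Equiv.swap_apply_of_ne_of_ne hzp hzq]
    simp only [stepPerm, Equiv.coe_fn_mk]
    rw [h3 z z.2 (fun h => hzp (Subtype.ext h)) (fun h => hzq (Subtype.ext h))]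
  rw [this]

end Surgery

/-- Identifying exactly two classes of an equivalence relation lowers the number of classes
by one. -/
theorem card_quot_eq_succ {P : Type*} [Finite P] {r r' : P → P → Prop} {x y : P}
    (h : ∀ p q, r p q → Quot.mk r' p = Quot.mk r' q)
    (h' : ∀ p q, r' p q → Quot.mk r p = Quot.mk r q ∨
      (Quot.mk r p = Quot.mk r x ∨ Quot.mk r p = Quot.mk r y) ∧
      (Quot.mk r q = Quot.mk r x ∨ Quot.mk r q = Quot.mk r y))
    (hxy : Quot.mk r x ≠ Quot.mk r y) (hxy' : Quot.mk r' x = Quot.mk r' y) :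
    Nat.card (Quot r) = Nat.card (Quot r') + 1 := by
  classical
  let f : Quot r → Quot r' := Quot.lift (Quot.mk r') h
  -- The right-hand side is an equivalence relation containing `r'`.
  have hf : ∀ p q, Quot.mk r' p = Quot.mk r' q → Quot.mk r p = Quot.mk r q ∨
      (Quot.mk r p = Quot.mk r x ∨ Quot.mk r p = Quot.mk r y) ∧
      (Quot.mk r q = Quot.mk r x ∨ Quot.mk r q = Quot.mk r y) := by
    intro p q hpq
    have := Quot.eqvGen_exact hpq
    clear hpq
    induction this with
    | rel p q hpq => exact h' p q hpq
    | refl p => exact Or.inl rfl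
    | symm p q _ ih =>
      rcases ih with ih | ⟨h1, h2⟩
      · exact Or.inl ih.symm
      · exact Or.inr ⟨h2, h1⟩
    | trans p q s _ _ ih1 ih2 =>
      rcases ih1 with ih1 | ⟨h1, h2⟩
      · rwa [ih1]
      · rcases ih2 with ih2 | ⟨h3, h4⟩
        · rw [← ih2]
          exact Or.inr ⟨h1, h2⟩
        · exact Or.inr ⟨h1, h4⟩
  -- After removing the class of `x`, which is represented by that of `y`, the remaining classes
  -- correspond to those of `r'`.
  have hbij : Function.Bijective fun u : {u : Quot r // u ≠ Quot.mk r x} => f u := by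
    constructor
    · rintro ⟨⟨p⟩, hp⟩ ⟨⟨q⟩, hq⟩ hpq
      refine Subtype.ext ?_
      rcases hf p q hpq with h1 | ⟨h1 | h1, h2 | h2⟩
      · exact h1
      · exact absurd h1 hp
      · exact absurd h1 hp
      · exact absurd h2 hq
      · exact h1.trans h2.symm
    · rintro ⟨p⟩
      by_cases hp : Quot.mk r p = Quot.mk r x
      · exact ⟨⟨Quot.mk r y, hxy.symm⟩, hxy'.symm.trans (congrArg f hp).symm⟩
      · exact ⟨⟨Quot.mk r p, hp⟩, rfl⟩
  have e1 := Nat.card_congr (Equiv.ofBijective _ hbij)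
  have e2 := Nat.card_congr (Equiv.optionSubtypeNe (Quot.mk r x))
  have : Finite {u : Quot r // u ≠ Quot.mk r x} := Subtype.finite
  rw [← e2, ← e1]
  exact Finite.card_option

theorem Quot.mk_eq_mk_iff_of_imp {P : Type*} {r r' : P → P → Prop}
    (h : ∀ p q, r p q → Quot.mk r' p = Quot.mk r' q)
    (h' : ∀ p q, r' p q → Quot.mk r p = Quot.mk r q) (p q : P) :
    Quot.mk r p = Quot.mk r q ↔ Quot.mk r' p = Quot.mk r' q :=
  ⟨fun e => congrArg (Quot.lift (Quot.mk r') h) e, fun e => congrArg (Quot.lift (Quot.mk r) h') e⟩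

/-! ### Parity of the endpoints of an arc -/

namespace CrossinglessMatching

variable {n : ℕ}

theorem partner_involutive (b : CrossinglessMatching n) : Function.Involutive b.partner :=
  b.partner_partner

/-- The points strictly inside an arc are matched among themselves. -/
theorem partner_mem_Ioo (b : CrossinglessMatching n) {i j : Fin (2 * n)}
    (hj : j ∈ Finset.Ioo i (b.partner i)) : b.partner j ∈ Finset.Ioo i (b.partner i) := by
  rw [Finset.mem_Ioo] at hj ⊢
  obtain ⟨h1, h2⟩ := hj
  have n1 := b.noncrossing i j
  have n2 := b.noncrossing (b.partner j) i
  rw [b.partner_partner] at n2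
  have e1 : b.partner j ≠ i := by
    rintro rfl
    rw [b.partner_partner] at h2
    exact lt_irrefl _ h2
  have e2 : b.partner j ≠ b.partner i := fun h => h1.ne' (b.partner_involutive.injective h)
  constructor
  · by_contra hlt
    exact n2 ⟨lt_of_le_of_ne (not_lt.mp hlt) e1, h1, h2⟩
  · by_contra hlt
    exact n1 ⟨h1, h2, lt_of_le_of_ne (not_lt.mp hlt) e2.symm⟩

/-- The points strictly inside the arc carry a fixed-point-free involution, so their number is even.
This is what makes the diagrams chessboard colourable. -/
theorem parity_partner_of_lt (b : CrossinglessMatching n) {i : Fin (2 * n)}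
    (h : i < b.partner i) : (b.partner i : ℕ) % 2 ≠ (i : ℕ) % 2 := by
  have h1 : ∏ _j ∈ Finset.Ioo i (b.partner i), (-1 : ℤ) = 1 :=
    Finset.prod_involution (fun j _ => b.partner j) (fun _ _ => by norm_num)
      (fun j _ _ => b.partner_ne j) (fun j hj => b.partner_mem_Ioo hj)
      (fun j _ => b.partner_partner j)
  rw [Finset.prod_const, Fin.card_Ioo, neg_one_pow_eq_one_iff_even (by norm_num)] at h1
  have h2 : (i : ℕ) < b.partner i := h
  obtain ⟨k, hk⟩ := h1
  omega

theorem parity_partner (b : CrossinglessMatching n) (i : Fin (2 * n)) :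
    (b.partner i : ℕ) % 2 ≠ (i : ℕ) % 2 := by
  rcases lt_or_gt_of_ne (b.partner_ne i) with h | h
  · have h2 : b.partner i < b.partner (b.partner i) := by rwa [b.partner_partner]
    have := b.parity_partner_of_lt h2
    rw [b.partner_partner] at this
    exact this.symm
  · exact b.parity_partner_of_lt h

end CrossinglessMatching

/-! ## The saddles as surgeries -/

section Stacked

variable {n : ℕ} (c b a : CrossinglessMatching n)

/-- A chessboard colouring of the points of two parallel lines. -/
def pointColour (p : Fin (2 * n) × Bool) : Bool := xor (decide ((p.1 : ℕ) % 2 = 0)) p.2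

/-- The involution of the points given by the outer matchings. -/
def outerStep (p : Fin (2 * n) × Bool) : Fin (2 * n) × Bool :=
  (if p.2 then c.partner p.1 else a.partner p.1, p.2)

open scoped Classical in
/-- The involution of the points given by what is left of the middle matching and by the vertical
strands. -/
noncomputable def innerStep (S : Set (Fin (2 * n))) (p : Fin (2 * n) × Bool) :
    Fin (2 * n) × Bool :=
  if p.1 ∈ S then (p.1, !p.2) else (b.partner p.1, p.2)

theorem outerStep_involutive : Function.Involutive (outerStep c a) := by
  rintro ⟨i, _ | _⟩ <;> simp [outerStep, c.partner_partner, a.partner_partner]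

theorem innerStep_involutive {S : Set (Fin (2 * n))} (hS : ∀ i, b.partner i ∈ S ↔ i ∈ S) :
    Function.Involutive (innerStep b S) := by
  rintro ⟨i, s⟩
  by_cases h : i ∈ S
  · simp [innerStep, h]
  · simp [innerStep, h, hS i, b.partner_partner]

theorem decide_parity_partner (i : Fin (2 * n)) :
    decide ((b.partner i : ℕ) % 2 = 0) = !decide ((i : ℕ) % 2 = 0) := by
  have := b.parity_partner i
  by_cases h : (i : ℕ) % 2 = 0
  · simp only [h, decide_true, Bool.not_true, decide_eq_false_iff_not]
    omega
  · simp only [h, decide_false, Bool.not_false, decide_eq_true_eq]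
    omega

theorem pointColour_outerStep (p : Fin (2 * n) × Bool) :
    pointColour (outerStep c a p) = !pointColour p := by
  obtain ⟨i, _ | _⟩ := p <;> simp [outerStep, pointColour, decide_parity_partner]

theorem pointColour_innerStep (S : Set (Fin (2 * n))) (p : Fin (2 * n) × Bool) :
    pointColour (innerStep b S p) = !pointColour p := by
  obtain ⟨i, s⟩ := p
  by_cases h : i ∈ S
  · simp [innerStep, pointColour, h]
  · simp [innerStep, pointColour, h, decide_parity_partner]

variable {c b a}

theorem quot_stackedAdj_eq_iff (S : Set (Fin (2 * n))) (p q : Fin (2 * n) × Bool) :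
    Quot.mk (StackedAdj c b a S) p = Quot.mk _ q ↔
      Quot.mk (StepRel (outerStep c a) (innerStep b S)) p = Quot.mk _ q := by
  refine Quot.mk_eq_mk_iff_of_imp (fun p q h => ?_) (fun p q h => ?_) p q
  · cases h with
    | lower i => exact Quot.sound (Or.inl (by simp [outerStep]))
    | upper i => exact Quot.sound (Or.inl (by simp [outerStep]))
    | cup i side h => exact Quot.sound (Or.inr (by simp [innerStep, h]))
    | strand i h => exact Quot.sound (Or.inr (by simp [innerStep, h]))
  · rcases h with rfl | rfl
    · obtain ⟨i, _ | _⟩ := p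
      · exact Quot.sound (by simpa [outerStep] using StackedAdj.lower i)
      · exact Quot.sound (by simpa [outerStep] using StackedAdj.upper i)
    · obtain ⟨i, s⟩ := p
      by_cases h : i ∈ S
      · cases s
        · exact Quot.sound (by simpa [innerStep, h] using StackedAdj.strand i h)
        · exact (Quot.sound (by simpa [innerStep, h] using StackedAdj.strand i h)).symm
      · exact Quot.sound (by simpa [innerStep, h] using StackedAdj.cup i s h)

variable {S S' : Set (Fin (2 * n))} {i : Fin (2 * n)}

/-- Before the saddle, the two points on the left vertical strand are on the same circle if and only
if, after the saddle, the two strands are on different circles. -/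
theorem stackedAdj_surgery (hS : ∀ j, b.partner j ∈ S ↔ j ∈ S) (hi : i ∉ S)
    (hS' : ∀ j, j ∈ S' ↔ j ∈ S ∨ j = i ∨ j = b.partner i) :
    Quot.mk (StackedAdj c b a S') (i, false) = Quot.mk _ (b.partner i, false) ↔
      ¬ Quot.mk (StackedAdj c b a S) (i, false) = Quot.mk _ (i, true) := by
  have hbi : b.partner i ∉ S := by rwa [hS]
  have hi' : i ∈ S' := (hS' i).mpr (Or.inr (Or.inl rfl))
  have hbi' : b.partner i ∈ S' := (hS' _).mpr (Or.inr (Or.inr rfl))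
  have hSS' : ∀ j, b.partner j ∈ S' ↔ j ∈ S' := by
    intro j
    rw [hS', hS', hS, b.partner_involutive.injective.eq_iff, ← b.partner_involutive.eq_iff,
      or_comm (a := b.partner j = i)]
  have e1 : Quot.mk (StackedAdj c b a S') (b.partner i, false) = Quot.mk _ (b.partner i, true) :=
    Quot.sound (.strand _ hbi')
  have e2 : Quot.mk (StackedAdj c b a S) (i, true) = Quot.mk _ (b.partner i, true) :=
    Quot.sound (.cup _ _ hi)
  rw [e1, e2, quot_stackedAdj_eq_iff, quot_stackedAdj_eq_iff]
  have hflip : pointColour (b.partner i, true) = pointColour (i, false) := by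
    simp [pointColour, decide_parity_partner]
  -- The surgery is performed at these two diagonally opposite points: they have the same colour,
  -- and the saddle exchanges their inner neighbours.
  have hne : ((i, false) : Fin (2 * n) × Bool) ≠ (b.partner i, true) := by simp
  have hz : ∀ z : Fin (2 * n) × Bool, pointColour z = pointColour (i, false) → z ≠ (i, false) →
      z ≠ (b.partner i, true) → innerStep b S' z = innerStep b S z := by
    rintro ⟨j, s⟩ hj h1 h2
    have hji : j ≠ i := by
      rintro rfl
      cases s
      · exact h1 rfl
      · simp [pointColour] at hj
    have hjb : j ≠ b.partner i := by
      rintro rfl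
      cases s
      · simp [pointColour, decide_parity_partner] at hj
      · exact h2 rfl
    have : j ∈ S' ↔ j ∈ S := by rw [hS']; simp [hji, hjb]
    by_cases hjS : j ∈ S
    · simp [innerStep, hjS, this.mpr hjS]
    · simp [innerStep, hjS, mt this.mp hjS]
  have f1 : innerStep b S' (i, false) = innerStep b S (b.partner i, true) := by
    simp [innerStep, hi', hbi, b.partner_partner]
  have f2 : innerStep b S' (b.partner i, true) = innerStep b S (i, false) := by
    simp [innerStep, hi, hbi']
  -- The surgery lemma is applied to the colouring or its complement, so that the two points get the
  -- colour `true`.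
  by_cases hc : pointColour (i, false) = true
  · exact quot_stepRel_surgery (χ := pointColour) (outerStep_involutive c a)
      (innerStep_involutive b hS) (innerStep_involutive b hSS') (pointColour_outerStep c a)
      (pointColour_innerStep b S) (pointColour_innerStep b S') hc (hflip.trans hc) hne f1 f2
      fun z h => hz z (h.trans hc.symm)
  · have hc' : pointColour (i, false) = false := by simpa using hc
    refine quot_stepRel_surgery (χ := fun p => !pointColour p) (outerStep_involutive c a)
      (innerStep_involutive b hS) (innerStep_involutive b hSS')
      (fun p => congrArg _ (pointColour_outerStep c a p))
      (fun p => congrArg _ (pointColour_innerStep b S p))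
      (fun p => congrArg _ (pointColour_innerStep b S' p)) (by simp [hc'])
      (by simp [hflip, hc']) hne f1 f2 fun z h => hz z ?_
    rw [hc']
    simpa using h

/-- The only adjacencies lost in the saddle are the two copies of the contracted arc, whose
endpoints then lie on the two new strands. -/
theorem stackedAdj_forward (hS' : ∀ j, j ∈ S' ↔ j ∈ S ∨ j = i ∨ j = b.partner i)
    {p q : Fin (2 * n) × Bool} (h : StackedAdj c b a S p q) :
    Quot.mk (StackedAdj c b a S') p = Quot.mk _ q ∨
      (Quot.mk (StackedAdj c b a S') p = Quot.mk _ (i, false) ∨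
        Quot.mk (StackedAdj c b a S') p = Quot.mk _ (b.partner i, false)) ∧
      (Quot.mk (StackedAdj c b a S') q = Quot.mk _ (i, false) ∨
        Quot.mk (StackedAdj c b a S') q = Quot.mk _ (b.partner i, false)) := by
  have hs : ∀ (j : Fin (2 * n)) (s : Bool), j = i ∨ j = b.partner i →
      Quot.mk (StackedAdj c b a S') (j, s) = Quot.mk _ (i, false) ∨
        Quot.mk (StackedAdj c b a S') (j, s) = Quot.mk _ (b.partner i, false) := by
    intro j s hj
    have hjs : Quot.mk (StackedAdj c b a S') (j, s) = Quot.mk _ (j, false) := by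
      cases s
      · rfl
      · exact (Quot.sound (.strand _ ((hS' j).mpr (Or.inr hj)))).symm
    rw [hjs]
    rcases hj with rfl | rfl
    · exact Or.inl rfl
    · exact Or.inr rfl
  cases h with
  | lower j => exact Or.inl (Quot.sound (.lower j))
  | upper j => exact Or.inl (Quot.sound (.upper j))
  | strand j h => exact Or.inl (Quot.sound (.strand j ((hS' j).mpr (Or.inl h))))
  | cup j s h =>
    by_cases hj : j ∈ S'
    · have hj2 := ((hS' j).mp hj).resolve_left h
      refine Or.inr ⟨hs j s hj2, hs _ s ?_⟩
      rcases hj2 with rfl | rfl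
      · exact Or.inr rfl
      · exact Or.inl (b.partner_partner i)
    · exact Or.inl (Quot.sound (.cup j s hj))

theorem stackedAdj_backward (hi : i ∉ S)
    (hS' : ∀ j, j ∈ S' ↔ j ∈ S ∨ j = i ∨ j = b.partner i)
    {p q : Fin (2 * n) × Bool} (h : StackedAdj c b a S' p q) :
    Quot.mk (StackedAdj c b a S) p = Quot.mk _ q ∨
      (Quot.mk (StackedAdj c b a S) p = Quot.mk _ (i, false) ∨
        Quot.mk (StackedAdj c b a S) p = Quot.mk _ (i, true)) ∧
      (Quot.mk (StackedAdj c b a S) q = Quot.mk _ (i, false) ∨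
        Quot.mk (StackedAdj c b a S) q = Quot.mk _ (i, true)) := by
  cases h with
  | lower j => exact Or.inl (Quot.sound (.lower j))
  | upper j => exact Or.inl (Quot.sound (.upper j))
  | cup j s h => exact Or.inl (Quot.sound (.cup j s fun hj => h ((hS' j).mpr (Or.inl hj))))
  | strand j h =>
    rcases (hS' j).mp h with h | rfl | rfl
    · exact Or.inl (Quot.sound (.strand j h))
    · exact Or.inr ⟨Or.inl rfl, Or.inr rfl⟩
    · have e : ∀ s, Quot.mk (StackedAdj c b a S) (b.partner i, s) = Quot.mk _ (i, s) :=
        fun s => (Quot.sound (.cup i s hi)).symm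
      exact Or.inr ⟨Or.inl (e _), Or.inr (e _)⟩

/-- The saddle which splits a circle. -/
theorem card_circles_split (hS : ∀ j, b.partner j ∈ S ↔ j ∈ S) (hi : i ∉ S)
    (hS' : ∀ j, j ∈ S' ↔ j ∈ S ∨ j = i ∨ j = b.partner i)
    (h : Quot.mk (StackedAdj c b a S) (i, false) = Quot.mk _ (i, true)) :
    Nat.card (Circles (StackedAdj c b a S')) = Nat.card (Circles (StackedAdj c b a S)) + 1 := by
  refine card_quot_eq_succ (x := (i, false)) (y := (b.partner i, false)) (fun p q hpq => ?_)
    (fun p q hpq => stackedAdj_forward hS' hpq)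
    (fun e => (stackedAdj_surgery hS hi hS').mp e h) (Quot.sound (.cup _ _ hi))
  rcases stackedAdj_backward hi hS' hpq with e | ⟨e1 | e1, e2 | e2⟩ <;> simp_all

/-- The saddle which merges two circles. -/
theorem card_circles_merge (hS : ∀ j, b.partner j ∈ S ↔ j ∈ S) (hi : i ∉ S)
    (hS' : ∀ j, j ∈ S' ↔ j ∈ S ∨ j = i ∨ j = b.partner i)
    (h : ¬ Quot.mk (StackedAdj c b a S) (i, false) = Quot.mk _ (i, true)) :
    Nat.card (Circles (StackedAdj c b a S)) = Nat.card (Circles (StackedAdj c b a S')) + 1 := by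
  have h' := (stackedAdj_surgery hS hi hS').mpr h
  refine card_quot_eq_succ (x := (i, false)) (y := (i, true)) (fun p q hpq => ?_)
    (fun p q hpq => stackedAdj_backward hi hS' hpq) h
    (Quot.sound (.strand _ ((hS' i).mpr (Or.inr (Or.inl rfl)))))
  rcases stackedAdj_forward hS' hpq with e | ⟨e1 | e1, e2 | e2⟩ <;> simp_all

end Stacked

/-! ## The product in terms of points -/

namespace ExteriorAlgebra

/-- Left multiplication by `κ` kills every wedge with a factor in the span of `κ`. This is why a
split does not depend on which of the two new circles replaces the old one. -/
theorem ι_mul_map_congr {R M N : Type*} [CommRing R] [AddCommGroup M] [Module R M]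
    [AddCommGroup N] [Module R N] {κ : N} {f g : M →ₗ[R] N}
    (h : ∀ x, f x - g x ∈ Submodule.span R {κ}) (X : ExteriorAlgebra R M) :
    ι R κ * map f X = ι R κ * map g X := by
  have hX : X ∈ Submodule.span R (Set.range fun x : Σ k, Fin k → M => ιMulti R x.1 x.2) := by
    rw [ιMulti_span]
    trivial
  induction hX using Submodule.span_induction with
  | zero => simp
  | add x y _ _ hx hy => rw [map_add, map_add, mul_add, mul_add, hx, hy]
  | smul r x _ hx => rw [map_smul, map_smul, mul_smul_comm, mul_smul_comm, hx]
  | mem x hx =>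
    obtain ⟨⟨k, v⟩, rfl⟩ := hx
    have h1 := wedge_map_mul_congr f g (List.ofFn v) (ι R κ) fun x _ => by
      refine (Submodule.span_le.mpr ?_ : Submodule.span R {κ} ≤ _) (h x)
      rintro _ rfl
      exact ι_sq_zero _
    have h2 : ∀ l : List N, ι R κ * wedge R l = (-1 : R) ^ l.length • (wedge R l * ι R κ) :=
      fun l => by simpa using wedge_mul_wedge_comm R [κ] l
    simp only [ιMulti_eq_wedge, map_wedge]
    rw [h2, h2, h1, List.length_map, List.length_map]

end ExteriorAlgebra

open ExteriorAlgebra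

section Points

variable {P : Type}

/-- The map from the free group on the points of a diagram to that on its circles. -/
noncomputable def pointMap (r : P → P → Prop) : (P →₀ ℤ) →ₗ[ℤ] CircleGroup r :=
  Finsupp.lmapDomain ℤ ℤ (Quot.mk r)

@[simp] theorem pointMap_single (r : P → P → Prop) (p : P) (k : ℤ) :
    pointMap r (Finsupp.single p k) = Finsupp.single (Quot.mk r p) k :=
  Finsupp.mapDomain_single

theorem pointMap_surjective (r : P → P → Prop) : Function.Surjective (pointMap r) :=
  Finsupp.mapDomain_surjective Quot.mk_surjective

/-- Modulo the differences, a generator depends only on the class of its point, so the quotient map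
factors through the free module on the classes. -/
theorem Finsupp.ker_lmapDomain_mk (R : Type*) [CommRing R] (r : P → P → Prop) :
    LinearMap.ker (Finsupp.lmapDomain R R (Quot.mk r)) =
      Submodule.span R {x | ∃ p q, r p q ∧ x = Finsupp.single p 1 - Finsupp.single q 1} := by
  set N := Submodule.span R
    {x : P →₀ R | ∃ p q, r p q ∧ x = Finsupp.single p 1 - Finsupp.single q 1} with hN
  refine le_antisymm (fun x hx => ?_) (Submodule.span_le.mpr ?_)
  · let f : Quot r → (P →₀ R) ⧸ N := Quot.lift (fun p => N.mkQ (Finsupp.single p 1))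
      fun p q h => (Submodule.Quotient.eq N).mpr (Submodule.subset_span ⟨p, q, h, rfl⟩)
    have hf : Finsupp.linearCombination R f ∘ₗ Finsupp.lmapDomain R R (Quot.mk r) = N.mkQ := by
      ext p
      simp [f, Finsupp.mapDomain_single]
    have h2 := LinearMap.congr_fun hf x
    rw [LinearMap.comp_apply, LinearMap.mem_ker.mp hx, map_zero] at h2
    exact (Submodule.Quotient.mk_eq_zero N).mp h2.symm
  · rintro _ ⟨p, q, h, rfl⟩
    rw [SetLike.mem_coe, LinearMap.mem_ker, map_sub, Finsupp.lmapDomain_apply,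
      Finsupp.lmapDomain_apply, Finsupp.mapDomain_single, Finsupp.mapDomain_single,
      Quot.sound h, sub_self]

theorem ker_pointMap (r : P → P → Prop) : LinearMap.ker (pointMap r) =
    Submodule.span ℤ {x | ∃ p q, r p q ∧ x = Finsupp.single p 1 - Finsupp.single q 1} :=
  Finsupp.ker_lmapDomain_mk ℤ r

theorem sub_mem_ker_pointMap {r : P → P → Prop} {p q : P} (h : Quot.mk r p = Quot.mk r q) :
    Finsupp.single p (1 : ℤ) - Finsupp.single q 1 ∈ LinearMap.ker (pointMap r) := by
  rw [LinearMap.mem_ker, map_sub, pointMap_single, pointMap_single, h, sub_self]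

end Points

/-! ### Saddles and products as left multiplications by endpoint differences -/

section Saddle

variable {n : ℕ} {b : CrossinglessMatching n}

/-- The difference of the endpoints of an arc. -/
noncomputable def arcVec (b : CrossinglessMatching n) (i : Fin (2 * n)) : Fin (2 * n) →₀ ℤ :=
  Finsupp.single i 1 - Finsupp.single (b.partner i) 1

/-- The difference of the endpoints of an arc on the lower line. -/
noncomputable def lowerArcVec (b : CrossinglessMatching n) (i : Fin (2 * n)) :
    Fin (2 * n) × Bool →₀ ℤ :=
  Finsupp.single (i, false) 1 - Finsupp.single (b.partner i, false) 1

theorem lmapDomain_fst_lowerArcVec (i : Fin (2 * n)) :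
    Finsupp.lmapDomain ℤ ℤ Prod.fst (lowerArcVec b i) = arcVec b i := by
  rw [lowerArcVec, arcVec, map_sub]
  simp [Finsupp.mapDomain_single]

/-- The one kind of relation that the saddle destroys joins points of the two new strands, and such
points differ by the arc vector up to surviving relations. -/
theorem ker_pointMap_le {c a : CrossinglessMatching n} {S S' : Set (Fin (2 * n))}
    {i : Fin (2 * n)} (hS' : ∀ j, j ∈ S' ↔ j ∈ S ∨ j = i ∨ j = b.partner i) :
    LinearMap.ker (pointMap (StackedAdj c b a S)) ≤
      Submodule.span ℤ {lowerArcVec b i} ⊔ LinearMap.ker (pointMap (StackedAdj c b a S')) := by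
  rw [ker_pointMap (StackedAdj c b a S)]
  refine Submodule.span_le.mpr ?_
  rintro _ ⟨p, q, h, rfl⟩
  set T := Submodule.span ℤ {lowerArcVec b i} ⊔ LinearMap.ker (pointMap (StackedAdj c b a S'))
  have h0 : ∀ p q, Quot.mk (StackedAdj c b a S') p = Quot.mk _ q →
      Finsupp.single p (1 : ℤ) - Finsupp.single q 1 ∈ T := fun p q h =>
    Submodule.mem_sup_right (sub_mem_ker_pointMap h)
  have h1 : lowerArcVec b i ∈ T := Submodule.mem_sup_left (Submodule.mem_span_singleton_self _)
  have h2 : ∀ p, Quot.mk (StackedAdj c b a S') p = Quot.mk _ (i, false) ∨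
      Quot.mk (StackedAdj c b a S') p = Quot.mk _ (b.partner i, false) →
      Finsupp.single p (1 : ℤ) - Finsupp.single (i, false) 1 ∈ T := by
    rintro p (h | h)
    · exact h0 _ _ h
    · have := sub_mem (h0 _ _ h) h1
      rw [lowerArcVec] at this
      convert this using 1
      abel
  rcases stackedAdj_forward hS' h with h | ⟨h3, h4⟩
  · exact h0 _ _ h
  · have := sub_mem (h2 _ h3) (h2 _ h4)
    rwa [sub_sub_sub_cancel_right] at this

namespace ChronContraction

variable (C : ChronContraction b) (c a : CrossinglessMatching n)

theorem mem_contracted_succ (t : Fin n) (j : Fin (2 * n)) :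
    j ∈ C.contracted t.succ ↔
      j ∈ C.contracted t.castSucc ∨ j = C.arc t ∨ j = b.partner (C.arc t) := by
  constructor
  · rintro ⟨s, hs, hj⟩
    rcases (Fin.castSucc_lt_succ_iff.mp hs).lt_or_eq with h | rfl
    · exact Or.inl ⟨s, Fin.castSucc_lt_castSucc_iff.mpr h, hj⟩
    · exact Or.inr hj
  · rintro (⟨s, hs, hj⟩ | hj)
    · exact ⟨s, hs.trans t.castSucc_lt_succ, hj⟩
    · exact ⟨t, t.castSucc_lt_succ, hj⟩

theorem partner_mem_contracted (t : Fin (n + 1)) (j : Fin (2 * n)) :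
    b.partner j ∈ C.contracted t ↔ j ∈ C.contracted t := by
  have h : ∀ j, j ∈ C.contracted t → b.partner j ∈ C.contracted t := by
    rintro j ⟨s, hs, rfl | rfl⟩
    · exact ⟨s, hs, Or.inr rfl⟩
    · exact ⟨s, hs, Or.inl (b.partner_partner _)⟩
  exact ⟨fun hj => b.partner_partner j ▸ h _ hj, h j⟩

theorem arc_not_mem_contracted (t : Fin n) : (C.arc t : Fin (2 * n)) ∉ C.contracted t.castSucc := by
  rintro ⟨s, hs, h | h⟩
  · have : t = s := C.arc.injective (Subtype.ext h)
    subst this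
    exact lt_irrefl _ hs
  · have h1 := (C.arc t).2
    have h2 := (C.arc s).2
    rw [h, b.partner_partner] at h1
    exact lt_asymm h1 h2

/-- A saddle multiplies by the differences in `js` on the left. -/
theorem saddle_eq (t : Fin n) : ∃ js : List (Fin (2 * n)),
    (∀ X, C.saddle c a t (map (pointMap (C.diagram c a t.castSucc)) X) =
      map (pointMap (C.diagram c a t.succ)) (wedge ℤ (js.map (lowerArcVec b)) * X)) ∧
    2 * js.length + Nat.card (Circles (C.diagram c a t.castSucc)) =
      1 + Nat.card (Circles (C.diagram c a t.succ)) ∧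
    LinearMap.ker (pointMap (C.diagram c a t.castSucc)) ≤
      Submodule.span ℤ {x | x ∈ js.map (lowerArcVec b)} ⊔
        LinearMap.ker (pointMap (C.diagram c a t.succ)) := by
  have hS' := C.mem_contracted_succ t
  have hS := C.partner_mem_contracted t.castSucc
  have hi := C.arc_not_mem_contracted t
  have hker := ker_pointMap_le (c := c) (a := a) hS'
  set i : Fin (2 * n) := (C.arc t).val
  -- The representative chosen by `transport` may lie on the other new circle than `p`; the error is
  -- a multiple of the arc vector. It vanishes for a merge and is killed by the left factor for a
  -- split.
  have htr : ∀ p, (Finsupp.lmapDomain ℤ ℤ (C.transport c a t) ∘ₗ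
      pointMap (C.diagram c a t.castSucc)) (Finsupp.single p 1) -
        pointMap (C.diagram c a t.succ) (Finsupp.single p 1) ∈
      Submodule.span ℤ {pointMap (C.diagram c a t.succ) (lowerArcVec b i)} := by
    intro p
    set q := (Quot.mk (C.diagram c a t.castSucc) p).out with hq
    have h1 : Finsupp.single q (1 : ℤ) - Finsupp.single p 1 ∈
        LinearMap.ker (pointMap (C.diagram c a t.castSucc)) :=
      sub_mem_ker_pointMap (Quot.out_eq _)
    obtain ⟨y, hy, z, hz, e⟩ := Submodule.mem_sup.mp (hker h1)
    obtain ⟨k, rfl⟩ := Submodule.mem_span_singleton.mp hy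
    have h2 : (Finsupp.lmapDomain ℤ ℤ (C.transport c a t) ∘ₗ
        pointMap (C.diagram c a t.castSucc)) (Finsupp.single p 1) =
        pointMap (C.diagram c a t.succ) (Finsupp.single q 1) := by
      rw [LinearMap.comp_apply, pointMap_single, pointMap_single]
      exact Finsupp.mapDomain_single
    rw [h2, ← map_sub, ← e, map_add, LinearMap.mem_ker.mp hz, add_zero, map_smul]
    exact Submodule.smul_mem _ _ (Submodule.mem_span_singleton_self _)
  have htr' : ∀ x, (Finsupp.lmapDomain ℤ ℤ (C.transport c a t) ∘ₗ
      pointMap (C.diagram c a t.castSucc)) x - pointMap (C.diagram c a t.succ) x ∈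
      Submodule.span ℤ {pointMap (C.diagram c a t.succ) (lowerArcVec b i)} := by
    intro x
    rw [← LinearMap.sub_apply]
    induction x using Finsupp.induction_linear with
    | zero => rw [map_zero]; exact zero_mem _
    | add x y hx hy => rw [map_add]; exact add_mem hx hy
    | single p k =>
      have hk : Finsupp.single p k = k • Finsupp.single p (1 : ℤ) := by
        rw [Finsupp.smul_single, smul_eq_mul, mul_one]
      rw [hk, map_smul]
      exact Submodule.smul_mem _ _ (htr p)
  have hmap : ∀ X, mapCircles (C.transport c a t) (map (pointMap (C.diagram c a t.castSucc)) X) =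
      map (Finsupp.lmapDomain ℤ ℤ (C.transport c a t) ∘ₗ pointMap (C.diagram c a t.castSucc)) X :=
    fun X => by rw [mapCircles, ← AlgHom.comp_apply, map_comp_map]
  by_cases h : Quot.mk (C.diagram c a t.castSucc) (i, false) = Quot.mk _ (i, true)
  · have hcard := card_circles_split hS hi hS' h
    -- The orientation of the split is encoded by taking the left or the right endpoint of the arc
    -- as `j`.
    obtain ⟨j, hj, hspan⟩ : ∃ j, (ι ℤ (pointMap (C.diagram c a t.succ) (lowerArcVec b j)) =
        if C.leftToRight t then circleGen (C.diagram c a t.succ) (i, false) -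
            circleGen (C.diagram c a t.succ) (b.partner i, false)
          else circleGen (C.diagram c a t.succ) (b.partner i, false) -
            circleGen (C.diagram c a t.succ) (i, false)) ∧
        (lowerArcVec b j = lowerArcVec b i ∨ lowerArcVec b j = - lowerArcVec b i) := by
      by_cases hl : C.leftToRight t = true
      · exact ⟨i, by rw [if_pos hl]; simp [lowerArcVec, circleGen], Or.inl rfl⟩
      · exact ⟨b.partner i, by
          rw [if_neg hl]; simp [lowerArcVec, circleGen, b.partner_partner],
          Or.inr (by simp [lowerArcVec, b.partner_partner])⟩
    have hspan' : Submodule.span ℤ {lowerArcVec b i} = Submodule.span ℤ {lowerArcVec b j} := by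
      rcases hspan with e | e
      · rw [e]
      · rw [e, ← Set.neg_singleton, Submodule.span_neg]
    refine ⟨[j], fun X => ?_, ?_, ?_⟩
    · have hsp : ∀ x, (Finsupp.lmapDomain ℤ ℤ (C.transport c a t) ∘ₗ
          pointMap (C.diagram c a t.castSucc)) x - pointMap (C.diagram c a t.succ) x ∈
          Submodule.span ℤ {pointMap (C.diagram c a t.succ) (lowerArcVec b j)} := by
        intro x
        have := htr' x
        rwa [← Set.image_singleton, Submodule.span_image, hspan', ← Submodule.span_image,
          Set.image_singleton] at this
      rw [saddle, if_pos h, ← hj, LinearMap.comp_apply, LinearMap.mulLeft_apply,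
        AlgHom.toLinearMap_apply, hmap, ι_mul_map_congr hsp]
      simp
    · change _ = 1 + Nat.card (Circles (StackedAdj c b a (C.contracted t.succ)))
      rw [hcard, List.length_singleton]
      change _ + Nat.card (Circles (StackedAdj c b a (C.contracted t.castSucc))) = _
      omega
    · have : {x | x ∈ [j].map (lowerArcVec b)} = {lowerArcVec b j} := by
        ext x; simp
      rw [this, ← hspan']
      exact hker
  · have hcard := card_circles_merge hS hi hS' h
    have hLR := (stackedAdj_surgery hS hi hS').mpr h
    have h0 : pointMap (C.diagram c a t.succ) (lowerArcVec b i) = 0 :=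
      LinearMap.mem_ker.mp (sub_mem_ker_pointMap hLR)
    refine ⟨[], fun X => ?_, ?_, ?_⟩
    · rw [saddle, if_neg h, AlgHom.toLinearMap_apply, hmap]
      have : Finsupp.lmapDomain ℤ ℤ (C.transport c a t) ∘ₗ
          pointMap (C.diagram c a t.castSucc) = pointMap (C.diagram c a t.succ) := by
        refine LinearMap.ext fun x => sub_eq_zero.mp ?_
        have := htr' x
        rwa [h0, Submodule.span_zero_singleton, Submodule.mem_bot] at this
      rw [this]
      simp
    · change _ + Nat.card (Circles (StackedAdj c b a (C.contracted t.castSucc))) = _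
      rw [hcard, List.length_nil]
      change _ = 1 + Nat.card (Circles (StackedAdj c b a (C.contracted t.succ)))
      omega
    · refine hker.trans (sup_le ?_ le_sup_right)
      rw [Submodule.span_singleton_le_iff_mem]
      exact Submodule.mem_sup_right h0

/-- Later splits multiply further to the left. The count holds because a split adds a circle and a
vector, whereas a merge removes a circle; the inclusion of kernels later shows that different orders
of contraction give the same lattice. -/
theorem saddlesUpTo_eq (t : Fin (n + 1)) : ∃ js : List (Fin (2 * n)),
    (∀ X, C.saddlesUpTo c a t (map (pointMap (C.diagram c a 0)) X) =
      map (pointMap (C.diagram c a t)) (wedge ℤ (js.map (lowerArcVec b)) * X)) ∧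
    2 * js.length + Nat.card (Circles (C.diagram c a 0)) =
      t + Nat.card (Circles (C.diagram c a t)) ∧
    LinearMap.ker (pointMap (C.diagram c a 0)) ≤
      Submodule.span ℤ {x | x ∈ js.map (lowerArcVec b)} ⊔
        LinearMap.ker (pointMap (C.diagram c a t)) := by
  induction t using Fin.induction with
  | zero => exact ⟨[], fun X => by simp [saddlesUpTo], by simp, le_sup_right⟩
  | succ t ih =>
    obtain ⟨js, h1, h2, h3⟩ := ih
    obtain ⟨js', h1', h2', h3'⟩ := C.saddle_eq c a t
    refine ⟨js' ++ js, fun X => ?_, ?_, ?_⟩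
    · have : C.saddlesUpTo c a t.succ = C.saddle c a t ∘ₗ C.saddlesUpTo c a t.castSucc := by
        simp only [saddlesUpTo, Fin.induction_succ]
      rw [this, LinearMap.comp_apply, h1, h1', List.map_append, wedge_append, mul_assoc]
    · rw [List.length_append, Fin.val_succ]
      rw [Fin.val_castSucc] at h2
      omega
    · refine h3.trans (sup_le ?_ (h3'.trans (sup_le ?_ le_sup_right)))
      · exact le_sup_of_le_left (Submodule.span_mono fun x hx => by
          rw [Set.mem_ofPred_eq, List.map_append]; exact List.mem_append_right _ hx)
      · exact le_sup_of_le_left (Submodule.span_mono fun x hx => by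
          rw [Set.mem_ofPred_eq, List.map_append]; exact List.mem_append_left _ hx)

theorem toGlued_bijective : Function.Bijective (C.toGlued c a) := by
  let g : Circles (GluedAdj c a) → Circles (C.diagram c a (Fin.last n)) :=
    Quot.lift (fun i => Quot.mk _ (i, false)) fun i j h => by
      have hs : ∀ i, Quot.mk (C.diagram c a (Fin.last n)) (i, false) = Quot.mk _ (i, true) :=
        fun i => Quot.sound (.strand i (C.mem_contracted_last i))
      cases h with
      | lower => exact Quot.sound (.lower i)
      | upper =>
        rw [hs, hs]
        exact Quot.sound (.upper i)
  refine Function.bijective_iff_has_inverse.mpr ⟨g, ?_, ?_⟩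
  · rintro ⟨i, _ | _⟩
    · rfl
    · exact Quot.sound (.strand i (C.mem_contracted_last i))
  · rintro ⟨i⟩
    rfl

theorem card_circles_zero : Nat.card (Circles (C.diagram c a 0)) =
    Nat.card (Circles (GluedAdj c b)) + Nat.card (Circles (GluedAdj b a)) := by
  rw [← Nat.card_sum]
  let f : Circles (GluedAdj c b) ⊕ Circles (GluedAdj b a) → Circles (C.diagram c a 0) :=
    Sum.elim (C.inclUpper c a) (C.inclLower c a)
  let g : Circles (C.diagram c a 0) → Circles (GluedAdj c b) ⊕ Circles (GluedAdj b a) :=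
    Quot.lift (fun p => if p.2 then Sum.inl (Quot.mk _ p.1) else Sum.inr (Quot.mk _ p.1))
      fun p q h => by
        cases h with
        | lower i => exact congrArg Sum.inr (Quot.sound (.lower i))
        | upper i => exact congrArg Sum.inl (Quot.sound (.upper i))
        | cup i s _ =>
          cases s
          · exact congrArg Sum.inr (Quot.sound (.upper i))
          · exact congrArg Sum.inl (Quot.sound (.lower i))
        | strand i h => exact absurd h (C.not_mem_contracted_zero i)
  refine (Nat.card_congr (Equiv.ofBijective f
    (Function.bijective_iff_has_inverse.mpr ⟨g, ?_, ?_⟩))).symm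
  · rintro (i | i)
    · obtain ⟨i, rfl⟩ := Quot.mk_surjective i
      rfl
    · obtain ⟨i, rfl⟩ := Quot.mk_surjective i
      rfl
  · rintro ⟨i, _ | _⟩ <;> rfl

/-- The product is given, on the level of points, by the multiplication by differences of the
endpoints of arcs of `b`. -/
theorem product_eq : ∃ js : List (Fin (2 * n)),
    (∀ X Y, C.product c a (map (pointMap (GluedAdj c b)) X) (map (pointMap (GluedAdj b a)) Y) =
      map (pointMap (GluedAdj c a)) (wedge ℤ (js.map (arcVec b)) * (X * Y))) ∧
    2 * js.length + Nat.card (Circles (GluedAdj c b)) + Nat.card (Circles (GluedAdj b a)) =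
      n + Nat.card (Circles (GluedAdj c a)) ∧
    ∀ i, arcVec b i ∈ Submodule.span ℤ {x | x ∈ js.map (arcVec b)} ⊔
        LinearMap.ker (pointMap (GluedAdj c a)) := by
  obtain ⟨js, h1, h2, h3⟩ := C.saddlesUpTo_eq c a (Fin.last n)
  have hfst : Finsupp.lmapDomain ℤ ℤ (C.toGlued c a) ∘ₗ
      pointMap (C.diagram c a (Fin.last n)) =
      pointMap (GluedAdj c a) ∘ₗ Finsupp.lmapDomain ℤ ℤ Prod.fst := by
    ext p : 2
    simp [pointMap, Finsupp.mapDomain_single, toGlued]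
  have hmapfst : ∀ js : List (Fin (2 * n)),
      (js.map (lowerArcVec b)).map (Finsupp.lmapDomain ℤ ℤ Prod.fst) = js.map (arcVec b) := by
    intro js
    rw [List.map_map]
    exact List.map_congr_left fun i _ => lmapDomain_fst_lowerArcVec i
  refine ⟨js, fun X Y => ?_, ?_, fun i => ?_⟩
  · have hup : ∀ X, mapCircles (C.inclUpper c a) (map (pointMap (GluedAdj c b)) X) =
        map (pointMap (C.diagram c a 0))
          (map (Finsupp.lmapDomain ℤ ℤ fun i => (i, true)) X) := by
      intro X
      rw [mapCircles, ← AlgHom.comp_apply, ← AlgHom.comp_apply, map_comp_map, map_comp_map]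
      congr 2
      ext p : 2
      simp [pointMap, Finsupp.mapDomain_single, inclUpper]
      rfl
    have hlow : ∀ X, mapCircles (C.inclLower c a) (map (pointMap (GluedAdj b a)) X) =
        map (pointMap (C.diagram c a 0))
          (map (Finsupp.lmapDomain ℤ ℤ fun i => (i, false)) X) := by
      intro X
      rw [mapCircles, ← AlgHom.comp_apply, ← AlgHom.comp_apply, map_comp_map, map_comp_map]
      congr 2
      ext p : 2
      simp [pointMap, Finsupp.mapDomain_single, inclLower]
      rfl
    have hid : ∀ (s : Bool) (X : ExteriorAlgebra ℤ (Fin (2 * n) →₀ ℤ)),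
        map (Finsupp.lmapDomain ℤ ℤ Prod.fst)
          (map (Finsupp.lmapDomain ℤ ℤ fun i : Fin (2 * n) => (i, s)) X) = X := by
      intro s X
      rw [← AlgHom.comp_apply, map_comp_map]
      have : (Finsupp.lmapDomain ℤ ℤ Prod.fst ∘ₗ
          Finsupp.lmapDomain ℤ ℤ fun i : Fin (2 * n) => (i, s)) = LinearMap.id := by
        ext p : 2
        simp [Finsupp.mapDomain_single]
      rw [this, map_id]
      rfl
    have : C.product c a (map (pointMap (GluedAdj c b)) X) (map (pointMap (GluedAdj b a)) Y) =
        C.oddFunctor c a (mapCircles (C.inclUpper c a) (map (pointMap (GluedAdj c b)) X) *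
          mapCircles (C.inclLower c a) (map (pointMap (GluedAdj b a)) Y)) := rfl
    rw [this, hup, hlow, ← map_mul, oddFunctor, LinearMap.comp_apply, h1,
      AlgHom.toLinearMap_apply, mapCircles, ← AlgHom.comp_apply, map_comp_map, hfst,
      ← map_comp_map, AlgHom.comp_apply, map_mul (map (Finsupp.lmapDomain ℤ ℤ Prod.fst)),
      map_mul (map (Finsupp.lmapDomain ℤ ℤ Prod.fst)), hid, hid, map_wedge, hmapfst]
  · have e := Nat.card_congr (Equiv.ofBijective _ (C.toGlued_bijective c a))
    rw [C.card_circles_zero, e, Fin.val_last] at h2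
    omega
  -- Before any saddle the endpoints of an arc of `b` lie on one circle; the inclusion of kernels
  -- turns this into a statement about the vectors of the splits.
  · have h4 : lowerArcVec b i ∈ LinearMap.ker (pointMap (C.diagram c a 0)) :=
      sub_mem_ker_pointMap (Quot.sound (.cup _ _ (C.not_mem_contracted_zero i)))
    obtain ⟨y, hy, z, hz, e⟩ := Submodule.mem_sup.mp (h3 h4)
    rw [← lmapDomain_fst_lowerArcVec, ← e, map_add]
    refine add_mem (Submodule.mem_sup_left ?_) (Submodule.mem_sup_right ?_)
    · have := Submodule.mem_map_of_mem (f := Finsupp.lmapDomain ℤ ℤ Prod.fst) hy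
      rw [Submodule.map_span] at this
      refine Submodule.span_mono ?_ this
      rintro _ ⟨x, hx, rfl⟩
      rw [Set.mem_ofPred_eq, ← hmapfst]
      exact List.mem_map_of_mem hx
    · rw [LinearMap.mem_ker, ← LinearMap.comp_apply, ← hfst, LinearMap.comp_apply,
        LinearMap.mem_ker.mp hz, map_zero]

end ChronContraction

end Saddle

/-! ## The plane model of a crossingless matching -/

theorem Submodule.finrank_prod {K V V' : Type*} [Field K] [AddCommGroup V] [Module K V]
    [AddCommGroup V'] [Module K V'] [FiniteDimensional K V] [FiniteDimensional K V']
    (p : Submodule K V) (q : Submodule K V') :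
    Module.finrank K (p.prod q) = Module.finrank K p + Module.finrank K q := by
  let e : p.prod q ≃ₗ[K] p × q :=
    { toFun := fun x => (⟨x.1.1, x.2.1⟩, ⟨x.1.2, x.2.2⟩)
      invFun := fun y => ⟨(y.1.1, y.2.1), y.1.2, y.2.2⟩
      map_add' := fun _ _ => rfl
      map_smul' := fun _ _ => rfl
      left_inv := fun _ => rfl
      right_inv := fun _ => rfl }
  rw [e.finrank_eq, Module.finrank_prod]

theorem Submodule.orthogonal_inf {W : Type*} [NormedAddCommGroup W] [InnerProductSpace ℝ W]
    [FiniteDimensional ℝ W] (p q : Submodule ℝ W) : (p ⊓ q)ᗮ = pᗮ ⊔ qᗮ := by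
  rw [← Submodule.orthogonal_orthogonal (pᗮ ⊔ qᗮ), ← Submodule.inf_orthogonal,
    Submodule.orthogonal_orthogonal, Submodule.orthogonal_orthogonal]

open ExteriorAlgebra

section Plane

variable {n : ℕ}

/-- The interval between consecutive points, in a chessboard colouring of the line, which is
adjacent to a given point. -/
def half (i : Fin (2 * n)) : Fin n := ⟨i / 2, by omega⟩

/-- The functions on the intervals of one colour which are constant on the regions of the half
plane cut out by the matching. -/
noncomputable def regionSpace (b : CrossinglessMatching n) :
    Submodule ℝ (EuclideanSpace ℝ (Fin n)) where
  carrier := {f | ∀ i, f (half i) = f (half (b.partner i))}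
  zero_mem' := fun _ => rfl
  add_mem' := fun hf hg i => by simp [hf i, hg i]
  smul_mem' := fun r f hf i => by simp [hf i]

/-- The vector of a point in the plane model: the interval adjacent to the point, and the intervals
to the left of the point. -/
noncomputable def pointVec (i : Fin (2 * n)) :
    EuclideanSpace ℝ (Fin n) × EuclideanSpace ℝ (Fin n) :=
  (EuclideanSpace.single (half i) 1, WithLp.toLp 2 fun k => if 2 * (k : ℕ) < i then 1 else 0)

variable (b : CrossinglessMatching n)

/-- The first component tests equality of the values on the two intervals adjacent to the arc, so it
is orthogonal to the functions constant on regions. The second is minus the indicator function of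
the intervals under the arc, which is constant on regions since no arc crosses this one. -/
theorem pointVec_sub_mem_of_lt {i : Fin (2 * n)} (hi : i < b.partner i) :
    pointVec i - pointVec (b.partner i) ∈ (regionSpace b)ᗮ.prod (regionSpace b) := by
  constructor
  · rw [SetLike.mem_coe, Submodule.mem_orthogonal]
    intro f hf
    have := hf i
    simp only [pointVec, Prod.fst_sub, inner_sub_right, EuclideanSpace.inner_single_right]
    simp [this]
  · intro j
    have hpar := b.parity_partner i
    have hjpar := b.parity_partner j
    have h1 : ∀ j, j ≠ i → j ≠ b.partner i → ((i < j ∧ j < b.partner i) ↔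
        (i < b.partner j ∧ b.partner j < b.partner i)) := by
      intro j _ _
      rw [← Finset.mem_Ioo, ← Finset.mem_Ioo]
      exact ⟨fun h => b.partner_mem_Ioo h, fun h => by
        simpa [b.partner_partner] using b.partner_mem_Ioo h⟩
    have hi' : (i : ℕ) < b.partner i := hi
    have key : ∀ j : Fin (2 * n), (pointVec i - pointVec (b.partner i)).2 (half j) =
        if (i : ℕ) ≤ 2 * ((j : ℕ) / 2) ∧ 2 * ((j : ℕ) / 2) < b.partner i then -1 else 0 := by
      intro j
      simp only [pointVec, Prod.snd_sub, PiLp.sub_apply, half]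
      split_ifs <;> first | omega | norm_num
    rw [key, key]
    refine if_congr ?_ rfl rfl
    by_cases hji : j = i
    · subst hji
      omega
    by_cases hjb : j = b.partner i
    · subst hjb
      rw [b.partner_partner]
      omega
    have h2 := h1 j hji hjb
    have h3 : (j : ℕ) ≠ i := fun h => hji (Fin.ext h)
    have h4 : (j : ℕ) ≠ b.partner i := fun h => hjb (Fin.ext h)
    have h5 : (b.partner j : ℕ) ≠ i := fun h => hjb (by
      rw [← b.partner_partner j, Fin.ext h])
    have h6 : (b.partner j : ℕ) ≠ b.partner i := fun h => hji
      (b.partner_involutive.injective (Fin.ext h))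
    simp only [Fin.lt_def] at h2
    omega

theorem pointVec_sub_mem (i : Fin (2 * n)) :
    pointVec i - pointVec (b.partner i) ∈ (regionSpace b)ᗮ.prod (regionSpace b) := by
  rcases lt_or_gt_of_ne (b.partner_ne i) with h | h
  · have h2 : b.partner i < b.partner (b.partner i) := by rwa [b.partner_partner]
    have := neg_mem (pointVec_sub_mem_of_lt b h2)
    rwa [b.partner_partner, neg_sub] at this
  · exact pointVec_sub_mem_of_lt b h

/-- The linear extension of `pointVec`. -/
noncomputable def planeMap (n : ℕ) : (Fin (2 * n) →₀ ℝ) →ₗ[ℝ]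
    EuclideanSpace ℝ (Fin n) × EuclideanSpace ℝ (Fin n) :=
  Finsupp.linearCombination ℝ pointVec

theorem planeMap_single (i : Fin (2 * n)) : planeMap n (Finsupp.single i 1) = pointVec i := by
  simp [planeMap]

theorem EuclideanSpace.mem_of_single_mem {T : Submodule ℝ (EuclideanSpace ℝ (Fin n))}
    (h : ∀ j, EuclideanSpace.single j 1 ∈ T) (x : EuclideanSpace ℝ (Fin n)) : x ∈ T := by
  rw [← (EuclideanSpace.basisFun (Fin n) ℝ).sum_repr x]
  exact Submodule.sum_mem _ fun j _ => Submodule.smul_mem _ _ (by simpa using h j)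

theorem planeMap_bijective (n : ℕ) : Function.Bijective (planeMap n) := by
  have hsurj : Function.Surjective (planeMap n) := by
    have h1 : ∀ x, (0, x) ∈ LinearMap.range (planeMap n) := by
      intro x
      refine EuclideanSpace.mem_of_single_mem
        (T := (LinearMap.range (planeMap n)).comap (LinearMap.inr ℝ _ _)) (fun j => ?_) x
      have h1 : 2 * (j : ℕ) < 2 * n := by omega
      have h2 : 2 * (j : ℕ) + 1 < 2 * n := by omega
      -- The points `2j` and `2j + 1` bound the interval `j`: their first components agree, and only
      -- this interval lies to the left of the one but not of the other.
      refine ⟨Finsupp.single ⟨2 * j + 1, h2⟩ 1 - Finsupp.single ⟨2 * j, h1⟩ 1, ?_⟩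
      rw [map_sub, planeMap_single, planeMap_single]
      refine Prod.ext ?_ ?_
      · have : half (⟨2 * j + 1, h2⟩ : Fin (2 * n)) = half ⟨2 * j, h1⟩ := by
          ext
          simp only [half]
          omega
        simp [pointVec, this]
      · ext k
        simp only [pointVec, Prod.snd_sub, PiLp.sub_apply, LinearMap.inr_apply,
          PiLp.single_apply, Fin.ext_iff]
        split_ifs <;> first | omega | norm_num
    have h2 : ∀ x, (x, 0) ∈ LinearMap.range (planeMap n) := by
      intro x
      refine EuclideanSpace.mem_of_single_mem
        (T := (LinearMap.range (planeMap n)).comap (LinearMap.inl ℝ _ _)) (fun j => ?_) x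
      have h3 : 2 * (j : ℕ) < 2 * n := by omega
      have h4 : pointVec (⟨2 * j, h3⟩ : Fin (2 * n)) ∈ LinearMap.range (planeMap n) :=
        ⟨_, planeMap_single _⟩
      have h5 := sub_mem h4 (h1 (pointVec (⟨2 * j, h3⟩ : Fin (2 * n))).2)
      have h6 : half (⟨2 * j, h3⟩ : Fin (2 * n)) = j := by
        ext
        simp [half]
      rw [Submodule.mem_comap]
      convert h5 using 1
      refine Prod.ext ?_ ?_
      · simp [pointVec, h6]
      · simp
    intro x
    have := add_mem (h2 x.1) (h1 x.2)
    rwa [Prod.mk_add_mk, add_zero, zero_add] at this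
  refine ⟨(LinearMap.injective_iff_surjective_of_finrank_eq_finrank ?_).mpr hsurj, hsurj⟩
  simp
  ring

/-- The plane model as a linear equivalence. -/
noncomputable def planeEquiv (n : ℕ) : (Fin (2 * n) →₀ ℝ) ≃ₗ[ℝ]
    EuclideanSpace ℝ (Fin n) × EuclideanSpace ℝ (Fin n) :=
  LinearEquiv.ofBijective (planeMap n) (planeMap_bijective n)

/-- The span of the differences of the endpoints of the arcs. -/
noncomputable def arcSpan (b : CrossinglessMatching n) : Submodule ℝ (Fin (2 * n) →₀ ℝ) :=
  Submodule.span ℝ (Set.range fun i => Finsupp.single i 1 - Finsupp.single (b.partner i) 1)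

/-- Every arc has exactly one even endpoint, so the even coordinates map its vectors onto the
standard basis up to sign. -/
theorem le_finrank_arcSpan : n ≤ Module.finrank ℝ (arcSpan b) := by
  let f : (Fin (2 * n) →₀ ℝ) →ₗ[ℝ] (Fin n → ℝ) :=
    LinearMap.pi fun j => Finsupp.lapply ⟨2 * j, by omega⟩
  have h : Function.Surjective (f.domRestrict (arcSpan b)) := by
    rw [← LinearMap.range_eq_top, ← top_le_iff, ← (Pi.basisFun ℝ (Fin n)).span_eq,
      Submodule.span_le]
    rintro _ ⟨j, rfl⟩
    have h1 : 2 * (j : ℕ) < 2 * n := by omega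
    refine ⟨⟨Finsupp.single ⟨2 * j, h1⟩ 1 - Finsupp.single (b.partner ⟨2 * j, h1⟩) 1,
      Submodule.subset_span ⟨_, rfl⟩⟩, ?_⟩
    have hpar : (b.partner ⟨2 * j, h1⟩ : ℕ) % 2 ≠ 2 * (j : ℕ) % 2 := b.parity_partner _
    ext k
    simp only [LinearMap.domRestrict_apply, f, LinearMap.pi_apply, Finsupp.lapply_apply,
      Finsupp.sub_apply, Finsupp.single_apply, Pi.basisFun_apply, Pi.single_apply, Fin.ext_iff]
    split_ifs <;> first | omega | norm_num
  have := LinearMap.finrank_le_finrank_of_surjective h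
  simpa using this

/-- One inclusion holds arc by arc. The right-hand side has dimension exactly `n`, and the left-hand
side at least `n`. -/
theorem map_arcSpan : (arcSpan b).map (planeEquiv n).toLinearMap =
    (regionSpace b)ᗮ.prod (regionSpace b) := by
  refine Submodule.eq_of_le_of_finrank_le ?_ ?_
  · rw [arcSpan, Submodule.map_span, Submodule.span_le]
    rintro _ ⟨_, ⟨i, rfl⟩, rfl⟩
    have : (planeEquiv n).toLinearMap (Finsupp.single i 1 - Finsupp.single (b.partner i) 1) =
        pointVec i - pointVec (b.partner i) := by
      change planeMap n _ = _
      rw [map_sub, planeMap_single, planeMap_single]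
    rw [this]
    exact pointVec_sub_mem b i
  · rw [LinearEquiv.finrank_map_eq, Submodule.finrank_prod]
    have := Submodule.finrank_add_finrank_orthogonal (regionSpace b)
    rw [finrank_euclideanSpace_fin] at this
    have := le_finrank_arcSpan b
    omega

variable (c a : CrossinglessMatching n)

theorem ker_lmapDomain_gluedAdj :
    LinearMap.ker (Finsupp.lmapDomain ℝ ℝ (Quot.mk (GluedAdj c a))) = arcSpan c ⊔ arcSpan a := by
  rw [Finsupp.ker_lmapDomain_mk, arcSpan, arcSpan, ← Submodule.span_union]
  congr 1
  ext x
  constructor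
  · rintro ⟨p, q, h, rfl⟩
    cases h with
    | lower => exact Or.inr ⟨p, rfl⟩
    | upper => exact Or.inl ⟨p, rfl⟩
  · rintro (⟨i, rfl⟩ | ⟨i, rfl⟩)
    · exact ⟨_, _, .upper i, rfl⟩
    · exact ⟨_, _, .lower i, rfl⟩

theorem map_ker_lmapDomain_gluedAdj :
    (LinearMap.ker (Finsupp.lmapDomain ℝ ℝ (Quot.mk (GluedAdj c a)))).map
      (planeEquiv n).toLinearMap =
    (regionSpace c ⊓ regionSpace a)ᗮ.prod (regionSpace c ⊔ regionSpace a) := by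
  rw [ker_lmapDomain_gluedAdj, Submodule.map_sup, map_arcSpan, map_arcSpan,
    Submodule.prod_sup_prod, Submodule.orthogonal_inf]

/-- The number of circles in terms of the dimensions of the region spaces. -/
theorem card_circles_gluedAdj : Nat.card (Circles (GluedAdj c a)) +
    2 * codim (regionSpace c) (regionSpace a) + Module.finrank ℝ (regionSpace c) +
      Module.finrank ℝ (regionSpace a) = 3 * n := by
  have h1 := LinearMap.finrank_range_add_finrank_ker
    (Finsupp.lmapDomain ℝ ℝ (Quot.mk (GluedAdj c a)))
  have hs : Function.Surjective (Finsupp.lmapDomain ℝ ℝ (Quot.mk (GluedAdj c a))) :=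
    Finsupp.mapDomain_surjective Quot.mk_surjective
  have : Fintype (Quot (GluedAdj c a)) := Fintype.ofFinite _
  rw [LinearMap.range_eq_top.mpr hs, finrank_top, Module.finrank_finsupp_self,
    Module.finrank_finsupp_self, ← LinearEquiv.finrank_map_eq (planeEquiv n),
    map_ker_lmapDomain_gluedAdj, Submodule.finrank_prod, Fintype.card_fin,
    ← Nat.card_eq_fintype_card] at h1
  have h2 := Submodule.finrank_sup_add_finrank_inf_eq (regionSpace c) (regionSpace a)
  have h3 := Submodule.finrank_add_finrank_orthogonal (regionSpace c ⊓ regionSpace a)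
  rw [finrank_euclideanSpace_fin] at h3
  have h4 : Nat.card (Circles (GluedAdj c a)) + (codim (regionSpace c) (regionSpace a) +
      Module.finrank ℝ (regionSpace c ⊔ regionSpace a : Submodule ℝ _)) = 2 * n := h1
  change _ + codim (regionSpace c) (regionSpace a) = _ at h3
  omega

end Plane

open ExteriorAlgebra

/-! ## From circles to the plane model -/

section Transfer

variable {n : ℕ}

theorem LinearIndependent.intCast_of_finsupp {ι Q : Type*} [Finite Q] {v : ι → Q →₀ ℤ}
    (h : LinearIndependent ℤ v) : LinearIndependent ℝ fun i q => ((v i q : ℤ) : ℝ) := by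
  have h1 : LinearIndependent ℤ (Finsupp.lcoeFun (R := ℤ) ∘ v) :=
    h.map' _ (LinearMap.ker_eq_bot.mpr DFunLike.coe_injective)
  have h2 := linearIndependent_algebraMap_comp_iff (S := ℝ)
    (v := (Finsupp.lcoeFun (R := ℤ) ∘ v : ι → Q → ℤ))
  exact h2.mpr h1

/-- Needed over `ℤ` for two purposes: linearly dependent vectors have zero wedge, and a scalar
fixing a nonzero wedge is `1`. -/
theorem isTorsionFree_exteriorAlgebra {Q : Type} :
    Module.IsTorsionFree ℤ (ExteriorAlgebra ℤ (Q →₀ ℤ)) := by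
  classical
  let : LinearOrder Q := linearOrderOfSTO WellOrderingRel
  have : Module.Free ℤ (ExteriorAlgebra ℤ (Q →₀ ℤ)) :=
    Module.Free.of_basis (Finsupp.basisSingleOne (ι := Q) (R := ℤ)).ExteriorAlgebra
  infer_instance

/-- The plane model on integral combinations of points. -/
noncomputable def latticeMap (n : ℕ) : (Fin (2 * n) →₀ ℤ) →ₗ[ℤ]
    EuclideanSpace ℝ (Fin n) × EuclideanSpace ℝ (Fin n) :=
  Finsupp.linearCombination ℤ pointVec

theorem latticeMap_arcVec (b : CrossinglessMatching n) (i : Fin (2 * n)) :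
    latticeMap n (arcVec b i) = pointVec i - pointVec (b.partner i) := by
  simp [latticeMap, arcVec]

/-- The map from the plane model to the real vector space on the circles. -/
noncomputable def circleSpaceMap (d a : CrossinglessMatching n) :
    EuclideanSpace ℝ (Fin n) × EuclideanSpace ℝ (Fin n) →ₗ[ℝ]
      (Circles (GluedAdj d a) →₀ ℝ) :=
  Finsupp.lmapDomain ℝ ℝ (Quot.mk (GluedAdj d a)) ∘ₗ (planeEquiv n).symm.toLinearMap

theorem circleSpaceMap_pointVec (d a : CrossinglessMatching n) (i : Fin (2 * n)) :
    circleSpaceMap d a (pointVec i) = Finsupp.single (Quot.mk _ i) 1 := by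
  have : (planeEquiv n).symm (pointVec i) = Finsupp.single i 1 := by
    rw [LinearEquiv.symm_apply_eq]
    exact (planeMap_single i).symm
  simp [circleSpaceMap, this, Finsupp.mapDomain_single]

theorem circleSpaceMap_latticeMap (d a : CrossinglessMatching n) (x : Fin (2 * n) →₀ ℤ)
    (q : Circles (GluedAdj d a)) :
    circleSpaceMap d a (latticeMap n x) q = ((pointMap (GluedAdj d a) x q : ℤ) : ℝ) := by
  induction x using Finsupp.induction_linear with
  | zero => simp
  | add x y hx hy => simp only [map_add, Finsupp.add_apply, Int.cast_add, hx, hy]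
  | single i k =>
    have h1 : latticeMap n (Finsupp.single i k) = (k : ℝ) • pointVec i := by
      rw [latticeMap, Finsupp.linearCombination_single, Int.cast_smul_eq_zsmul]
    rw [h1, map_smul, circleSpaceMap_pointVec, pointMap_single]
    by_cases h : Quot.mk (GluedAdj d a) i = q <;> simp [h]

theorem ker_circleSpaceMap (d a : CrossinglessMatching n) : LinearMap.ker (circleSpaceMap d a) =
    (regionSpace d ⊓ regionSpace a)ᗮ.prod (regionSpace d ⊔ regionSpace a) := by
  rw [← map_ker_lmapDomain_gluedAdj, circleSpaceMap, LinearMap.ker_comp]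
  exact (Submodule.map_equiv_eq_comap_symm _ _).symm

theorem mem_annih_outerList {W : Type} [NormedAddCommGroup W] [InnerProductSpace ℝ W]
    [FiniteDimensional ℝ W] {Yd Ya : Submodule ℝ W} {x : W × W}
    (hx : x ∈ (Yd ⊓ Ya)ᗮ.prod (Yd ⊔ Ya)) : x ∈ annih (wedge ℝ (outerList Yd Ya)) := by
  have h1 : LinearMap.inl ℝ W W x.1 ∈ annih (wedge ℝ (outerList Yd Ya)) := by
    rw [outerList, wedge_append]
    exact annih_le_mul_right _ _ (mem_annih_basisList _ hx.1)
  have h2 : LinearMap.inr ℝ W W x.2 ∈ annih (wedge ℝ (outerList Yd Ya)) := by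
    rw [outerList, wedge_append]
    exact annih_le_wedge_mul _ _ (mem_annih_basisList _ hx.2)
  have := add_mem h1 h2
  simpa using this

theorem mem_of_mem_outerList {W : Type} [NormedAddCommGroup W] [InnerProductSpace ℝ W]
    [FiniteDimensional ℝ W] {Yd Ya : Submodule ℝ W} {x : W × W} (hx : x ∈ outerList Yd Ya) :
    x ∈ (Yd ⊓ Ya)ᗮ.prod (Yd ⊔ Ya) := by
  have h : ∀ {S : Submodule ℝ W} {y : W}, y ∈ basisList S → y ∈ S := fun {S y} hy => by
    rw [← span_basisList S]
    exact Submodule.subset_span hy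
  simp only [outerList, List.mem_append, List.mem_map] at hx
  rcases hx with ⟨y, hy, rfl⟩ | ⟨y, hy, rfl⟩
  · exact ⟨h hy, zero_mem _⟩
  · exact ⟨zero_mem _, h hy⟩

theorem wedge_outerList_ne_zero {W : Type} [NormedAddCommGroup W] [InnerProductSpace ℝ W]
    [FiniteDimensional ℝ W] (Yd Ya : Submodule ℝ W) : wedge ℝ (outerList Yd Ya) ≠ 0 := by
  rw [outerList, wedge_append]
  exact wedge_inl_mul_wedge_inr_ne_zero (wedge_basisList_ne_zero _) (wedge_basisList_ne_zero _)

/-- A nonzero wedge of circle vectors forces independence over `ℤ`, hence over `ℝ`. As `outerList`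
is a basis of the kernel of the map from the plane model to the circles, independence modulo that
kernel gives independence of the joint list. -/
theorem wedge_latticeMap_ne_zero (d a : CrossinglessMatching n) (l : List (Fin (2 * n) →₀ ℤ))
    (h : wedge ℤ (l.map (pointMap (GluedAdj d a))) ≠ 0) :
    wedge ℝ (l.map (latticeMap n)) *
      wedge ℝ (outerList (regionSpace d) (regionSpace a)) ≠ 0 := by
  have e : l.map (pointMap (GluedAdj d a)) = List.ofFn (pointMap (GluedAdj d a) ∘ l.get) := by
    rw [← List.map_ofFn, List.ofFn_get]
  have e' : l.map (latticeMap n) = List.ofFn (latticeMap n ∘ l.get) := by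
    rw [← List.map_ofFn, List.ofFn_get]
  set O := outerList (regionSpace d) (regionSpace a)
  have hout := wedge_outerList_ne_zero (regionSpace d) (regionSpace a)
  rw [wedge_eq_ιMulti, ιMulti_ne_zero_iff] at hout
  have h1 : LinearIndependent ℤ (pointMap (GluedAdj d a) ∘ l.get) := by
    by_contra hdep
    have := isTorsionFree_exteriorAlgebra (Q := Circles (GluedAdj d a))
    rw [e, ← ιMulti_eq_wedge] at h
    exact h (AlternatingMap.map_linearDependent _ _ hdep)
  have h2 : LinearIndependent ℝ ((Finsupp.lcoeFun (R := ℝ) ∘ₗ circleSpaceMap d a) ∘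
      (latticeMap n ∘ l.get)) := by
    convert h1.intCast_of_finsupp using 1
    funext i q
    exact circleSpaceMap_latticeMap d a _ q
  have hker : LinearMap.ker (Finsupp.lcoeFun (R := ℝ) ∘ₗ circleSpaceMap d a) =
      (regionSpace d ⊓ regionSpace a)ᗮ.prod (regionSpace d ⊔ regionSpace a) := by
    rw [← ker_circleSpaceMap, LinearMap.ker_comp_of_ker_eq_bot]
    exact LinearMap.ker_eq_bot.mpr DFunLike.coe_injective
  have h3 := LinearIndependent.sum_type (LinearIndependent.of_comp _ h2) hout
    ((Submodule.range_ker_disjoint h2).mono_right (by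
      rw [hker, Submodule.span_le]
      rintro _ ⟨i, rfl⟩
      exact mem_of_mem_outerList (List.get_mem _ _)))
  have h4 := wedge_ofFn_mul_wedge_ofFn_ne_zero h3
  rwa [← e', List.ofFn_get] at h4

theorem latticeMap_mem_of_mem_ker (d a : CrossinglessMatching n) {x : Fin (2 * n) →₀ ℤ}
    (hx : x ∈ LinearMap.ker (pointMap (GluedAdj d a))) : latticeMap n x ∈
      (regionSpace d ⊓ regionSpace a)ᗮ.prod (regionSpace d ⊔ regionSpace a) := by
  rw [← ker_circleSpaceMap, LinearMap.mem_ker]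
  ext q
  rw [circleSpaceMap_latticeMap, LinearMap.mem_ker.mp hx]
  simp

/-- Choosing a point on each circle extends to a map from the exterior algebra on the circles to
that of the plane model. The choice changes vectors only by relations of `W(d)a`, which the wedge of
`outerList` annihilates. -/
theorem wedge_latticeMap_eq_smul (d a : CrossinglessMatching n) (l l' : List (Fin (2 * n) →₀ ℤ))
    (η : ℤ) (h : wedge ℤ (l.map (pointMap (GluedAdj d a))) =
      η • wedge ℤ (l'.map (pointMap (GluedAdj d a)))) :
    wedge ℝ (l.map (latticeMap n)) * wedge ℝ (outerList (regionSpace d) (regionSpace a)) =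
      (η : ℝ) • (wedge ℝ (l'.map (latticeMap n)) *
        wedge ℝ (outerList (regionSpace d) (regionSpace a))) := by
  let σ : CircleGroup (GluedAdj d a) →ₗ[ℤ] (Fin (2 * n) →₀ ℤ) :=
    Finsupp.lmapDomain ℤ ℤ Quot.out
  have hσ : ∀ y, pointMap (GluedAdj d a) (σ y) = y := by
    intro y
    have : pointMap (GluedAdj d a) ∘ₗ σ = LinearMap.id := by
      ext q : 2
      simp [pointMap, σ, Finsupp.mapDomain_single]
    exact LinearMap.congr_fun this y
  let j : CircleGroup (GluedAdj d a) →ₗ[ℤ]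
      ExteriorAlgebra ℝ (EuclideanSpace ℝ (Fin n) × EuclideanSpace ℝ (Fin n)) :=
    ((ι ℝ).toAddMonoidHom.comp (latticeMap n ∘ₗ σ).toAddMonoidHom).toIntLinearMap
  let Θ := ExteriorAlgebra.lift ℤ ⟨j, fun y => ι_sq_zero (R := ℝ) (latticeMap n (σ y))⟩
  have hΘ : ∀ l : List (CircleGroup (GluedAdj d a)),
      Θ (wedge ℤ l) = wedge ℝ (l.map (latticeMap n ∘ σ)) := by
    intro l
    induction l with
    | nil => exact map_one Θ
    | cons y l ih =>
      rw [wedge_cons, map_mul, ih, List.map_cons, wedge_cons]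
      congr 1
      exact lift_ι_apply ℤ _ _ _
  have hcong : ∀ l : List (Fin (2 * n) →₀ ℤ),
      Θ (wedge ℤ (l.map (pointMap (GluedAdj d a)))) *
        wedge ℝ (outerList (regionSpace d) (regionSpace a)) =
      wedge ℝ (l.map (latticeMap n)) * wedge ℝ (outerList (regionSpace d) (regionSpace a)) := by
    intro l
    rw [hΘ, List.map_map]
    refine wedge_map_mul_congr _ _ l _ fun x _ => mem_annih_outerList ?_
    have hx : σ (pointMap (GluedAdj d a) x) - x ∈ LinearMap.ker (pointMap (GluedAdj d a)) := by
      rw [LinearMap.mem_ker, map_sub, hσ, sub_self]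
    have := latticeMap_mem_of_mem_ker d a hx
    rwa [map_sub] at this
  rw [← hcong, ← hcong, h, map_zsmul, ← Int.cast_smul_eq_zsmul ℝ, smul_mul_assoc]

end Transfer

open ExteriorAlgebra

/-! ## The associativity of the product up to sign -/

section Sign

variable {n : ℕ}

theorem ker_pointMap_gluedAdj_le (c a : CrossinglessMatching n)
    {T : Submodule ℤ (Fin (2 * n) →₀ ℤ)} (hc : ∀ i, arcVec c i ∈ T) (ha : ∀ i, arcVec a i ∈ T) :
    LinearMap.ker (pointMap (GluedAdj c a)) ≤ T := by
  rw [ker_pointMap, Submodule.span_le]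
  rintro _ ⟨p, q, h, rfl⟩
  cases h with
  | lower => exact ha p
  | upper => exact hc p

theorem arcVec_mem_ker_upper (c a : CrossinglessMatching n) (i : Fin (2 * n)) :
    arcVec c i ∈ LinearMap.ker (pointMap (GluedAdj c a)) :=
  sub_mem_ker_pointMap (Quot.sound (.upper i))

theorem arcVec_mem_ker_lower (c a : CrossinglessMatching n) (i : Fin (2 * n)) :
    arcVec a i ∈ LinearMap.ker (pointMap (GluedAdj c a)) :=
  sub_mem_ker_pointMap (Quot.sound (.lower i))

namespace ChronContraction

variable {b : CrossinglessMatching n} (C : ChronContraction b) (c a : CrossinglessMatching n)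

/-- The arcs whose contraction splits a circle. -/
noncomputable def splitArcs : List (Fin (2 * n)) := (C.product_eq c a).choose

/-- The differences of endpoints of the arcs whose contraction splits a circle. -/
noncomputable def splitVecs : List (Fin (2 * n) →₀ ℤ) := (C.splitArcs c a).map (arcVec b)

theorem product_pointMap (X Y : ExteriorAlgebra ℤ (Fin (2 * n) →₀ ℤ)) :
    C.product c a (map (pointMap (GluedAdj c b)) X) (map (pointMap (GluedAdj b a)) Y) =
      map (pointMap (GluedAdj c a)) (wedge ℤ (C.splitVecs c a) * (X * Y)) :=
  (C.product_eq c a).choose_spec.1 X Y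

theorem two_mul_length_splitVecs : 2 * (C.splitVecs c a).length +
    Nat.card (Circles (GluedAdj c b)) + Nat.card (Circles (GluedAdj b a)) =
      n + Nat.card (Circles (GluedAdj c a)) := by
  rw [splitVecs, List.length_map]
  exact (C.product_eq c a).choose_spec.2.1

theorem arcVec_mem_splitVecs (i : Fin (2 * n)) : arcVec b i ∈
    Submodule.span ℤ {x | x ∈ C.splitVecs c a} ⊔ LinearMap.ker (pointMap (GluedAdj c a)) :=
  (C.product_eq c a).choose_spec.2.2 i

/-- The count of circles under saddles, rewritten by the dimension formula for the number of
circles. This is exactly the equality of lengths that the triple comparison requires. -/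
theorem length_splitVecs : (C.splitVecs c a).length +
    codim (regionSpace c) (regionSpace a) + n =
      Module.finrank ℝ (regionSpace b) + codim (regionSpace c) (regionSpace b) +
        codim (regionSpace b) (regionSpace a) := by
  have h := C.two_mul_length_splitVecs c a
  have h1 := card_circles_gluedAdj c b
  have h2 := card_circles_gluedAdj b a
  have h3 := card_circles_gluedAdj c a
  omega

/-- The vectors of `splitVecs` in the plane model. -/
noncomputable def planeVecs : List (EuclideanSpace ℝ (Fin n) × EuclideanSpace ℝ (Fin n)) :=
  (C.splitVecs c a).map (latticeMap n)

theorem length_planeVecs : (C.planeVecs c a).length = (C.splitVecs c a).length :=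
  List.length_map _

theorem exists_isTripleCoeff : ∃ r,
    IsTripleCoeff (regionSpace c) (regionSpace b) (regionSpace a) (C.planeVecs c a) r := by
  refine exists_triple_eq_smul _ _ _ _ (fun x hx => ?_) ?_
  · simp only [planeVecs, splitVecs, List.map_map, List.mem_map] at hx
    obtain ⟨i, -, rfl⟩ := hx
    rw [Function.comp_apply, latticeMap_arcVec]
    exact pointVec_sub_mem b i
  · rw [length_planeVecs, finrank_euclideanSpace_fin]
    exact C.length_splitVecs c a

/-- The coefficient of the triple of region spaces. -/
noncomputable def coeff : ℝ := (C.exists_isTripleCoeff c a).choose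

theorem isTripleCoeff : IsTripleCoeff (regionSpace c) (regionSpace b) (regionSpace a)
    (C.planeVecs c a) (C.coeff c a) := (C.exists_isTripleCoeff c a).choose_spec

open scoped Classical in
/-- The sign of the coefficient. -/
noncomputable def coeffSign : ℤ := if 0 ≤ C.coeff c a then 1 else -1

theorem coeffSign_mul_self : C.coeffSign c a * C.coeffSign c a = 1 := by
  rw [coeffSign]
  split_ifs <;> rfl

theorem coeffSign_mul_coeff_nonneg : 0 ≤ (C.coeffSign c a : ℝ) * C.coeff c a := by
  rw [coeffSign]
  split_ifs with h
  · simpa using h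
  · push Not at h
    simpa using h.le

end ChronContraction

/-- The exponent of the sign attached to a triple. -/
noncomputable def tripleExp (c b a : CrossinglessMatching n) : ℕ :=
  codim (regionSpace c) (regionSpace b) + codim (regionSpace b) (regionSpace a) +
    n * codim (regionSpace b) (regionSpace a) +
    Module.finrank ℝ (regionSpace c) * codim (regionSpace c) (regionSpace b) +
    Module.finrank ℝ (regionSpace c) * codim (regionSpace c) (regionSpace a) +
    Module.finrank ℝ (regionSpace b) * codim (regionSpace c) (regionSpace a) +
    codim (regionSpace c) (regionSpace b) * codim (regionSpace b) (regionSpace a) +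
    codim (regionSpace c) (regionSpace b) * codim (regionSpace c) (regionSpace a) +
    codim (regionSpace b) (regionSpace a) * codim (regionSpace c) (regionSpace a)

/-- The parity shift of a pair. -/
noncomputable def pairExp (c a : CrossinglessMatching n) : ℕ :=
  codim (regionSpace c) (regionSpace a) + Module.finrank ℝ (regionSpace a) + n

/-- The left side is the Koszul exponent from comparing the bracketings; the right side is the sum
of the triple exponents of the four triples and one mixed term. The triple exponents are designed
for this: the `s` are eliminated by the length relations, squares reduce by `x² = x` modulo 2, and
the terms with `kd` cancel in pairs. -/
theorem exponent_parity (n gdb gda gcb gdc gca gba kd kc kb s₁ s₂ s₄ : ℕ)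
    (h1 : s₁ + gda + n = kb + gdb + gba) (h2 : s₂ + gdb + n = kc + gdc + gcb)
    (h4 : s₄ + gca + n = kb + gcb + gba) :
    (-1 : ℤ) ^ (n * gdb + gdb * kb + n * (s₁ + gda) + s₁ * s₂ + kb * (gcb + gdc + kc) +
      (s₄ * (gda + n) + gca * s₄ + (kc + gdc) * (gca + s₄ + n + gcb + gba))) =
    (-1 : ℤ) ^ ((gdb + gba + n * gba + kd * gdb + kd * gda + kb * gda + gdb * gba + gdb * gda +
        gba * gda) +
      (gdc + gcb + n * gcb + kd * gdc + kd * gdb + kc * gdb + gdc * gcb + gdc * gdb + gcb * gdb) +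
      (gcb + gba + n * gba + kc * gcb + kc * gca + kb * gca + gcb * gba + gcb * gca + gba * gca) +
      (gdc + gca + n * gca + kd * gdc + kd * gda + kc * gda + gdc * gca + gdc * gda + gca * gda) +
      (gdc + kc + n) * s₄) := by
  rw [neg_one_pow_eq_pow_mod_two, neg_one_pow_eq_pow_mod_two (n := _ + _)]
  congr 1
  change _ ≡ _ [MOD 2]
  rw [← ZMod.natCast_eq_natCast_iff]
  have hsq : ∀ x : ZMod 2, x * x = x := by decide
  have e1 := congrArg (Nat.cast : ℕ → ZMod 2) h1
  have e2 := congrArg (Nat.cast : ℕ → ZMod 2) h2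
  have e4 := congrArg (Nat.cast : ℕ → ZMod 2) h4
  push_cast at e1 e2 e4 ⊢
  have := hsq n
  have := hsq gdb
  have := hsq gda
  have := hsq gcb
  have := hsq gdc
  have := hsq gca
  have := hsq gba
  have := hsq kd
  have := hsq kc
  have := hsq kb
  grind

/-- The two ways of splitting circles in a product of three factors agree up to sign, because both
lists of vectors span the same lattice. -/
theorem exists_sign_wedge_splitVecs {d c b a : CrossinglessMatching n} (D₁ : ChronContraction b)
    (D₂ D₃ : ChronContraction c) (D₄ : ChronContraction b) : ∃ η : ℤ, (η = 1 ∨ η = -1) ∧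
      map (pointMap (GluedAdj d a)) (wedge ℤ (D₁.splitVecs d a ++ D₂.splitVecs d b)) =
        η • map (pointMap (GluedAdj d a)) (wedge ℤ (D₃.splitVecs d a ++ D₄.splitVecs c a)) := by
  set L := D₁.splitVecs d a ++ D₂.splitVecs d b
  set L' := D₃.splitVecs d a ++ D₄.splitVecs c a
  set M := LinearMap.ker (pointMap (GluedAdj d a))
  have hlen : L.length = L'.length := by
    have h1 := D₁.two_mul_length_splitVecs d a
    have h2 := D₂.two_mul_length_splitVecs d b
    have h3 := D₃.two_mul_length_splitVecs d a
    have h4 := D₄.two_mul_length_splitVecs c a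
    simp only [L, L', List.length_append]
    omega
  have hsub : ∀ {l l' : List (Fin (2 * n) →₀ ℤ)} (hl : ∀ x ∈ l, x ∈ l'),
      Submodule.span ℤ {x | x ∈ l} ≤ Submodule.span ℤ {x | x ∈ l'} := fun hl =>
    Submodule.span_mono hl
  have hLb : ∀ i, arcVec b i ∈ Submodule.span ℤ {x | x ∈ L} ⊔ M := fun i =>
    sup_le_sup_right (hsub fun x hx => List.mem_append_left _ hx) M
      (D₁.arcVec_mem_splitVecs d a i)
  have hLc : ∀ i, arcVec c i ∈ Submodule.span ℤ {x | x ∈ L} ⊔ M := fun i =>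
    (sup_le (le_sup_of_le_left (hsub fun x hx => List.mem_append_right _ hx))
      (ker_pointMap_gluedAdj_le d b
        (fun i => Submodule.mem_sup_right (arcVec_mem_ker_upper d a i)) hLb) :
      _ ≤ Submodule.span ℤ {x | x ∈ L} ⊔ M) (D₂.arcVec_mem_splitVecs d b i)
  have hLc' : ∀ i, arcVec c i ∈ Submodule.span ℤ {x | x ∈ L'} ⊔ M := fun i =>
    sup_le_sup_right (hsub fun x hx => List.mem_append_left _ hx) M
      (D₃.arcVec_mem_splitVecs d a i)
  have hLb' : ∀ i, arcVec b i ∈ Submodule.span ℤ {x | x ∈ L'} ⊔ M := fun i =>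
    (sup_le (le_sup_of_le_left (hsub fun x hx => List.mem_append_right _ hx))
      (ker_pointMap_gluedAdj_le c a hLc'
        (fun i => Submodule.mem_sup_right (arcVec_mem_ker_lower d a i))) :
      _ ≤ Submodule.span ℤ {x | x ∈ L'} ⊔ M) (D₄.arcVec_mem_splitVecs c a i)
  have hmemL : ∀ x ∈ L, x ∈ Submodule.span ℤ {x | x ∈ L'} ⊔ M := by
    intro x hx
    simp only [L, ChronContraction.splitVecs, List.mem_append, List.mem_map] at hx
    rcases hx with ⟨i, -, rfl⟩ | ⟨i, -, rfl⟩
    · exact hLb' i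
    · exact hLc' i
  have hmemL' : ∀ x ∈ L', x ∈ Submodule.span ℤ {x | x ∈ L} ⊔ M := by
    intro x hx
    simp only [L', ChronContraction.splitVecs, List.mem_append, List.mem_map] at hx
    rcases hx with ⟨i, -, rfl⟩ | ⟨i, -, rfl⟩
    · exact hLc i
    · exact hLb i
  have hZ : M ≤ (annih (1 : ExteriorAlgebra ℤ (CircleGroup (GluedAdj d a)))).comap
      (pointMap (GluedAdj d a)) := by
    intro x hx
    rw [Submodule.mem_comap, LinearMap.mem_ker.mp hx]
    exact zero_mem _
  obtain ⟨β, hβ⟩ := exists_wedge_mul_eq_smul L' L M hlen hmemL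
  obtain ⟨γ, hγ⟩ := exists_wedge_mul_eq_smul L L' M hlen.symm hmemL'
  have h1 := hβ (pointMap (GluedAdj d a)) 1 hZ
  have h2 := hγ (pointMap (GluedAdj d a)) 1 hZ
  rw [mul_one, mul_one, ← map_wedge, ← map_wedge] at h1 h2
  -- If the wedge vanishes any sign will do. Otherwise the two transition scalars are inverse to
  -- each other, hence units of `ℤ`.
  by_cases h0 : map (pointMap (GluedAdj d a)) (wedge ℤ L') = 0
  · refine ⟨1, Or.inl rfl, ?_⟩
    rw [h1, h0, smul_zero, smul_zero]
  · refine ⟨β, ?_, h1⟩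
    have h3 := h2
    rw [h1, smul_smul] at h3
    have := isTorsionFree_exteriorAlgebra (Q := Circles (GluedAdj d a))
    have h4 : (1 - γ * β) • map (pointMap (GluedAdj d a)) (wedge ℤ L') = 0 := by
      rw [sub_smul, one_smul, ← h3, sub_self]
    have h5 := (smul_eq_zero.mp h4).resolve_right h0
    exact Int.isUnit_iff.mp (IsUnit.of_mul_eq_one_right γ (by linarith))

/-- If the wedges do not vanish in the circles of `W(d)a`, they can be compared in the plane model,
where positivity determines the abstract sign `η` in terms of the four triple signs and the Koszul
exponent. If they vanish, there is nothing to compare. -/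
theorem wedge_splitVecs_eq {d c b a : CrossinglessMatching n} (D₁ : ChronContraction b)
    (D₂ D₃ : ChronContraction c) (D₄ : ChronContraction b) :
    map (pointMap (GluedAdj d a)) (wedge ℤ (D₁.splitVecs d a) * wedge ℤ (D₂.splitVecs d b)) =
      ((-1) ^ (tripleExp d b a + tripleExp d c b + tripleExp c b a + tripleExp d c a +
        pairExp d c * (D₄.splitVecs c a).length) *
        (D₁.coeffSign d a * D₂.coeffSign d b * (D₃.coeffSign d a * D₄.coeffSign c a))) •
        map (pointMap (GluedAdj d a))
          (wedge ℤ (D₃.splitVecs d a) * wedge ℤ (D₄.splitVecs c a)) := by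
  obtain ⟨η, hη, h⟩ := exists_sign_wedge_splitVecs (d := d) (a := a) D₁ D₂ D₃ D₄
  rw [← wedge_append, ← wedge_append]
  by_cases h0 : map (pointMap (GluedAdj d a)) (wedge ℤ (D₁.splitVecs d a ++ D₂.splitVecs d b)) = 0
  · rw [h0]
    rw [h0] at h
    have : map (pointMap (GluedAdj d a))
        (wedge ℤ (D₃.splitVecs d a ++ D₄.splitVecs c a)) = 0 := by
      rcases hη with rfl | rfl
      · simpa using h.symm
      · simpa using h.symm
    rw [this, smul_zero]
  have e1 := h
  have e2 := h0
  rw [map_wedge, map_wedge] at e1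
  rw [map_wedge] at e2
  have e3 := wedge_latticeMap_ne_zero d a _ e2
  have e4 := wedge_latticeMap_eq_smul d a _ _ η e1
  rw [List.map_append, wedge_append, mul_assoc] at e3
  rw [List.map_append, List.map_append, wedge_append, wedge_append, mul_assoc, mul_assoc] at e4
  have hpos := pos_of_wedge_eq_smul (D₁.isTripleCoeff d a) (D₂.isTripleCoeff d b)
    (D₃.isTripleCoeff d a) (D₄.isTripleCoeff c a) η e4 e3
  simp only [ChronContraction.length_planeVecs, finrank_euclideanSpace_fin] at hpos
  have hpar := exponent_parity n (codim (regionSpace d) (regionSpace b))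
    (codim (regionSpace d) (regionSpace a)) (codim (regionSpace c) (regionSpace b))
    (codim (regionSpace d) (regionSpace c)) (codim (regionSpace c) (regionSpace a))
    (codim (regionSpace b) (regionSpace a)) (Module.finrank ℝ (regionSpace d))
    (Module.finrank ℝ (regionSpace c)) (Module.finrank ℝ (regionSpace b))
    _ _ _ (D₁.length_splitVecs d a) (D₂.length_splitVecs d b) (D₄.length_splitVecs c a)
  have hpar' := congrArg (Int.cast : ℤ → ℝ) hpar
  push_cast at hpar'
  rw [hpar'] at hpos
  rw [h]
  congr 1
  set E := tripleExp d b a + tripleExp d c b + tripleExp c b a + tripleExp d c a +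
        pairExp d c * (D₄.splitVecs c a).length with hE
  have hpos' : (0 : ℝ) < η * ((-1) ^ E *
    (D₁.coeff d a * D₂.coeff d b * (D₃.coeff d a * D₄.coeff c a))) := hpos
  have hθ := mul_nonneg (mul_nonneg (D₁.coeffSign_mul_coeff_nonneg d a)
    (D₂.coeffSign_mul_coeff_nonneg d b)) (mul_nonneg (D₃.coeffSign_mul_coeff_nonneg d a)
    (D₄.coeffSign_mul_coeff_nonneg c a))
  set θ := D₁.coeffSign d a * D₂.coeffSign d b * (D₃.coeffSign d a * D₄.coeffSign c a) with hθ'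
  have hθθ : θ * θ = 1 := by
    have : θ * θ = (D₁.coeffSign d a * D₁.coeffSign d a) * (D₂.coeffSign d b * D₂.coeffSign d b) *
      ((D₃.coeffSign d a * D₃.coeffSign d a) * (D₄.coeffSign c a * D₄.coeffSign c a)) := by
      rw [hθ']; ring
    rw [this, ChronContraction.coeffSign_mul_self, ChronContraction.coeffSign_mul_self,
      ChronContraction.coeffSign_mul_self, ChronContraction.coeffSign_mul_self]
    rfl
  set r := D₁.coeff d a * D₂.coeff d b * (D₃.coeff d a * D₄.coeff c a) with hr
  have hθr : 0 ≤ (θ : ℝ) * r := by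
    have e : (θ : ℝ) * r = (D₁.coeffSign d a * D₁.coeff d a) * (D₂.coeffSign d b * D₂.coeff d b) *
      ((D₃.coeffSign d a * D₃.coeff d a) * (D₄.coeffSign c a * D₄.coeff c a)) := by
      rw [hθ', hr]; push_cast; ring
    rw [e]
    exact hθ
  have hε : ((-1 : ℤ) ^ E = 1 ∨ (-1 : ℤ) ^ E = -1) := neg_one_pow_eq_or ℤ E
  have hθ1 : θ = 1 ∨ θ = -1 := Int.isUnit_iff.mp (IsUnit.of_mul_eq_one _ hθθ)
  have hεr : ((-1 : ℝ)) ^ E = (((-1 : ℤ) ^ E : ℤ) : ℝ) := by push_cast; rfl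
  rw [hεr] at hpos'
  generalize (-1 : ℤ) ^ E = ε at hε hpos' ⊢
  -- From `η ε r > 0` and `θ r ≥ 0` with all signs `±1` it follows that `η = ε θ`.
  rcases hη with rfl | rfl <;> rcases hε with rfl | rfl <;> rcases hθ1 with h1 | h1 <;>
    rw [h1] at hθr ⊢ <;> norm_num at hθr hpos' ⊢ <;> linarith

end Sign

open ExteriorAlgebra

/-! ## The twisted algebra -/

section Assembly

variable {n : ℕ}

theorem LinearMap.assoc_of_span_eq_top {R A : Type*} [CommRing R] [AddCommGroup A] [Module R A]
    (μ : A →ₗ[R] A →ₗ[R] A) {S : Set A} (hS : Submodule.span R S = ⊤)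
    (h : ∀ x ∈ S, ∀ y ∈ S, ∀ z ∈ S, μ (μ x y) z = μ x (μ y z)) (x y z : A) :
    μ (μ x y) z = μ x (μ y z) := by
  have hmem : ∀ x, x ∈ Submodule.span R S := fun x => by rw [hS]; trivial
  induction hmem x using Submodule.span_induction with
  | zero => simp
  | add u v _ _ hu hv => simp only [map_add, LinearMap.add_apply, hu, hv]
  | smul r u _ hu => simp only [map_smul, LinearMap.smul_apply, hu]
  | mem x hx =>
    induction hmem y using Submodule.span_induction with
    | zero => simp
    | add u v _ _ hu hv => simp only [map_add, LinearMap.add_apply, hu, hv]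
    | smul r u _ hu => simp only [map_smul, LinearMap.smul_apply, hu]
    | mem y hy =>
      induction hmem z using Submodule.span_induction with
      | zero => simp
      | add u v _ _ hu hv => simp only [map_add, hu, hv]
      | smul r u _ hu => simp only [map_smul, hu]
      | mem z hz => exact h x hx y hy z hz

/-! ### The twist, and associativity on generators -/

namespace OH

/-- The generator of `OH^n ⊗ ℤ[i]` given by a wedge of vectors attached to points. -/
noncomputable def gen (b a : CrossinglessMatching n) (l : List (Fin (2 * n) →₀ ℤ)) :
    GaussianInt ⊗[ℤ] OH n :=
  1 ⊗ₜ[ℤ] OH.incl b a (map (pointMap (GluedAdj b a)) (wedge ℤ l))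

theorem gen_eq_smul {b a : CrossinglessMatching n} {l l' : List (Fin (2 * n) →₀ ℤ)} {κ : ℤ}
    (h : map (pointMap (GluedAdj b a)) (wedge ℤ l) =
      κ • map (pointMap (GluedAdj b a)) (wedge ℤ l')) :
    gen b a l = (κ : GaussianInt) • gen b a l' := by
  rw [gen, gen, h, map_smul, TensorProduct.tmul_smul, Int.cast_smul_eq_zsmul]

theorem mem_span_wedge (b a : CrossinglessMatching n) (w : OddF (GluedAdj b a)) :
    w ∈ Submodule.span ℤ (Set.range fun l : List (Fin (2 * n) →₀ ℤ) =>
      map (pointMap (GluedAdj b a)) (wedge ℤ l)) := by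
  have hw : w ∈ Submodule.span ℤ (Set.range fun x : Σ k, Fin k → CircleGroup (GluedAdj b a) =>
      ιMulti ℤ x.1 x.2) := by
    rw [ιMulti_span]
    trivial
  refine Submodule.span_mono ?_ hw
  rintro _ ⟨⟨k, v⟩, rfl⟩
  choose u hu using fun i => pointMap_surjective (GluedAdj b a) (v i)
  refine ⟨List.ofFn u, ?_⟩
  change map (pointMap (GluedAdj b a)) (wedge ℤ (List.ofFn u)) = ιMulti ℤ k v
  rw [map_wedge, List.map_ofFn, ← ιMulti_eq_wedge]
  exact congrArg _ (funext hu)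

theorem sum_incl (x : OH n) : ∑ b, ∑ a, OH.incl b a (x b a) = x := by
  classical
  funext b a
  rw [Finset.sum_apply, Finset.sum_apply, Finset.sum_eq_single b, Finset.sum_apply,
    Finset.sum_apply, Finset.sum_eq_single a]
  · simp [OH.incl]
  · intro a' _ ha
    simp [OH.incl, ha.symm]
  · simp
  · intro b' _ hb
    rw [Finset.sum_apply, Finset.sum_apply]
    exact Finset.sum_eq_zero fun a' _ => by simp [OH.incl, hb.symm]
  · simp

theorem span_gen : Submodule.span GaussianInt
    {x : GaussianInt ⊗[ℤ] OH n | ∃ b a l, x = gen b a l} = ⊤ := by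
  rw [eq_top_iff]
  rintro x -
  set T := Submodule.span GaussianInt {x : GaussianInt ⊗[ℤ] OH n | ∃ b a l, x = gen b a l}
  have h1 : ∀ b a (w : OddF (GluedAdj b a)), (1 : GaussianInt) ⊗ₜ[ℤ] OH.incl b a w ∈ T := by
    intro b a w
    induction mem_span_wedge b a w using Submodule.span_induction with
    | mem w hw =>
      obtain ⟨l, rfl⟩ := hw
      exact Submodule.subset_span ⟨b, a, l, rfl⟩
    | zero => rw [map_zero, TensorProduct.tmul_zero]; exact zero_mem _
    | add u v _ _ hu hv => rw [map_add, TensorProduct.tmul_add]; exact add_mem hu hv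
    | smul k u _ hu =>
      rw [map_smul, TensorProduct.tmul_smul]
      exact zsmul_mem hu k
  induction x using TensorProduct.induction_on with
  | zero => exact zero_mem _
  | add u v hu hv => exact add_mem hu hv
  | tmul q w =>
    have : q ⊗ₜ[ℤ] w = q • (∑ b, ∑ a, (1 : GaussianInt) ⊗ₜ[ℤ] OH.incl b a (w b a)) := by
      simp only [← TensorProduct.tmul_sum]
      rw [sum_incl, TensorProduct.smul_tmul', smul_eq_mul, mul_one]
    rw [this]
    exact Submodule.smul_mem _ _ (Submodule.sum_mem _ fun b _ => Submodule.sum_mem _ fun a _ =>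
      h1 b a _)

/-- The morphism of `𝒢^n × 𝒵` given by a diagram and an integer. -/
def arcArrow (b a : CrossinglessMatching n) (m : ℤ) : Arrow (ArcGroupoid n) :=
  Arrow.mk (X := ((⟨a⟩, SingleObj.star _) : ArcGroupoid n))
    (Y := ((⟨b⟩, SingleObj.star _) : ArcGroupoid n))
    ((), (Multiplicative.ofAdd m : Multiplicative ℤ))

/-- The degree of the exterior products of `k` circles. -/
noncomputable def wedgeDegree (b a : CrossinglessMatching n) (k : ℕ) : ℤ :=
  2 * (k : ℤ) - Nat.card (Circles (GluedAdj b a)) + n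

theorem gen_mem_gaussPiece (b a : CrossinglessMatching n) (l : List (Fin (2 * n) →₀ ℤ)) :
    gen b a l ∈ OH.gaussPiece (arcArrow b a (wedgeDegree b a l.length)) := by
  refine Submodule.tmul_mem_baseChange_of_mem _ ⟨_, ?_, rfl⟩
  refine Submodule.mem_iSup_of_mem l.length (Submodule.mem_iSup_of_mem rfl ?_)
  rw [map_wedge]
  have e : wedge ℤ (l.map (pointMap (GluedAdj b a))) =
      ιMulti ℤ l.length fun i => pointMap (GluedAdj b a) (l.get i) := by
    rw [ιMulti_eq_wedge]
    congr 1
    change _ = List.ofFn (pointMap (GluedAdj b a) ∘ l.get)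
    rw [← List.map_ofFn, List.ofFn_get]
  rw [e]
  exact ιMulti_range ℤ l.length (Set.mem_range_self _)

variable (C : ContractionChoice n)

/-- The sign by which the product of a wedge of `k` circles is twisted. -/
noncomputable def twistSign (c b a : CrossinglessMatching n) (k : ℕ) : ℤ :=
  (C c b a).coeffSign c a * (-1) ^ (tripleExp c b a + (k + pairExp c b) * pairExp b a)

theorem twistSign_eq (c b a : CrossinglessMatching n) (k : ℕ) :
    twistSign C c b a k = 1 ∨ twistSign C c b a k = -1 := by
  refine Int.isUnit_iff.mp (IsUnit.mul ?_ (IsUnit.pow _ (by decide)))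
  exact IsUnit.of_mul_eq_one _ ((C c b a).coeffSign_mul_self c a)

open scoped Classical in
/-- The twist, with values in the subgroup of order two. -/
noncomputable def twist (F : ComposableArrows (ArcGroupoid n) 2) : ZMod 4 :=
  -- The left factor has degree `2k - |W(c)b| + n`; the formula solves this for the exterior degree
  -- `k`. Truncation and rounding only concern integers in which the homogeneous part is zero. The
  -- value `2` stands for `i² = -1`.
  if twistSign C (F.obj 2).1.as (F.obj 1).1.as (F.obj 0).1.as
    ((Multiplicative.toAdd (show Multiplicative ℤ from (F.map' 1 2).2) +
      Nat.card (Circles (GluedAdj (F.obj 2).1.as (F.obj 1).1.as)) - n) / 2).toNat = 1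
  then 0 else 2

theorem twistCoeff_twist (c b a : CrossinglessMatching n) (k k' : ℕ) :
    twistCoeff (fun F => gaussUnit (twist C F)) (arcArrow c b (wedgeDegree c b k))
      (arcArrow b a (wedgeDegree b a k')) = ((twistSign C c b a k : ℤ) : GaussianInt) := by
  have e : (arcArrow b a (wedgeDegree b a k')).right =
      (arcArrow c b (wedgeDegree c b k)).left := rfl
  rw [twistCoeff, dif_pos e]
  have hk : ((wedgeDegree c b k + Nat.card (Circles (GluedAdj c b)) - n) / 2).toNat = k := by
    rw [wedgeDegree]
    omega
  have ht : twist C (ComposableArrows.mk₂ (arcArrow b a (wedgeDegree b a k')).hom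
      (eqToHom e ≫ (arcArrow c b (wedgeDegree c b k)).hom)) =
      if twistSign C c b a k = 1 then 0 else 2 := by
    have h1 : ComposableArrows.mk₂ (arcArrow b a (wedgeDegree b a k')).hom
        (eqToHom e ≫ (arcArrow c b (wedgeDegree c b k)).hom) =
        ComposableArrows.mk₂ (arcArrow b a (wedgeDegree b a k')).hom
          (arcArrow c b (wedgeDegree c b k)).hom :=
      congrArg (ComposableArrows.mk₂ _) (Category.id_comp (arcArrow c b (wedgeDegree c b k)).hom)
    rw [h1]
    conv_rhs => rw [← hk]
    rfl
  rw [ht]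
  rcases twistSign_eq C c b a k with h | h
  · rw [h, if_pos rfl]
    simp [gaussUnit]
  · rw [h, if_neg (by decide)]
    rfl

theorem mul_incl (c b a : CrossinglessMatching n) (x : OddF (GluedAdj c b))
    (y : OddF (GluedAdj b a)) :
    OH.mul C (OH.incl c b x) (OH.incl b a y) = OH.incl c a ((C c b a).product c a x y) := by
  classical
  funext c' a'
  change ∑ b', (C c' b' a').product c' a' (OH.incl c b x c' b') (OH.incl b a y b' a') = _
  rw [Finset.sum_eq_single b]
  · by_cases hc : c' = c
    · subst hc
      by_cases ha : a' = a
      · subst ha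
        simp [OH.incl]
      · simp [OH.incl, ha]
    · simp [OH.incl, hc]
  · intro b' _ hb
    simp [OH.incl, hb]
  · simp

theorem twistedMul_gen (c b a : CrossinglessMatching n) (l l' : List (Fin (2 * n) →₀ ℤ)) :
    OH.twistedMul C (twist C) (gen c b l) (gen b a l') =
      ((twistSign C c b a l.length : ℤ) : GaussianInt) •
        gen c a ((C c b a).splitVecs c a ++ (l ++ l')) := by
  rw [OH.twistedMul, twistMul_apply _ _ _ _ (gen_mem_gaussPiece c b l) (gen_mem_gaussPiece b a l'),
    twistCoeff_twist]
  congr 1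
  rw [gen, gen, gen, OH.gaussMul, LinearMap.BilinMap.baseChange_tmul, mul_incl,
    ChronContraction.product_pointMap, wedge_append, wedge_append, mul_one]

theorem twistedMul_gen_of_ne (d c c' a : CrossinglessMatching n) (h : c ≠ c')
    (l l' : List (Fin (2 * n) →₀ ℤ)) :
    OH.twistedMul C (twist C) (gen d c l) (gen c' a l') = 0 := by
  rw [OH.twistedMul, twistMul_apply _ _ _ _ (gen_mem_gaussPiece d c l)
    (gen_mem_gaussPiece c' a l'), twistCoeff, dif_neg, zero_smul]
  intro e
  exact h (congrArg (fun X : ArcGroupoid n => X.1.as) e).symm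

/-- The left exponent collects the twists of `(xy)z`, the sign relating the two prefactors and the
sign of moving `x` past the splits of the inner product; the right one collects the twists of
`x(yz)`. Substituting the additivity of the pair exponents makes them agree modulo 2: the term `ldc
* s₄` is what the shift by pair exponents in the twist is for. -/
theorem sign_parity (t₁ t₂ t₃ t₄ kx ky ldc lcb lba ldb lca s₂ s₄ : ℕ)
    (h2 : (ldb + s₂) % 2 = (ldc + lcb) % 2) (h4 : (lca + s₄) % 2 = (lcb + lba) % 2) :
    (-1 : ℤ) ^ (t₂ + (kx + ldc) * lcb + (t₁ + (s₂ + (kx + ky) + ldb) * lba) +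
      (t₁ + t₂ + t₃ + t₄ + ldc * s₄) + kx * s₄) =
    (-1 : ℤ) ^ (t₃ + (ky + lcb) * lba + (t₄ + (kx + ldc) * lca)) := by
  rw [neg_one_pow_eq_pow_mod_two, neg_one_pow_eq_pow_mod_two (n := t₃ + _ + _)]
  congr 1
  change _ ≡ _ [MOD 2]
  rw [← ZMod.natCast_eq_natCast_iff]
  have e2 := (ZMod.natCast_eq_natCast_iff _ _ 2).mpr h2
  have e4 := (ZMod.natCast_eq_natCast_iff _ _ 2).mpr h4
  push_cast at e2 e4 ⊢
  grind

/-- Immediate from the number of splits. It says that exterior degree plus pair exponent is additive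
modulo 2 under the product. -/
theorem pairExp_parity {c b a : CrossinglessMatching n} (D : ChronContraction b) :
    (pairExp c a + (D.splitVecs c a).length) % 2 = (pairExp c b + pairExp b a) % 2 := by
  have := D.length_splitVecs c a
  simp only [pairExp]
  omega

/-- On generators both sides are one wedge with coefficient `±1`. The signs of the triples occur
once in the twists and once in the comparison of prefactors for the left bracketing, so those two
cancel and the two of the right bracketing remain. -/
theorem twistedMul_gen_assoc (d c b a : CrossinglessMatching n)
    (x y z : List (Fin (2 * n) →₀ ℤ)) :
    OH.twistedMul C (twist C) (OH.twistedMul C (twist C) (gen d c x) (gen c b y)) (gen b a z) =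
      OH.twistedMul C (twist C) (gen d c x)
        (OH.twistedMul C (twist C) (gen c b y) (gen b a z)) := by
  rw [twistedMul_gen, map_smul, LinearMap.smul_apply, twistedMul_gen, twistedMul_gen, map_smul,
    twistedMul_gen]
  set D₁ := C d b a
  set D₂ := C d c b
  set D₃ := C d c a
  set D₄ := C c b a
  have hw := wedge_splitVecs_eq (d := d) (a := a) D₁ D₂ D₃ D₄
  set κ : ℤ := (-1) ^ (tripleExp d b a + tripleExp d c b + tripleExp c b a + tripleExp d c a +
    pairExp d c * (D₄.splitVecs c a).length) *
    (D₁.coeffSign d a * D₂.coeffSign d b * (D₃.coeffSign d a * D₄.coeffSign c a)) with hκ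
  have hgen : gen d a (D₁.splitVecs d a ++ (D₂.splitVecs d b ++ (x ++ y) ++ z)) =
      ((κ * (-1) ^ (x.length * (D₄.splitVecs c a).length) : ℤ) : GaussianInt) •
        gen d a (D₃.splitVecs d a ++ (x ++ (D₄.splitVecs c a ++ (y ++ z)))) := by
    refine gen_eq_smul ?_
    have e1 : wedge ℤ (D₁.splitVecs d a ++ (D₂.splitVecs d b ++ (x ++ y) ++ z)) =
        wedge ℤ (D₁.splitVecs d a) * wedge ℤ (D₂.splitVecs d b) * wedge ℤ (x ++ (y ++ z)) := by
      simp only [wedge_append, mul_assoc]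
    have e2 : wedge ℤ (D₃.splitVecs d a ++ (x ++ (D₄.splitVecs c a ++ (y ++ z)))) =
        (-1 : ℤ) ^ (x.length * (D₄.splitVecs c a).length) •
        (wedge ℤ (D₃.splitVecs d a) * wedge ℤ (D₄.splitVecs c a) * wedge ℤ (x ++ (y ++ z))) := by
      simp only [wedge_append]
      rw [← mul_assoc (wedge ℤ x), wedge_mul_wedge_comm ℤ x]
      simp only [mul_smul_comm, smul_mul_assoc, mul_assoc]
    rw [e1, e2, map_mul, hw, map_smul, map_mul _ _ (wedge ℤ (x ++ (y ++ z))), smul_mul_assoc,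
      smul_smul, mul_assoc, ← pow_add, ← two_mul, pow_mul]
    simp
  rw [hgen, smul_smul, smul_smul, smul_smul]
  congr 1
  rw [← Int.cast_mul, ← Int.cast_mul, ← Int.cast_mul]
  congr 1
  have hpar := sign_parity (tripleExp d b a) (tripleExp d c b) (tripleExp c b a)
    (tripleExp d c a) x.length y.length _ _ _ _ _ _ _ (pairExp_parity (c := d) (a := b) D₂)
    (pairExp_parity (c := c) (a := a) D₄)
  have h1 := D₁.coeffSign_mul_self d a
  have h2 := D₂.coeffSign_mul_self d b
  simp only [twistSign, List.length_append, hκ]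
  calc _ = (D₁.coeffSign d a * D₁.coeffSign d a) * (D₂.coeffSign d b * D₂.coeffSign d b) *
        (D₃.coeffSign d a * D₄.coeffSign c a) * _ := by
        -- Here `s, t` are the signs of the triples of `(xy)z`, which become squares, and `u, v`
        -- those of `x(yz)`.
        rw [show ∀ s t u v e₁ e₂ e₃ e₄ : ℤ, t * e₁ * (s * e₂) * (e₃ * (s * t * (u * v)) * e₄) =
          s * s * (t * t) * (u * v) * (e₁ * e₂ * e₃ * e₄) from fun _ _ _ _ _ _ _ _ => by ring]
    _ = _ := by
        rw [h1, h2, ← pow_add, ← pow_add, ← pow_add, hpar, pow_add]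
        ring

end OH

end Assembly

theorem mainTheorem4 (n : ℕ) (C : ContractionChoice n) :
    ∃ τ : ComposableArrows (ArcGroupoid n) 2 → ZMod 4,
      ∀ x y z : GaussianInt ⊗[ℤ] OH n,
        OH.twistedMul C τ (OH.twistedMul C τ x y) z =
          OH.twistedMul C τ x (OH.twistedMul C τ y z) := by
  refine ⟨OH.twist C, LinearMap.assoc_of_span_eq_top _ OH.span_gen ?_⟩
  rintro _ ⟨d, c, x, rfl⟩ _ ⟨c', b, y, rfl⟩ _ ⟨b', a, z, rfl⟩
  -- If a pair of adjacent generators is not composable, both bracketings vanish, since the product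
  -- of the other pair keeps its outer matchings.
  by_cases hc : c = c'
  · subst hc
    by_cases hb : b = b'
    · subst hb
      exact OH.twistedMul_gen_assoc C d c b a x y z
    · rw [OH.twistedMul_gen, map_smul, LinearMap.smul_apply, OH.twistedMul_gen_of_ne _ _ _ _ _ hb,
        OH.twistedMul_gen_of_ne _ _ _ _ _ hb, smul_zero, map_zero]
  · rw [OH.twistedMul_gen_of_ne _ _ _ _ _ hc, map_zero, LinearMap.zero_apply]
    by_cases hb : b = b'
    · subst hb
      rw [OH.twistedMul_gen, map_smul, OH.twistedMul_gen_of_ne _ _ _ _ _ hc, smul_zero]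
    · rw [OH.twistedMul_gen_of_ne _ _ _ _ _ hb, map_zero]
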